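/- Setting. Let $Q$ be a finite-dimensional smooth (Hausdorff) manifold without boundary, $g$ a smooth Riemannian metric on $Q$, $V:Q\to\mathbb R$ a smooth function, $\mathcal D$ a smooth distribution of rank $r$ on $Q$ (not necessarily integrable), and $e\in\mathbb R$. Let $U_e=\{q\in Q: V(q)<e\}$, let $g_e=(e-V)g$ be the Jacobi metric on $U_e$, and $\mathcal D_e=\mathcal D|_{U_e}$. Let $\mathcal D^\perp$ be the $g$-orthogonal complement of $\mathcal D$ and $P$, $P'=1-P$ the orthogonal projectors onto $\mathcal D$, $\mathcal D^\perp$ (these are the same for $g$ and $g_e$ over $U_e$). Identify $\mathcal D^*$ with the annihilator of $\mathcal D^\perp$ in $T^*Q$, and let $\mathcal D_e^*$ be its part over $U_e$. Let $\pi:T^*Q\to Q$ be the projection, $\theta_Q$ the canonical 1-form of $T^*Q$ and $\omega_Q=-d\theta_Q$. For $N=\mathcal D^*$ or $N=\mathcal D^*_e$ put $\mathcal T_\alpha N=\{X\in T_\alpha N: T_\alpha\pi(X)\in\mathcal D_{\pi(\alpha)}\}$ (so $\mathcal T N$ is the bundle written $\mathcal T^{\mathcal D^*}\mathcal D^*$,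 resp. $\mathcal T^{\mathcal D_e^*}\mathcal D_e^*$). Put $H_{(g,V)}(\alpha)=\tfrac12\|\alpha\|_g^2+V(\pi(\alpha))$ on $T^*Q$ and $H_{g_e}(\alpha)=\tfrac12\|\alpha\|_{g_e}^2$ on $T^*U_e$, with the norms of the co-metrics. Let $X_{(g,V,\mathcal D)}$ be the smooth section of $\mathcal T\mathcal D^*$ over $\mathcal D^*$ with $\omega_Q(X_{(g,V,\mathcal D)},Y)=dH_{(g,V)}(Y)$ for all $Y\in\mathcal T\mathcal D^*$, and $X_{(g_e,\mathcal D_e)}$ the smooth section of $\mathcal T\mathcal D_e^*$ over $\mathcal D_e^*$ with $\omega_Q(X_{(g_e,\mathcal D_e)},Y)=dH_{g_e}(Y)$ for all $Y\in\mathcal T\mathcal D_e^*$ (both exist and are unique). Let $$S_e^*=\{\alpha\in\mathcal D_e^*:\ \|\alpha\|_g^2=2(e-V(\pi(\alpha)))\}.$$ With the nonholonomic connection $\nabla^{nh}_XY=P(\nabla^g_XY)+\nabla^g_X(P'Y)$, a trajectory in $U_e$ of $(g,V,\mathcal D)$ is a $C^2$ curve $c$ from an open interval containing $0$ to $U_e$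 with $\nabla^{nh}_{\dot c}\dot c+P(\operatorname{grad}^gV)=0$ and $\dot c(0)\in\mathcal D$; a trajectory of $(g_e,\mathcal D_e)$ is defined in the same way with $g_e$ in place of $g$ and $0$ in place of $V$. Theorem. 1. $S_e^*=(H_{(g,V)}|_{\mathcal D_e^*})^{-1}(e)=(H_{g_e}|_{\mathcal D_e^*})^{-1}(1)$. For $\alpha\in S_e^*$ over $q$, $dH_{(g,V)}(\alpha)=(e-V(q))\,dH_{g_e}(\alpha)\neq0$ on $\mathcal T_\alpha\mathcal D_e^*$. The set $S_e^*$ is a submanifold of codimension $1$ of $\mathcal D_e^*$, with $$T_\alpha S_e^*=\{X\in T_\alpha\mathcal D_e^*: dH_{(g,V)}(\alpha)(X)=0\}=\{X\in T_\alpha\mathcal D_e^*: dH_{g_e}(\alpha)(X)=0\},$$ and $\pi:S_e^*\to U_e$ is a smooth locally trivial bundle with typical fibre the sphere $S^{r-1}$; its fibre at $q$ is the sphere in $\mathcal D_q^*$ with centre $0$ and radius $\sqrt{2(e-V(q))}$ for $g$. 2. The spaces $(\mathcal C_e)_\alpha=T_\alpha S_e^*\cap\mathcal T_\alpha\mathcal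 D_e^*$, $\alpha\in S_e^*$, form a smooth vector bundle $\mathcal C_e$ of rank $2r-1$ over $S_e^*$. The restrictions $(\theta_Q)_e$, $(\omega_Q)_e$ of $\tfrac12\theta_Q$, $\tfrac12\omega_Q$ to $\mathcal C_e$ are a contact bundle structure on $\mathcal C_e$, that is, $(\theta_Q)_e\wedge(\omega_Q)_e^{\,r-1}$ vanishes at no point of $S_e^*$. Its Reeb section $R_e$, the unique smooth section of $\mathcal C_e$ with $i_{R_e}(\theta_Q)_e=1$ and $i_{R_e}(\omega_Q)_e=0$, is $X_{(g_e,\mathcal D_e)}|_{S_e^*}$. 3. $(e-V)R_e=X_{(g,V,\mathcal D)}$ on $S_e^*$. 4. Let $q\in U_e$, $0\ne v\in\mathcal D_q$, $\mathcal P_q(v)=\sqrt{2(e-V(q))}\,v/\|v\|_g$ and $\mathcal Q_q(v)=\sqrt{2/(e-V(q))}\,v/\|v\|_g$. Let $c_{\mathcal P}:J\to U_e$ be a trajectory of $(g,V,\mathcal D)$ in $U_e$ with initial velocity $\mathcal P_q(v)$ and $c_{\mathcal Q}:I\to U_e$ a trajectory of $(g_e,\mathcal D_e)$ with initial velocity $\mathcal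 Q_q(v)$. Then there is a strictly increasing function $h$ on $J$ with $$\frac{dh}{ds}=e-V\circ c_{\mathcal P},\qquad h(0)=0,$$ and $c_{\mathcal P}(s)=c_{\mathcal Q}(h(s))$ for all $s\in J$ with $h(s)\in I$. If $c_{\mathcal Q}$ is maximal, then $h(J)\subseteq I$; if $c_{\mathcal P}$ is maximal, then $I\subseteq h(J)$. In particular, if both are maximal, then $h$ is a bijection from $J$ onto $I$ and $c_{\mathcal P}=c_{\mathcal Q}\circ h$ on $J$. -/

import Mathlib

open Set Bundle
open scoped Manifold ContDiff Topology

noncomputable section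

namespace Nonholonomic

/-! ### Submanifolds, subbundles and differential forms on a smooth manifold -/

section General

variable {EM : Type*} [NormedAddCommGroup EM] [NormedSpace ℝ EM]
  {HM : Type*} [TopologicalSpace HM] (J : ModelWithCorners ℝ EM HM)
  {M : Type*} [TopologicalSpace M] [ChartedSpace HM M] [IsManifold J ∞ M]

/-- The tangent vectors at `x` to a subset `S` of `M`: the velocities at time `0` of the smooth
curves of `M` that pass through `x` at time `0` and stay in `S`. For an embedded submanifold `S`
and `x ∈ S` this is the tangent space `T_x S`, seen inside `T_x M`. -/
def tangentSet (S : Set M) (x : M) : Set (TangentSpace J x) :=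
  {v | ∃ γ : ℝ → M, γ 0 = x ∧ ContMDiffAt 𝓘(ℝ, ℝ) J ∞ γ 0 ∧ (∀ᶠ t in 𝓝 (0 : ℝ), γ t ∈ S) ∧
    (⟨γ 0, mfderiv 𝓘(ℝ, ℝ) J γ 0 (1 : ℝ)⟩ : TangentBundle J M) = ⟨x, v⟩}

/-- `S ⊆ N` is an embedded submanifold of codimension `k` in the submanifold `N` of `M`: around
every point of `S` there is a smooth chart of `M` in which `N` is a linear subspace `K` and `S` is
a linear subspace `K'` of codimension `k` in `K`. -/
def IsSubmanifoldOfCodim (S N : Set M) (k : ℕ) : Prop :=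
  S ⊆ N ∧ ∀ x ∈ S, ∃ φ ∈ IsManifold.maximalAtlas J ∞ M, x ∈ φ.source ∧
    ∃ K K' : Submodule ℝ EM, K' ≤ K ∧ Module.finrank ℝ K = Module.finrank ℝ K' + k ∧
      ∀ y ∈ φ.source, (y ∈ N ↔ φ.extend J y ∈ K) ∧ (y ∈ S ↔ φ.extend J y ∈ K')

/-- The vector field `X` is smooth along `S`: near every point of `S` it agrees on `S` with a
smooth vector field defined on an open subset of `M`. -/
def IsSmoothAlong (S : Set M) (X : ∀ x : M, TangentSpace J x) : Prop :=
  ∀ x ∈ S, ∃ W : Set M, IsOpen W ∧ x ∈ W ∧ ∃ Y : ∀ y : M, TangentSpace J y,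
    ContMDiffOn J J.tangent ∞ (fun y => (⟨y, Y y⟩ : TangentBundle J M)) W ∧
      ∀ y ∈ W ∩ S, Y y = X y

/-- `X` is a smooth section over `S` of the family `F` of sets of tangent vectors. -/
def IsSmoothSection (S : Set M) (F : ∀ x : M, Set (TangentSpace J x))
    (X : ∀ x : M, TangentSpace J x) : Prop :=
  IsSmoothAlong J S X ∧ ∀ x ∈ S, X x ∈ F x

/-- `F` is a smooth vector bundle of rank `k` over `S`, a subbundle of `TM` restricted to `S`:
near every point of `S` its fibres are spanned by `k` smooth, linearly independent fields. -/
def IsSmoothSubbundle (S : Set M) (F : ∀ x : M, Set (TangentSpace J x)) (k : ℕ) : Prop :=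
  ∀ x ∈ S, ∃ W : Set M, IsOpen W ∧ x ∈ W ∧ ∃ s : Fin k → ∀ y : M, TangentSpace J y,
    (∀ i, ContMDiffOn J J.tangent ∞ (fun y => (⟨y, s i y⟩ : TangentBundle J M)) W) ∧
      ∀ y ∈ W ∩ S, LinearIndependent ℝ (fun i => s i y) ∧
        (Submodule.span ℝ (Set.range fun i => s i y) : Set (TangentSpace J y)) = F y

/-- The exterior derivative of a `1`-form `η` at `x`, computed in the chart of `M` at `x`: if
`η'` is the form that represents `η` in the chart, then `dη(v, w) = (D_v η')(w) - (D_w η')(v)`. -/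
def extDerivOneForm (η : ∀ x : M, TangentSpace J x →L[ℝ] ℝ) (x : M)
    (v w : TangentSpace J x) : ℝ :=
  let φ := extChartAt J x
  let η' : EM → EM →L[ℝ] ℝ := fun y =>
    (η (φ.symm y)).comp (mfderivWithin 𝓘(ℝ, EM) J φ.symm (Set.range J) y)
  let v' : EM := mfderiv J 𝓘(ℝ, EM) φ x v
  let w' : EM := mfderiv J 𝓘(ℝ, EM) φ x w
  fderivWithin ℝ η' (Set.range J) (φ x) v' w' - fderivWithin ℝ η' (Set.range J) (φ x) w' v'

/-- The value of the exterior product `θ ∧ om ^ k` of a `1`-form and the `k`-th power of a `2`-form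
on `2 * k + 1` vectors. -/
def wedgePow {T : Type*} (θ : T → ℝ) (om : T → T → ℝ) (k : ℕ) (v : Fin (2 * k + 1) → T) : ℝ :=
  (1 / 2 : ℝ) ^ k * ∑ σ : Equiv.Perm (Fin (2 * k + 1)), ((Equiv.Perm.sign σ : ℤ) : ℝ) *
    (θ (v (σ 0)) * ∏ i : Fin k, om (v (σ ⟨2 * i + 1, by omega⟩)) (v (σ ⟨2 * i + 2, by omega⟩)))

/-- `(θ, om)` is a contact bundle structure on the family `C` of tangent subspaces over `S`: `C` is
a smooth vector bundle of rank `2 * k + 1` over `S`, `θ` and `om` restrict to a smooth section of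
the dual of `C` and to a smooth section of the second exterior power of the dual of `C`, and
`θ ∧ om ^ k` vanishes at no point of `S`. -/
structure IsContactBundle (S : Set M) (C : ∀ x : M, Set (TangentSpace J x))
    (θ : ∀ x : M, TangentSpace J x → ℝ) (om : ∀ x : M, TangentSpace J x → TangentSpace J x → ℝ)
    (k : ℕ) : Prop where
  subbundle : IsSmoothSubbundle J S C (2 * k + 1)
  theta_linear : ∀ x ∈ S, ∀ a b : ℝ, ∀ u ∈ C x, ∀ v ∈ C x,
    θ x (a • u + b • v) = a * θ x u + b * θ x v
  omega_linear : ∀ x ∈ S, ∀ a b : ℝ, ∀ u ∈ C x, ∀ v ∈ C x, ∀ w ∈ C x,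
    om x (a • u + b • v) w = a * om x u w + b * om x v w
  omega_alternating : ∀ x ∈ S, ∀ u ∈ C x, ∀ v ∈ C x, om x u v = - om x v u
  theta_smooth : ∀ W : Set M, IsOpen W → ∀ X : ∀ x : M, TangentSpace J x,
    IsSmoothSection J (W ∩ S) C X → ContMDiffOn J 𝓘(ℝ, ℝ) ∞ (fun x => θ x (X x)) (W ∩ S)
  omega_smooth : ∀ W : Set M, IsOpen W → ∀ X Y : ∀ x : M, TangentSpace J x,
    IsSmoothSection J (W ∩ S) C X → IsSmoothSection J (W ∩ S) C Y →
      ContMDiffOn J 𝓘(ℝ, ℝ) ∞ (fun x => om x (X x) (Y x)) (W ∩ S)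
  nonvanishing : ∀ x ∈ S, ∃ v : Fin (2 * k + 1) → TangentSpace J x,
    (∀ i, v i ∈ C x) ∧ wedgePow (θ x) (om x) k v ≠ 0

/-- `R` is a Reeb section of `(C, θ, om)`: a smooth section of `C` over `S` with `i_R θ = 1` and
`i_R om = 0`. -/
structure IsReebSection (S : Set M) (C : ∀ x : M, Set (TangentSpace J x))
    (θ : ∀ x : M, TangentSpace J x → ℝ) (om : ∀ x : M, TangentSpace J x → TangentSpace J x → ℝ)
    (R : ∀ x : M, TangentSpace J x) : Prop where
  section_mem : IsSmoothSection J S C R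
  theta_eq : ∀ x ∈ S, θ x (R x) = 1
  omega_eq : ∀ x ∈ S, ∀ v ∈ C x, om x (R x) v = 0

variable {EB : Type*} [NormedAddCommGroup EB] [NormedSpace ℝ EB]
  {HB : Type*} [TopologicalSpace HB] (I : ModelWithCorners ℝ EB HB)
  {B : Type*} [TopologicalSpace B] [ChartedSpace HB B]

/-- The subset `S` of `M`, with the restriction of `p : M → B`, is a smooth bundle over the open
subset `U` of `B` whose typical fibre is the unit sphere of `ℝ^r`: it lies over `U`, and over a
neighbourhood `W` of every point of `U` there is a diffeomorphism `x ↦ (p x, Φ x)` of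
`S ∩ p⁻¹(W)` onto `W × S^{r-1}`, with inverse `Ψ`. -/
def IsSphereBundle (p : M → B) (S : Set M) (U : Set B) (r : ℕ) : Prop :=
  (∀ x ∈ S, p x ∈ U) ∧ ∀ b ∈ U, ∃ W : Set B, IsOpen W ∧ b ∈ W ∧ W ⊆ U ∧
    ∃ (Φ : M → EuclideanSpace ℝ (Fin r)) (Ψ : B × EuclideanSpace ℝ (Fin r) → M),
      ContMDiffOn J 𝓘(ℝ, EuclideanSpace ℝ (Fin r)) ∞ Φ (p ⁻¹' W) ∧
      ContMDiffOn (I.prod 𝓘(ℝ, EuclideanSpace ℝ (Fin r))) J ∞ Ψ (W ×ˢ univ) ∧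
      (∀ x ∈ S, p x ∈ W → Φ x ∈ Metric.sphere 0 1 ∧ Ψ (p x, Φ x) = x) ∧
      ∀ c ∈ W, ∀ y ∈ Metric.sphere (0 : EuclideanSpace ℝ (Fin r)) 1,
        Ψ (c, y) ∈ S ∧ p (Ψ (c, y)) = c ∧ Φ (Ψ (c, y)) = y

end General

/-! ### Nonholonomic mechanical systems -/

section Mechanics

variable {E : Type*} [NormedAddCommGroup E] [NormedSpace ℝ E]
  {Q : Type*} [TopologicalSpace Q] [ChartedSpace E Q]

/-- A field of bilinear forms on the tangent spaces of `Q` (in use: a Riemannian metric, or the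
Jacobi metric, which is a metric on an open subset only). -/
abbrev MetricField (E : Type*) [NormedAddCommGroup E] [NormedSpace ℝ E]
    (Q : Type*) [TopologicalSpace Q] [ChartedSpace E Q] :=
  ∀ q : Q, TangentSpace 𝓘(ℝ, E) q →L[ℝ] TangentSpace 𝓘(ℝ, E) q →L[ℝ] ℝ

/-- A (not necessarily integrable) family of subspaces of the tangent spaces of `Q`. -/
abbrev DistField (E : Type*) [NormedAddCommGroup E] [NormedSpace ℝ E]
    (Q : Type*) [TopologicalSpace Q] [ChartedSpace E Q] :=
  ∀ q : Q, Submodule ℝ (TangentSpace 𝓘(ℝ, E) q)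

variable (g : MetricField E Q) (V : Q → ℝ) (D : DistField E Q)

/-- `D` is a smooth distribution of rank `r` on `Q`. -/
def IsDistribution [IsManifold 𝓘(ℝ, E) ∞ Q] (D : DistField E Q) (r : ℕ) : Prop :=
  IsSmoothSubbundle 𝓘(ℝ, E) (univ : Set Q) (fun q => (D q : Set (TangentSpace 𝓘(ℝ, E) q))) r

/-- The norm `‖v‖_g`. -/
def gNorm (q : Q) (v : TangentSpace 𝓘(ℝ, E) q) : ℝ := √(g q v v)

/-- The isomorphism `♯ : T_q^*Q → T_qQ`, inverse to `♭ : v ↦ g(v, ·)`. -/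
def sharp (q : Q) : (TangentSpace 𝓘(ℝ, E) q →L[ℝ] ℝ) →L[ℝ] TangentSpace 𝓘(ℝ, E) q :=
  ContinuousLinearMap.inverse (g q)

/-- The co-metric `g^♯(α, β) = g(♯α, ♯β)`. -/
def cometric (q : Q) (α β : TangentSpace 𝓘(ℝ, E) q →L[ℝ] ℝ) : ℝ :=
  g q (sharp g q α) (sharp g q β)

/-- The gradient of `V` with respect to `g`. -/
def grad (q : Q) : TangentSpace 𝓘(ℝ, E) q := sharp g q (mfderiv 𝓘(ℝ, E) 𝓘(ℝ, ℝ) V q)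

/-- The orthogonal distribution `D^⊥`. -/
def orth (q : Q) : Submodule ℝ (TangentSpace 𝓘(ℝ, E) q) where
  carrier := {v | ∀ u ∈ D q, g q u v = 0}
  add_mem' := by
    intro a b ha hb u hu
    rw [map_add, ha u hu, hb u hu, add_zero]
  zero_mem' := by
    intro u _
    rw [map_zero]
  smul_mem' := by
    intro c a ha u hu
    rw [map_smul, ha u hu, smul_zero]

open Classical in
/-- The `g`-orthogonal projector `P : T_qQ → D_q`, as a map into `T_qQ`. (The tangent space is the
direct sum of `D_q` and `D_q^⊥` whenever `g` is positive definite at `q`: see `isCompl_orth`.) -/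
def proj (q : Q) : TangentSpace 𝓘(ℝ, E) q →ₗ[ℝ] TangentSpace 𝓘(ℝ, E) q :=
  if h : IsCompl (D q) (orth g D q) then (D q).projection (orth g D q) h else 0

theorem isCompl_orth [FiniteDimensional ℝ E] (q : Q)
    (hs : ∀ v w, g q v w = g q w v) (hp : ∀ v, v ≠ 0 → 0 < g q v v) :
    IsCompl (D q) (orth g D q) := by
  let B : LinearMap.BilinForm ℝ (TangentSpace 𝓘(ℝ, E) q) :=
    LinearMap.mk₂ ℝ (fun v w => g q v w) (by simp) (by simp) (by simp) (by simp)
  have hB : B.IsRefl := fun v w h => by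
    change g q w v = 0
    rw [hs]
    exact h
  have ho : orth g D q = B.orthogonal (D q) := by
    ext v
    exact Iff.rfl
  have : FiniteDimensional ℝ (TangentSpace 𝓘(ℝ, E) q) := inferInstanceAs (FiniteDimensional ℝ E)
  rw [ho, LinearMap.BilinForm.isCompl_orthogonal_iff_disjoint hB, Submodule.disjoint_def]
  intro v hv hv'
  by_contra h0
  exact (hp v h0).ne' (hv' v hv)

/-- The velocity of a curve. -/
def velocity (c : ℝ → Q) (t : ℝ) : TangentSpace 𝓘(ℝ, E) (c t) :=
  mfderiv 𝓘(ℝ, ℝ) 𝓘(ℝ, E) c t (1 : ℝ)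

/-- The coefficients of the metric in the chart around `p`, as a bilinear form at the point `y` of
the model space. -/
def metricInChart (p : Q) (y : E) : E →L[ℝ] E →L[ℝ] ℝ :=
  let dψ : E →L[ℝ] TangentSpace 𝓘(ℝ, E) ((extChartAt 𝓘(ℝ, E) p).symm y) :=
    mfderiv 𝓘(ℝ, E) 𝓘(ℝ, E) (extChartAt 𝓘(ℝ, E) p).symm y
  ((ContinuousLinearMap.precomp ℝ dψ).comp (g ((extChartAt 𝓘(ℝ, E) p).symm y))).comp dψ

set_option synthInstance.maxHeartbeats 200000 in
/-- The Christoffel symbols `Γ(u, w)` of the Levi-Civita connection of `g` in the chart around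
`p`: `2 g(Γ(u, w), z) = (D_u g)(w, z) + (D_w g)(u, z) - (D_z g)(u, w)`. -/
def christoffel (p : Q) (y u w : E) : E :=
  let dG : E →L[ℝ] E →L[ℝ] E →L[ℝ] ℝ := fderiv ℝ (metricInChart g p) y
  ContinuousLinearMap.inverse (metricInChart g p y)
    ((1 / 2 : ℝ) • (dG u w + dG w u - (dG.flip u).flip w))

/-- The Levi-Civita covariant derivative `∇^g_{ċ} W` at time `t` of a vector field `W` along the
curve `c`, computed in the chart around `c t`. -/
def covDeriv (c : ℝ → Q) (W : ∀ s : ℝ, TangentSpace 𝓘(ℝ, E) (c s)) (t : ℝ) :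
    TangentSpace 𝓘(ℝ, E) (c t) :=
  let φ := extChartAt 𝓘(ℝ, E) (c t)
  let x : ℝ → E := fun s => φ (c s)
  let W' : ℝ → E := fun s => mfderiv 𝓘(ℝ, E) 𝓘(ℝ, E) φ (c s) (W s)
  ContinuousLinearMap.inverse (mfderiv 𝓘(ℝ, E) 𝓘(ℝ, E) φ (c t))
    (deriv W' t + christoffel g (c t) (x t) (deriv x t) (W' t))

/-- The nonholonomic connection along a curve,
`∇^{nh}_{ċ} W = P (∇^g_{ċ} W) + ∇^g_{ċ} (P' W)` with `P' = 1 - P`. -/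
def nhCovDeriv (c : ℝ → Q) (W : ∀ s : ℝ, TangentSpace 𝓘(ℝ, E) (c s)) (t : ℝ) :
    TangentSpace 𝓘(ℝ, E) (c t) :=
  proj g D (c t) (covDeriv g c W t) + covDeriv g c (fun s => W s - proj g D (c s) (W s)) t

/-- `c`, on the open interval `J ∋ 0`, is a trajectory in the open set `U` of the nonholonomic
system with metric `g`, potential `V` and distribution `D`:
`∇^{nh}_{ċ} ċ + P (grad V) = 0` and `ċ(0) ∈ D`. -/
structure IsTrajectory (U : Set Q) (J : Set ℝ) (c : ℝ → Q) : Prop where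
  isOpen : IsOpen J
  ordConnected : J.OrdConnected
  zero_mem : (0 : ℝ) ∈ J
  contMDiffOn : ContMDiffOn 𝓘(ℝ, ℝ) 𝓘(ℝ, E) 2 c J
  mapsTo : MapsTo c J U
  initial_mem : velocity (E := E) c 0 ∈ D (c 0)
  equation : ∀ t ∈ J, nhCovDeriv g D c (velocity c) t + proj g D (c t) (grad g V (c t)) = 0

/-- A trajectory in `U` that is defined on its maximal interval of existence. -/
def IsMaximalTrajectory (U : Set Q) (J : Set ℝ) (c : ℝ → Q) : Prop :=
  IsTrajectory g V D U J c ∧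
    ∀ J' c', IsTrajectory g V D U J' c' → J ⊆ J' → EqOn c' c J → J' = J

/-- The curve `c` starts at `q` with velocity `v`. -/
def HasInitialVelocity (c : ℝ → Q) (q : Q) (v : TangentSpace 𝓘(ℝ, E) q) : Prop :=
  (⟨c 0, velocity c 0⟩ : TangentBundle 𝓘(ℝ, E) Q) = ⟨q, v⟩

/-! ### The Hamiltonian side -/

/-- The cotangent bundle `T^*Q`. -/
abbrev Cotangent (E : Type*) [NormedAddCommGroup E] [NormedSpace ℝ E]
    (Q : Type*) [TopologicalSpace Q] [ChartedSpace E Q] [IsManifold 𝓘(ℝ, E) ∞ Q] :=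
  TotalSpace (E →L[ℝ] ℝ) (fun q : Q => TangentSpace 𝓘(ℝ, E) q →L[ℝ] ℝ)

/-- The model with corners of the (boundaryless) manifold `T^*Q`. -/
abbrev cotModel (E : Type*) [NormedAddCommGroup E] [NormedSpace ℝ E] :=
  𝓘(ℝ, E).prod 𝓘(ℝ, E →L[ℝ] ℝ)

variable [IsManifold 𝓘(ℝ, E) ∞ Q]

/-- The differential at `α` of the projection `π : T^*Q → Q`. -/
def dPi (α : Cotangent E Q) : TangentSpace (cotModel E) α →L[ℝ] TangentSpace 𝓘(ℝ, E) α.proj :=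
  mfderiv (cotModel E) 𝓘(ℝ, E) (fun β : Cotangent E Q => β.proj) α

/-- The canonical (Liouville) `1`-form `θ_Q(α)(X) = ⟨α, Tπ(X)⟩`. -/
def liouville (α : Cotangent E Q) : TangentSpace (cotModel E) α →L[ℝ] ℝ :=
  α.snd.comp (dPi α)

/-- The canonical symplectic form `ω_Q = - dθ_Q`. -/
def omegaQ (α : Cotangent E Q) (X Y : TangentSpace (cotModel E) α) : ℝ :=
  - extDerivOneForm (cotModel E) liouville α X Y

/-- The Hamiltonian `H_{(g,V)}(α) = g^♯(α, α) / 2 + V(π(α))`. -/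
def hamiltonian (α : Cotangent E Q) : ℝ :=
  1 / 2 * cometric g α.proj α.snd α.snd + V α.proj

/-- The differential of a real function on `T^*Q`. -/
def differential (H : Cotangent E Q → ℝ) (α : Cotangent E Q) : TangentSpace (cotModel E) α →L[ℝ] ℝ :=
  mfderiv (cotModel E) 𝓘(ℝ, ℝ) H α

/-- The part over `U` of the bundle `D^*`, identified with the annihilator of `D^⊥` in `T^*Q`. -/
def dualDist (U : Set Q) : Set (Cotangent E Q) :=
  {α | α.proj ∈ U ∧ ∀ v ∈ orth g D α.proj, α.snd v = 0}

/-- The fibre at `α` of the bundle `𝒯^N N`, for a subset `N` of `T^*Q` (in use: `D^*` over an open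
set): the tangent vectors of `N` that project into `D`. -/
def nhTangent (N : Set (Cotangent E Q)) (α : Cotangent E Q) :
    Set (TangentSpace (cotModel E) α) :=
  {X | X ∈ tangentSet (cotModel E) N α ∧ dPi α X ∈ D α.proj}

/-- `X` is the nonholonomic Hamiltonian vector field of `H` on `N` (in use: `D^*` over an open
set): a smooth section of `𝒯^N N` over `N` with `i_X ω_Q = dH` on `𝒯^N N`. -/
def IsNHHamiltonianField (N : Set (Cotangent E Q)) (H : Cotangent E Q → ℝ)
    (X : ∀ α : Cotangent E Q, TangentSpace (cotModel E) α) : Prop :=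
  IsSmoothSection (cotModel E) N (nhTangent D N) X ∧
    ∀ α ∈ N, ∀ Y ∈ nhTangent D N α, omegaQ α (X α) Y = differential H α Y

variable (e : ℝ)

/-- The open set `U_e = {q | V(q) < e}`. -/
def region : Set Q := {q | V q < e}

/-- The Jacobi metric `g_e = (e - V) g` (a Riemannian metric on `U_e`). -/
def jacobi : MetricField E Q := fun q => (e - V q) • g q

/-- The Hamiltonian `H_{g_e}` of the kinetic system with the Jacobi metric. -/
def jacobiHamiltonian : Cotangent E Q → ℝ := hamiltonian (jacobi g V e) (fun _ => 0)

/-- The bundle `D_e^*` over `U_e`. (The orthogonal complements of `D` with respect to `g` and to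
`g_e` are the same over `U_e`.) -/
def dualDistE : Set (Cotangent E Q) := dualDist g D (region V e)

/-- The set `S_e^*` of the `α ∈ D_e^*` with `‖α‖_g ^ 2 = 2 (e - V)`. -/
def sphereSet : Set (Cotangent E Q) :=
  {α | α ∈ dualDistE g V D e ∧ cometric g α.proj α.snd α.snd = 2 * (e - V α.proj)}

/-- The fibre at `α` of `C_e = T S_e^* ∩ 𝒯^{D_e^*} D_e^*`. -/
def contactBundle (α : Cotangent E Q) : Set (TangentSpace (cotModel E) α) :=
  tangentSet (cotModel E) (sphereSet g V D e) α ∩ nhTangent D (dualDistE g V D e) α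

/-- The restriction to `C_e` of this form is the contact form `(θ_Q)_e = θ_Q / 2`. -/
def thetaE (α : Cotangent E Q) (X : TangentSpace (cotModel E) α) : ℝ := 1 / 2 * liouville α X

/-- The restriction to `C_e` of this form is the `2`-form `(ω_Q)_e = ω_Q / 2`. -/
def omegaE (α : Cotangent E Q) (X Y : TangentSpace (cotModel E) α) : ℝ := 1 / 2 * omegaQ α X Y

end Mechanics

end Nonholonomic

end

/-!
The argument has a Hamiltonian half (the level set, the contact bundle, the Reeb section) and a
Lagrangian half (the trajectories). Both are carried out in coordinates: `exists_model` describes the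
metric and the distribution near a point by a `CoordModel`, that is, by an open set `O` of `E`, a
field `G` of scalar products and an injective frame `L` of the distribution; the orthogonal projector
`P` and the index raising map `sharp` are then smooth functions on `O`.

*The Hamiltonian half.* In the chart of `T^*Q` the dual `D^*` is the set `N` of the `(x, p)` with
`p ∘ P x = p`, its tangent vectors `(u, a)` are the solutions of the linearized equation
`a = a ∘ P + p ∘ D_u P`, and `ω_Q` is the canonical form of `E × E^*`. Since `p ∘ D_u P` vanishes on
the distribution (differentiate `P ∘ P = P`), this form is nondegenerate on the space `NT` of the
tangent vectors with `u` in the distribution (`wform_nondegenerate`), which gives existence and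
uniqueness of the nonholonomic Hamiltonian field. On `S_e^*` the radial vector `(0, p)` has
`dH (0, p) = ‖p‖² > 0`; hence `S_e^*` is a hypersurface of `D_e^*` (`exists_straightening` flattens
the pair in a chart), its tangent spaces are the kernels of `dH`, and these kernels in `NT` are
spanned by a smooth frame of `2 r - 1` fields (`exists_contact_frame`). The radial vector pairs with
`Z` under `ω_Q` to `± θ_Q(Z)`, so that on the kernel of `dH` a vector annihilated by both canonical
forms is zero (`eq_zero_of_contact`). The Hamiltonian field `R` of the kinetic energy of `g_e` has
`θ_Q(R) = 2 H = 2` and `i_R ω_Q = dH = 0` on the kernel of `dH`: it is the Reeb section, and on `R`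
followed by a symplectic basis of `ker θ_Q` the form `θ ∧ ω^(r-1)` is positive, all nonzero terms of
the sum over permutations being equal (`wedgePow_ne_zero`). Finally
`H_(g,V) = (e - V) H_(g_e) + V` and `H_(g_e) = 1` on `S_e^*`, so that there
`dH_(g,V) = (e - V) dH_(g_e)` and, by nondegeneracy, `X_(g,V,D) = (e - V) R`.

*The Lagrangian half.* The component `P' ċ` of the velocity of a trajectory has covariant derivative
in `D` and is itself orthogonal to `D`; its length is therefore constant, and it vanishes initially.
So a trajectory stays tangent to `D` (`IsTrajectory.velocity_mem`), its equation becomes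
`P (∇ċ + grad V) = 0`, energy is conserved, and differentiating the constraint `P ẋ = ẋ` yields a
smooth second order system in normal form, so that solutions are unique (`solution_unique`). The
Christoffel symbols of `g_e = (e - V) g` along a velocity `v` of energy `e` satisfy
`Γ_e(a v, a v) = a² (Γ(v, v) + grad V) - a³ dV(v) v` with `a = 1 / (e - V)`
(`CoordModel.force_jacobi`); the last term is cancelled by the one that the chain rule produces for
the time change `dh/ds = e - V`, which therefore exchanges the trajectories of energy `e` of
`(g, V, D)` and the trajectories of energy `1` of `(g_e, D_e)` (`isSolutionAt_jacobi_iff`). Uniqueness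
identifies the reparametrized curve with the given one, and since two trajectories with the same
initial velocity have a common extension (`IsTrajectory.exists_union`), maximality of one of them
gives the inclusion of the intervals.
-/

noncomputable section

set_option linter.unusedSectionVars false

namespace Nonholonomic

/-! ### Charts, vector fields and the exterior derivative -/

theorem two_le_infty : (2 : WithTop ℕ∞) ≤ ∞ :=
  ENat.LEInfty.out

section General
variable {EM : Type*} [NormedAddCommGroup EM] [NormedSpace ℝ EM]
  {HM : Type*} [TopologicalSpace HM] {J : ModelWithCorners ℝ EM HM}
  {M : Type*} [TopologicalSpace M] [ChartedSpace HM M]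

variable (J) in
/-- The differential at `y` of the chart of `M` at `x₀`, with values in the model space. -/
def dchart (x₀ y : M) : TangentSpace J y →L[ℝ] EM :=
  mfderiv J 𝓘(ℝ, EM) (extChartAt J x₀) y

variable [IsManifold J ∞ M]

theorem dchart_isInvertible {x₀ y : M} (hy : y ∈ (extChartAt J x₀).source) :
    (dchart J x₀ y).IsInvertible := by
  have : IsManifold J 1 M := IsManifold.of_le (n := ∞) (by simp)
  exact isInvertible_mfderiv_extChartAt hy

theorem dchart_inverse_apply {x₀ y : M} (hy : y ∈ (extChartAt J x₀).source) (w : EM) :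
    dchart J x₀ y ((dchart J x₀ y).inverse w) = w :=
  (dchart_isInvertible hy).self_apply_inverse w

theorem inverse_dchart_apply {x₀ y : M} (hy : y ∈ (extChartAt J x₀).source)
    (v : TangentSpace J y) : (dchart J x₀ y).inverse (dchart J x₀ y v) = v :=
  (dchart_isInvertible hy).inverse_apply_self v

/-- A vector field on a subset of a chart domain is smooth if and only if its components are. -/
theorem contMDiffOn_field_iff (x₀ : M) (X : ∀ x : M, TangentSpace J x) {W : Set M}
    (hW : IsOpen W) (hs : W ⊆ (extChartAt J x₀).source) :
    ContMDiffOn J J.tangent ∞ (fun y => (⟨y, X y⟩ : TangentBundle J M)) W ↔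
      ContMDiffOn J 𝓘(ℝ, EM) ∞ (fun y => dchart J x₀ y (X y)) W := by
  have : IsManifold J 1 M := IsManifold.of_le (n := ∞) (by simp)
  rw [extChartAt_source] at hs
  have h := (trivializationAt EM (TangentSpace J) x₀).contMDiffOn_section_iff (IB := J) (n := ∞)
    (s := X) hW hs
  refine h.trans (contMDiffOn_congr fun y hy => ?_)
  have h1 : dchart J x₀ y = (trivializationAt EM (TangentSpace J) x₀).continuousLinearMapAt ℝ y :=
    (TangentBundle.continuousLinearMapAt_trivializationAt (hs hy)).symm
  rw [h1, Trivialization.continuousLinearMapAt_apply, Trivialization.linearMapAt_apply, if_pos]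
  exact hs hy

/-- Smooth components in a chart define a smooth vector field. -/
theorem contMDiffOn_inverse_dchart_field (x₀ : M) {F : EM → EM} {O : Set EM} (hO : IsOpen O)
    (hF : ContDiffOn ℝ ∞ F O) :
    ContMDiffOn J J.tangent ∞ (fun y => (⟨y, (dchart J x₀ y).inverse (F (extChartAt J x₀ y))⟩ :
        TangentBundle J M)) ((extChartAt J x₀).source ∩ extChartAt J x₀ ⁻¹' O) := by
  have ho : IsOpen ((extChartAt J x₀).source ∩ extChartAt J x₀ ⁻¹' O) :=
    (continuousOn_extChartAt x₀).isOpen_inter_preimage (isOpen_extChartAt_source x₀) hO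
  rw [contMDiffOn_field_iff x₀ _ ho inter_subset_left]
  have h1 : ContMDiffOn J 𝓘(ℝ, EM) ∞ (fun y => F (extChartAt J x₀ y))
      ((extChartAt J x₀).source ∩ extChartAt J x₀ ⁻¹' O) := by
    refine (contMDiffOn_iff_contDiffOn.2 hF).comp
      ((contMDiffOn_extChartAt (n := ∞) (I := J) (x := x₀)).mono ?_) inter_subset_right
    rw [extChartAt_source]
    exact inter_subset_left
  exact h1.congr fun y hy => dchart_inverse_apply hy.1 _

variable [J.Boundaryless]

theorem mfderiv_extChartAt_symm_eq (x₀ : M) {u : EM} (hu : u ∈ (extChartAt J x₀).target) :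
    mfderiv 𝓘(ℝ, EM) J (extChartAt J x₀).symm u =
      (dchart J x₀ ((extChartAt J x₀).symm u)).inverse := by
  have : IsManifold J 1 M := IsManifold.of_le (n := ∞) (by simp)
  have h1 := mfderiv_extChartAt_comp_mfderivWithin_extChartAt_symm hu
  have h2 := mfderivWithin_extChartAt_symm_comp_mfderiv_extChartAt hu
  rw [J.range_eq_univ, mfderivWithin_univ] at h1 h2
  exact (ContinuousLinearMap.inverse_eq h1 h2).symm

theorem contDiffAt_chart_transition (x₀ x₁ : M) {u : EM} (hu : u ∈ (extChartAt J x₁).target)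
    (hx : (extChartAt J x₁).symm u ∈ (extChartAt J x₀).source) :
    ContDiffAt ℝ ∞ (extChartAt J x₀ ∘ (extChartAt J x₁).symm) u := by
  have h := contDiffWithinAt_ext_coord_change (I := J) (n := ∞) x₀ x₁ (y := u) (by
    rw [PartialEquiv.trans_source]
    exact ⟨hu, hx⟩)
  rwa [J.range_eq_univ, contDiffWithinAt_univ] at h

/-- The differential of the change of charts. -/
theorem fderiv_chart_transition (x₀ x₁ : M) {u : EM} (hu : u ∈ (extChartAt J x₁).target)
    (hx : (extChartAt J x₁).symm u ∈ (extChartAt J x₀).source) (w : EM) :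
    fderiv ℝ (extChartAt J x₀ ∘ (extChartAt J x₁).symm) u w =
      dchart J x₀ ((extChartAt J x₁).symm u)
        ((dchart J x₁ ((extChartAt J x₁).symm u)).inverse w) := by
  have : IsManifold J 1 M := IsManifold.of_le (n := ∞) (by simp)
  have h1 : MDifferentiableAt J 𝓘(ℝ, EM) (extChartAt J x₀) ((extChartAt J x₁).symm u) :=
    mdifferentiableAt_extChartAt (by simpa using hx)
  have h2 : MDifferentiableAt 𝓘(ℝ, EM) J (extChartAt J x₁).symm u := by
    have := mdifferentiableWithinAt_extChartAt_symm hu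
    rwa [J.range_eq_univ, mdifferentiableWithinAt_univ] at this
  have := mfderiv_comp u h1 h2
  rw [mfderiv_eq_fderiv, mfderiv_extChartAt_symm_eq x₁ hu] at this
  exact DFunLike.congr_fun this w

omit [IsManifold J ∞ M] in
theorem eventually_mem_chart_domains (x₀ x₁ : M) {x : M} (hx : x ∈ (extChartAt J x₀).source)
    (hx1 : x ∈ (extChartAt J x₁).source) :
    ∀ᶠ u in 𝓝 (extChartAt J x₁ x), u ∈ (extChartAt J x₁).target ∧
      (extChartAt J x₁).symm u ∈ (extChartAt J x₀).source := by
  refine Filter.Eventually.and (extChartAt_target_mem_nhds' ((extChartAt J x₁).map_source hx1)) ?_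
  have hc : ContinuousAt (extChartAt J x₁).symm (extChartAt J x₁ x) :=
    continuousAt_extChartAt_symm' hx1
  refine hc.preimage_mem_nhds ?_
  rw [(extChartAt J x₁).left_inv hx1]
  exact extChartAt_source_mem_nhds' hx

/-- `extDerivOneForm` is computed in the chart at the point, but any other chart gives the same value:
the terms with the second derivative of the change of charts cancel by symmetry. -/
theorem extDerivOneForm_eq_chart (η : ∀ x : M, TangentSpace J x →L[ℝ] ℝ) (x₀ : M) {x : M}
    (hx : x ∈ (extChartAt J x₀).source) {η₀ : EM → EM →L[ℝ] ℝ}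
    (hη₀ : ∀ y ∈ (extChartAt J x₀).source, ∀ v, η₀ (extChartAt J x₀ y) (dchart J x₀ y v) = η y v)
    (hd : DifferentiableAt ℝ η₀ (extChartAt J x₀ x)) (v w : TangentSpace J x) :
    extDerivOneForm J η x v w =
      fderiv ℝ η₀ (extChartAt J x₀ x) (dchart J x₀ x v) (dchart J x₀ x w) -
        fderiv ℝ η₀ (extChartAt J x₀ x) (dchart J x₀ x w) (dchart J x₀ x v) := by
  set u₁ := extChartAt J x x with hu₁
  set τ : EM → EM := extChartAt J x₀ ∘ (extChartAt J x).symm with hτ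
  have hx1 := mem_extChartAt_source (I := J) x
  have hu : u₁ ∈ (extChartAt J x).target := (extChartAt J x).map_source hx1
  have hux : (extChartAt J x).symm u₁ = x := (extChartAt J x).left_inv hx1
  have hux' : (extChartAt J x).symm u₁ ∈ (extChartAt J x₀).source := by rw [hux]; exact hx
  have hτu : τ u₁ = extChartAt J x₀ x := by simp only [hτ, Function.comp, hux]
  have hc : ContDiffAt ℝ ∞ τ u₁ := contDiffAt_chart_transition x₀ x hu hux'
  have hcd : DifferentiableAt ℝ τ u₁ := hc.differentiableAt (by simp)
  have hcd' : DifferentiableAt ℝ (fderiv ℝ τ) u₁ :=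
    (hc.fderiv_right (m := 1) (by rw [one_add_one_eq_two]; exact two_le_infty)).differentiableAt (by simp)
  set η' : EM → EM →L[ℝ] ℝ := fun y =>
    (η ((extChartAt J x).symm y)).comp
      (mfderivWithin 𝓘(ℝ, EM) J (extChartAt J x).symm (Set.range J) y) with hη'
  have key : η' =ᶠ[𝓝 u₁] fun y => (η₀ (τ y)).comp (fderiv ℝ τ y) := by
    filter_upwards [eventually_mem_chart_domains (J := J) x₀ x hx hx1] with y hy
    ext w
    rw [hη', J.range_eq_univ]
    simp only [mfderivWithin_univ]
    change η _ (mfderiv 𝓘(ℝ, EM) J (extChartAt J x).symm y w) = η₀ (τ y) (fderiv ℝ τ y w)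
    rw [fderiv_chart_transition x₀ x hy.1 hy.2, mfderiv_extChartAt_symm_eq x hy.1]
    exact (hη₀ _ hy.2 _).symm
  rw [← hτu] at hd ⊢
  have hder : HasFDerivAt (fun y => (η₀ (τ y)).comp (fderiv ℝ τ y)) _ u₁ :=
    (hd.hasFDerivAt.comp u₁ hcd.hasFDerivAt).clm_comp hcd'.hasFDerivAt
  have hfd := key.fderiv_eq.trans hder.fderiv
  rw [← fderivWithin_univ, ← J.range_eq_univ] at hfd
  have hsymm : ∀ a b, fderiv ℝ (fderiv ℝ τ) u₁ a b = fderiv ℝ (fderiv ℝ τ) u₁ b a := by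
    intro a b
    exact (hc.isSymmSndFDerivAt (by simpa using two_le_infty)).eq a b
  have hdt : ∀ v : TangentSpace J x, fderiv ℝ τ u₁ (dchart J x x v) = dchart J x₀ x v := by
    intro v
    have h := fderiv_chart_transition x₀ x hu hux' (dchart J x x v)
    rw [hux] at h
    rw [h, inverse_dchart_apply hx1]
  change fderivWithin ℝ η' (Set.range J) u₁ (dchart J x x v) (dchart J x x w) -
    fderivWithin ℝ η' (Set.range J) u₁ (dchart J x x w) (dchart J x x v) = _
  rw [hfd]
  simp [hdt, hsymm (dchart J x x v) (dchart J x x w)]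

end General

/-! ### Tangent vectors of subsets and submanifolds -/

section General
variable {EM : Type*} [NormedAddCommGroup EM] [NormedSpace ℝ EM]
  {HM : Type*} [TopologicalSpace HM] {J : ModelWithCorners ℝ EM HM}
  {M : Type*} [TopologicalSpace M] [ChartedSpace HM M]

theorem trans_mem_maximalAtlas [IsManifold J ∞ M] {φ : OpenPartialHomeomorph M HM}
    (hφ : φ ∈ IsManifold.maximalAtlas J ∞ M) {f : OpenPartialHomeomorph HM HM}
    (hf : f ∈ contDiffGroupoid ∞ J) : φ ≫ₕ f ∈ IsManifold.maximalAtlas J ∞ M := by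
  rw [IsManifold.maximalAtlas, mem_maximalAtlas_iff]
  intro φ' hφ'
  have h := mem_maximalAtlas_iff.1 hφ φ' hφ'
  constructor
  · rw [OpenPartialHomeomorph.trans_symm_eq_symm_trans_symm, OpenPartialHomeomorph.trans_assoc]
    exact (contDiffGroupoid ∞ J).trans ((contDiffGroupoid ∞ J).symm hf) h.1
  · rw [← OpenPartialHomeomorph.trans_assoc]
    exact (contDiffGroupoid ∞ J).trans h.2 hf

variable (J) in
/-- The differential at `y` of the extension of the chart `φ`, with values in the model space. -/
def dext (φ : OpenPartialHomeomorph M HM) (y : M) : TangentSpace J y →L[ℝ] EM :=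
  mfderiv J 𝓘(ℝ, EM) (φ.extend J) y

theorem contMDiffAt_extend_symm [IsManifold J ∞ M] [J.Boundaryless]
    {φ : OpenPartialHomeomorph M HM}
    (hφ : φ ∈ IsManifold.maximalAtlas J ∞ M) {x : M} (hx : x ∈ φ.source) :
    ContMDiffAt 𝓘(ℝ, EM) J ∞ (φ.extend J).symm (φ.extend J x) := by
  have hxt : φ.extend J x ∈ (φ.extend J).target :=
    (φ.extend J).map_source (by rwa [φ.extend_source])
  refine (contMDiffOn_extend_symm hφ).contMDiffAt ?_
  rw [← φ.image_source_eq_target, ← image_comp]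
  have : (φ.extend J).target ∈ 𝓝 (φ.extend J x) := φ.isOpen_extend_target.mem_nhds hxt
  rwa [φ.extend_target_eq_image_source] at this

theorem dext_isInvertible [IsManifold J ∞ M] [J.Boundaryless] {φ : OpenPartialHomeomorph M HM}
    (hφ : φ ∈ IsManifold.maximalAtlas J ∞ M) {x : M} (hx : x ∈ φ.source) :
    (dext J φ x).IsInvertible := by
  have hmd : MDifferentiableAt J 𝓘(ℝ, EM) (φ.extend J) x :=
    (φ.contMDiffAt_extend hφ hx).mdifferentiableAt (by simp)
  have hsy : MDifferentiableAt 𝓘(ℝ, EM) J (φ.extend J).symm (φ.extend J x) :=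
    (contMDiffAt_extend_symm hφ hx).mdifferentiableAt (by simp)
  have hleft : (φ.extend J).symm (φ.extend J x) = x := φ.extend_left_inv hx
  have hxt : φ.extend J x ∈ (φ.extend J).target :=
    (φ.extend J).map_source (by rwa [φ.extend_source])
  have h1 := mfderiv_comp x hsy hmd
  have hid : (φ.extend J).symm ∘ φ.extend J =ᶠ[𝓝 x] id := by
    filter_upwards [φ.open_source.mem_nhds hx] with y hy using φ.extend_left_inv hy
  rw [hid.mfderiv_eq, mfderiv_id] at h1
  have h2 := mfderiv_comp (φ.extend J x) (I' := J) (g := φ.extend J) (f := (φ.extend J).symm)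
    (hleft.symm ▸ hmd) hsy
  have hid2 : φ.extend J ∘ (φ.extend J).symm =ᶠ[𝓝 (φ.extend J x)] id := by
    filter_upwards [φ.isOpen_extend_target.mem_nhds hxt] with y hy
      using (φ.extend J).right_inv hy
  rw [hid2.mfderiv_eq, mfderiv_id, hleft] at h2
  exact ContinuousLinearMap.IsInvertible.of_inverse
    (g := (mfderiv 𝓘(ℝ, EM) J (φ.extend J).symm (φ.extend J x) : EM →L[ℝ] TangentSpace J x))
    h2.symm h1.symm

/-- Tangent vectors to a set are given by curves in the image of a chart. -/
theorem mem_tangentSet_iff_extend [IsManifold J ∞ M] [J.Boundaryless]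
    {φ : OpenPartialHomeomorph M HM}
    (hφ : φ ∈ IsManifold.maximalAtlas J ∞ M) {x : M} (hx : x ∈ φ.source) (S : Set M)
    (v : TangentSpace J x) :
    v ∈ tangentSet J S x ↔ ∃ γ : ℝ → EM, γ 0 = φ.extend J x ∧ ContDiffAt ℝ ∞ γ 0 ∧
      HasDerivAt γ (dext J φ x v) 0 ∧
      ∀ᶠ t in 𝓝 (0 : ℝ), (φ.extend J).symm (γ t) ∈ S := by
  have hmd : ContMDiffAt J 𝓘(ℝ, EM) ∞ (φ.extend J) x :=
    φ.contMDiffAt_extend hφ hx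
  have hxt : φ.extend J x ∈ (φ.extend J).target :=
    (φ.extend J).map_source (by rwa [φ.extend_source])
  have hleft : (φ.extend J).symm (φ.extend J x) = x := φ.extend_left_inv hx
  have hsy : ContMDiffAt 𝓘(ℝ, EM) J ∞ (φ.extend J).symm (φ.extend J x) :=
    contMDiffAt_extend_symm hφ hx
  constructor
  · rintro ⟨γ, rfl, hγ, hS, hv⟩
    obtain rfl : mfderiv 𝓘(ℝ, ℝ) J γ 0 (1 : ℝ) = v := by simpa using hv
    refine ⟨φ.extend J ∘ γ, rfl, (hmd.comp 0 hγ).contDiffAt, ?_, ?_⟩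
    · have h1 := mfderiv_comp (0 : ℝ) (hmd.mdifferentiableAt (by simp))
        (hγ.mdifferentiableAt (by simp))
      rw [mfderiv_eq_fderiv] at h1
      have h2 : DifferentiableAt ℝ (φ.extend J ∘ γ) 0 :=
        (hmd.comp 0 hγ).contDiffAt.differentiableAt (by simp)
      have h3 := h2.hasDerivAt
      rw [← fderiv_apply_one_eq_deriv, h1] at h3
      exact h3
    · have : ∀ᶠ t in 𝓝 (0 : ℝ), γ t ∈ φ.source :=
        hγ.continuousAt.preimage_mem_nhds (φ.open_source.mem_nhds hx)
      filter_upwards [hS, this] with t ht1 ht2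
      rwa [Function.comp_apply, φ.extend_left_inv ht2]
  · rintro ⟨γ, h0, hγ, hd, hS⟩
    rw [← h0] at hsy
    have hc : ContMDiffAt 𝓘(ℝ, ℝ) J ∞ ((φ.extend J).symm ∘ γ) 0 :=
      hsy.comp (0 : ℝ) hγ.contMDiffAt
    have hγ0 : ((φ.extend J).symm ∘ γ) 0 = x := by rw [Function.comp_apply, h0, hleft]
    refine ⟨(φ.extend J).symm ∘ γ, hγ0, hc, hS, ?_⟩
    have hc' := hc
    generalize hg : (φ.extend J).symm ∘ γ = β at hγ0 hc
    subst hγ0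
    rw [TotalSpace.mk_inj]
    have h1 := mfderiv_comp (0 : ℝ) (hmd.mdifferentiableAt (by simp))
      (hc.mdifferentiableAt (by simp))
    rw [mfderiv_eq_fderiv] at h1
    have h2 : φ.extend J ∘ β =ᶠ[𝓝 0] γ := by
      have : ∀ᶠ t in 𝓝 (0 : ℝ), γ t ∈ (φ.extend J).target :=
        hγ.continuousAt.preimage_mem_nhds (h0 ▸ φ.isOpen_extend_target.mem_nhds hxt)
      filter_upwards [this] with t ht
      rw [← hg]
      exact (φ.extend J).right_inv ht
    have h3 := (h2.fderiv_eq.symm.trans h1)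
    have h4 : fderiv ℝ γ 0 1 = dext J φ (β 0) v := by
      rw [fderiv_apply_one_eq_deriv, hd.deriv]
    rw [h3] at h4
    have hinj := (dext_isInvertible hφ hx).injective
    exact hinj h4

/-- Tangent vectors to a set that is flat in a chart. -/
theorem mem_tangentSet_iff_of_flat [FiniteDimensional ℝ EM] [IsManifold J ∞ M] [J.Boundaryless]
    {φ : OpenPartialHomeomorph M HM}
    (hφ : φ ∈ IsManifold.maximalAtlas J ∞ M) {S : Set M} {x : M} (hx : x ∈ φ.source) (hxS : x ∈ S)
    (K : Submodule ℝ EM) (hK : ∀ y ∈ φ.source, y ∈ S ↔ φ.extend J y ∈ K)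
    (v : TangentSpace J x) :
    v ∈ tangentSet J S x ↔ (dext J φ x v) ∈ K := by
  rw [mem_tangentSet_iff_extend hφ hx]
  obtain ⟨w, hw⟩ : ∃ w : EM, w = dext J φ x v := ⟨_, rfl⟩
  rw [← hw]
  have hxt : φ.extend J x ∈ (φ.extend J).target :=
    (φ.extend J).map_source (by rwa [φ.extend_source])
  have key : ∀ γ : ℝ → EM, γ 0 = φ.extend J x → ContinuousAt γ 0 →
      ∀ᶠ t in 𝓝 (0 : ℝ), ((φ.extend J).symm (γ t) ∈ S ↔ γ t ∈ K) := by
    intro γ h0 hγ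
    have : ∀ᶠ t in 𝓝 (0 : ℝ), γ t ∈ (φ.extend J).target :=
      hγ.preimage_mem_nhds (h0 ▸ φ.isOpen_extend_target.mem_nhds hxt)
    filter_upwards [this] with t ht
    have h1 := (φ.extend J).map_target ht
    rw [φ.extend_source] at h1
    rw [hK _ h1, (φ.extend J).right_inv ht]
  constructor
  -- a functional that vanishes on `K` but not on the velocity would be constant along the curve
  · rintro ⟨γ, h0, hγ, hd, hS⟩
    by_contra hv
    obtain ⟨f, hf, hfK⟩ := Submodule.exists_le_ker_of_notMem hv
    refine hf ?_
    have h1 : HasDerivAt (fun t => f.toContinuousLinearMap (γ t)) (f.toContinuousLinearMap w) 0 :=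
      f.toContinuousLinearMap.hasFDerivAt.comp_hasDerivAt 0 hd
    refine h1.unique ((hasDerivAt_const (0 : ℝ) (0 : ℝ)).congr_of_eventuallyEq ?_)
    filter_upwards [hS, key γ h0 hγ.continuousAt] with t ht1 ht2
    exact hfK (ht2.1 ht1)
  · intro hv
    refine ⟨fun t => φ.extend J x + t • w, by simp, ?_, ?_, ?_⟩
    · fun_prop
    · simpa using ((hasDerivAt_id (0 : ℝ)).smul_const w).const_add (φ.extend J x)
    · filter_upwards [key (fun t => φ.extend J x + t • w) (by simp) (by fun_prop)] with t ht
      exact ht.2 (K.add_mem ((hK x hx).1 hxS) (K.smul_mem _ hv))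

theorem differential_eq_zero_of_mem_tangentSet {S : Set M} {x : M} {H : M → ℝ} {c : ℝ}
    (hc : ∀ y ∈ S, H y = c) (hd : MDifferentiableAt J 𝓘(ℝ, ℝ) H x) {v : TangentSpace J x}
    (hv : v ∈ tangentSet J S x) : mfderiv J 𝓘(ℝ, ℝ) H x v = (0 : ℝ) := by
  obtain ⟨γ, rfl, hγ, hS, hv⟩ := hv
  obtain rfl : mfderiv 𝓘(ℝ, ℝ) J γ 0 (1 : ℝ) = v := by
    simpa using hv
  have h1 := mfderiv_comp (0 : ℝ) hd (hγ.mdifferentiableAt (by simp))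
  have h2 : H ∘ γ =ᶠ[𝓝 0] fun _ => c := by
    filter_upwards [hS] with t ht using hc _ ht
  rw [h2.mfderiv_eq, mfderiv_const] at h1
  exact (DFunLike.congr_fun h1 (1 : ℝ)).symm

/-- Tangent vectors of a hypersurface of `N` on which `H` is constant. -/
theorem tangentSet_eq_of_codim_one [FiniteDimensional ℝ EM] [IsManifold J ∞ M] [J.Boundaryless]
    {S N : Set M} (hSN : IsSubmanifoldOfCodim J S N 1) {H : M → ℝ} {c : ℝ}
    (hc : ∀ y ∈ S, H y = c) {x : M} (hx : x ∈ S) (hd : MDifferentiableAt J 𝓘(ℝ, ℝ) H x)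
    (hne : ∃ Y ∈ tangentSet J N x, mfderiv J 𝓘(ℝ, ℝ) H x Y ≠ (0 : ℝ)) :
    tangentSet J S x = {X | X ∈ tangentSet J N x ∧ mfderiv J 𝓘(ℝ, ℝ) H x X = (0 : ℝ)} := by
  obtain ⟨φ, hφ, hxφ, K, K', hKK, hr, hK⟩ := hSN.2 x hx
  have hN := fun v => mem_tangentSet_iff_of_flat hφ hxφ (hSN.1 hx) K (fun y hy => (hK y hy).1) v
  have hS := fun v => mem_tangentSet_iff_of_flat hφ hxφ hx K' (fun y hy => (hK y hy).2) v
  have h0 := fun v => differential_eq_zero_of_mem_tangentSet hc hd (v := v)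
  obtain ⟨B, hB'⟩ := dext_isInvertible hφ hxφ
  have hB : ∀ v, B v = dext J φ x v := fun v => DFunLike.congr_fun hB' v
  obtain ⟨d, hd'⟩ : ∃ d : TangentSpace J x →L[ℝ] ℝ, ∀ v, d v = mfderiv J 𝓘(ℝ, ℝ) H x v :=
    ⟨mfderiv J 𝓘(ℝ, ℝ) H x, fun v => rfl⟩
  simp only [← hB, ← hd'] at hN hS h0 hne ⊢
  set l : EM →ₗ[ℝ] ℝ := (d : TangentSpace J x →ₗ[ℝ] ℝ) ∘ₗ (B.symm : EM →ₗ[ℝ] TangentSpace J x)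
    with hl
  have hlB : ∀ v, l (B v) = d v := fun v => by simp [hl]
  have hle : K' ≤ K ⊓ LinearMap.ker l := by
    intro w hw
    refine ⟨hKK hw, ?_⟩
    have := h0 (B.symm w) ((hS _).2 (by simpa using hw))
    exact this
  have hlt : K ⊓ LinearMap.ker l < K := by
    refine lt_of_le_of_ne inf_le_left fun h => ?_
    obtain ⟨Y, hY, hY0⟩ := hne
    have : B Y ∈ K ⊓ LinearMap.ker l := by rw [h]; exact (hN Y).1 hY
    exact hY0 ((hlB Y).symm.trans this.2)
  have heq : K' = K ⊓ LinearMap.ker l := by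
    refine Submodule.eq_of_le_of_finrank_le hle ?_
    have := Submodule.finrank_lt_finrank_of_lt hlt
    omega
  ext v
  rw [hS, mem_ofPred_eq, hN, heq, Submodule.mem_inf, LinearMap.mem_ker, hlB]
  exact Iff.rfl

end General

/-! ### Nonholonomic systems in coordinates -/

section LinearAlgebra
variable {E F : Type*} [NormedAddCommGroup E] [NormedSpace ℝ E] [FiniteDimensional ℝ E]
  [NormedAddCommGroup F] [NormedSpace ℝ F] [FiniteDimensional ℝ F]

theorem finrank_clm_dual : Module.finrank ℝ (E →L[ℝ] ℝ) = Module.finrank ℝ E := by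
  rw [← Subspace.dual_finrank_eq (K := ℝ) (V := E)]
  exact (LinearMap.toContinuousLinearMap (𝕜 := ℝ) (E := E) (F' := ℝ)).symm.finrank_eq

theorem isInvertible_of_injective (A : E →L[ℝ] F) (hA : Function.Injective A)
    (h : Module.finrank ℝ E = Module.finrank ℝ F) : A.IsInvertible :=
  ⟨(LinearEquiv.ofInjectiveOfFinrankEq (A : E →ₗ[ℝ] F) hA h).toContinuousLinearEquiv, by
    ext; rfl⟩

theorem isInvertible_of_pos (A : E →L[ℝ] E →L[ℝ] ℝ) (hA : ∀ v, v ≠ 0 → 0 < A v v) :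
    A.IsInvertible := by
  refine isInvertible_of_injective A ?_ finrank_clm_dual.symm
  refine (injective_iff_map_eq_zero A).2 fun v hv => ?_
  by_contra h
  have := hA v h
  rw [hv] at this
  simp at this

/-- Pointwise inversion of a smooth field of invertible linear maps is smooth. -/
theorem contDiffOn_inverse {Z : Type*} [NormedAddCommGroup Z] [NormedSpace ℝ Z] {O : Set Z}
    {A : Z → E →L[ℝ] F} (hA : ContDiffOn ℝ ∞ A O) (hi : ∀ x ∈ O, (A x).IsInvertible) :
    ContDiffOn ℝ ∞ (fun x => (A x).inverse) O := by
  intro x hx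
  obtain ⟨e, he⟩ := hi x hx
  have := contDiffAt_map_inverse (n := ∞) e
  rw [he] at this
  exact this.comp_contDiffWithinAt x (hA x hx)

end LinearAlgebra

/-- A nonholonomic system with a metric and a rank `r` distribution in coordinates: over the open
set `O` of the vector space `E`, a field `G` of scalar products and an injective frame `L` of the
distribution. -/
structure CoordModel (E : Type*) [NormedAddCommGroup E] [NormedSpace ℝ E] (r : ℕ) where
  /-- the coordinate domain -/
  O : Set E
  /-- the coefficients of the metric -/
  G : E → E →L[ℝ] E →L[ℝ] ℝ
  /-- the frame of the distribution, as a map from the standard space -/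
  L : E → EuclideanSpace ℝ (Fin r) →L[ℝ] E
  isOpen : IsOpen O
  smooth_G : ContDiffOn ℝ ∞ G O
  smooth_L : ContDiffOn ℝ ∞ L O
  symm : ∀ x ∈ O, ∀ u v, G x u v = G x v u
  pos : ∀ x ∈ O, ∀ u, u ≠ 0 → 0 < G x u u
  inj : ∀ x ∈ O, Function.Injective (L x)

namespace CoordModel
variable {E : Type*} [NormedAddCommGroup E] [NormedSpace ℝ E] [FiniteDimensional ℝ E] {r : ℕ}
  (m : CoordModel E r)

/-- The Gram form of the frame. -/
def gram (x : E) : EuclideanSpace ℝ (Fin r) →L[ℝ] EuclideanSpace ℝ (Fin r) →L[ℝ] ℝ :=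
  ((ContinuousLinearMap.precomp ℝ (m.L x)).comp (m.G x)).comp (m.L x)

/-- The linear map that sends a covector on the standard space to the vector of the distribution
that represents it. -/
def lift (x : E) : (EuclideanSpace ℝ (Fin r) →L[ℝ] ℝ) →L[ℝ] E :=
  (m.L x).comp (m.gram x).inverse

/-- The orthogonal projector onto the distribution. -/
def P (x : E) : E →L[ℝ] E :=
  (m.lift x).comp ((ContinuousLinearMap.precomp ℝ (m.L x)).comp (m.G x))

/-- The inverse of the metric. -/
def sharp (x : E) : (E →L[ℝ] ℝ) →L[ℝ] E := (m.G x).inverse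

variable {m} {x : E}

theorem isInvertible_G (hx : x ∈ m.O) : (m.G x).IsInvertible := isInvertible_of_pos _ (m.pos x hx)

theorem isInvertible_gram (hx : x ∈ m.O) : (m.gram x).IsInvertible :=
  isInvertible_of_pos _ fun _ hv => m.pos x hx _ fun h => hv (m.inj x hx (h.trans (map_zero _).symm))

theorem G_lift (hx : x ∈ m.O) (f : EuclideanSpace ℝ (Fin r) →L[ℝ] ℝ)
    (y : EuclideanSpace ℝ (Fin r)) : m.G x (m.lift x f) (m.L x y) = f y := by
  have := DFunLike.congr_fun ((isInvertible_gram hx).self_apply_inverse f) y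
  exact this

theorem P_eq_L (x : E) (v : E) : ∃ y, m.P x v = m.L x y := ⟨_, rfl⟩

theorem G_P_L (hx : x ∈ m.O) (v : E) (y : EuclideanSpace ℝ (Fin r)) :
    m.G x (m.P x v) (m.L x y) = m.G x v (m.L x y) := G_lift hx _ y

theorem eq_zero_of_G_L {z : EuclideanSpace ℝ (Fin r)} (hx : x ∈ m.O)
    (h : ∀ y, m.G x (m.L x z) (m.L x y) = 0) : m.L x z = 0 := by
  by_contra h0
  exact (m.pos x hx _ h0).ne' (h z)

theorem P_L (hx : x ∈ m.O) (y : EuclideanSpace ℝ (Fin r)) : m.P x (m.L x y) = m.L x y := by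
  obtain ⟨z, hz⟩ := m.P_eq_L x (m.L x y)
  have : m.L x (z - y) = 0 := by
    refine eq_zero_of_G_L hx fun w => ?_
    rw [map_sub, ← hz, map_sub, sub_apply, G_P_L hx, sub_self]
  rw [map_sub, sub_eq_zero] at this
  rw [hz, this]

theorem P_P (hx : x ∈ m.O) (v : E) : m.P x (m.P x v) = m.P x v := by
  obtain ⟨z, hz⟩ := m.P_eq_L x v
  rw [hz, P_L hx]

theorem G_P_left (hx : x ∈ m.O) (u v : E) : m.G x (m.P x u) v = m.G x u (m.P x v) := by
  obtain ⟨z, hz⟩ := m.P_eq_L x v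
  obtain ⟨y, hy⟩ := m.P_eq_L x u
  rw [hz, ← G_P_L hx u z, ← hz, hy, m.symm x hx _ v, m.symm x hx _ (m.P x v), G_P_L hx]

theorem G_sharp (hx : x ∈ m.O) (p : E →L[ℝ] ℝ) (v : E) : m.G x (m.sharp x p) v = p v :=
  DFunLike.congr_fun ((isInvertible_G hx).self_apply_inverse p) v

theorem sharp_G (hx : x ∈ m.O) (v : E) : m.sharp x (m.G x v) = v :=
  (isInvertible_G hx).inverse_apply_self v

theorem eq_of_G_eq (hx : x ∈ m.O) {u v : E} (h : ∀ w, m.G x u w = m.G x v w) : u = v := by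
  rw [← sharp_G hx u, ← sharp_G hx v]
  congr 1
  ext w
  exact h w

theorem P_sharp (hx : x ∈ m.O) {p : E →L[ℝ] ℝ} (hp : p.comp (m.P x) = p) :
    m.P x (m.sharp x p) = m.sharp x p := by
  refine eq_of_G_eq hx fun w => ?_
  rw [G_P_left hx, G_sharp hx, G_sharp hx]
  exact DFunLike.congr_fun hp w

theorem sharp_symm (hx : x ∈ m.O) (p q : E →L[ℝ] ℝ) : p (m.sharp x q) = q (m.sharp x p) := by
  rw [← G_sharp hx p, m.symm x hx, G_sharp hx]

theorem sharp_pos (hx : x ∈ m.O) {p : E →L[ℝ] ℝ} (hp : p ≠ 0) : 0 < p (m.sharp x p) := by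
  rw [← G_sharp hx p]
  refine m.pos x hx _ fun h => hp ?_
  ext v
  rw [← G_sharp hx p, h]
  simp

theorem smooth_gram : ContDiffOn ℝ ∞ m.gram m.O :=
  contDiffOn_clm_apply.2 fun y =>
    (m.smooth_G.clm_apply (m.smooth_L.clm_apply (contDiffOn_const (c := y)))).clm_comp m.smooth_L

theorem smooth_lift : ContDiffOn ℝ ∞ m.lift m.O :=
  m.smooth_L.clm_comp (contDiffOn_inverse smooth_gram fun _ hx => isInvertible_gram hx)

theorem smooth_P : ContDiffOn ℝ ∞ m.P m.O :=
  contDiffOn_clm_apply.2 fun v =>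
    smooth_lift.clm_apply ((m.smooth_G.clm_apply (contDiffOn_const (c := v))).clm_comp m.smooth_L)

theorem smooth_sharp : ContDiffOn ℝ ∞ m.sharp m.O :=
  contDiffOn_inverse m.smooth_G fun _ hx => isInvertible_G hx

theorem hasFDerivAt_P (hx : x ∈ m.O) : HasFDerivAt m.P (fderiv ℝ m.P x) x :=
  ((smooth_P.contDiffAt (m.isOpen.mem_nhds hx)).differentiableAt (by simp)).hasFDerivAt

/-- Differentiation of `P ∘ P = P`. -/
theorem fderiv_P_comp (hx : x ∈ m.O) (u v : E) :
    fderiv ℝ m.P x u (m.P x v) + m.P x (fderiv ℝ m.P x u v) = fderiv ℝ m.P x u v := by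
  have h1 := (hasFDerivAt_P hx).clm_comp (hasFDerivAt_P hx)
  have h2 : (fun x => (m.P x).comp (m.P x)) =ᶠ[𝓝 x] m.P := by
    filter_upwards [m.isOpen.mem_nhds hx] with y hy
    ext v
    exact P_P hy v
  have h3 := (h1.congr_of_eventuallyEq h2.symm).unique (hasFDerivAt_P hx)
  have := DFunLike.congr_fun (DFunLike.congr_fun h3 u) v
  simp at this
  rw [add_comm]
  exact this

/-- For `p` in the dual of the distribution, `p ∘ D_uP` vanishes on the distribution. -/
theorem fderiv_P_annihilates (hx : x ∈ m.O) {p : E →L[ℝ] ℝ} (hp : p.comp (m.P x) = p) (u v : E) :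
    p (fderiv ℝ m.P x u (m.P x v)) = 0 := by
  have h := congrArg p (fderiv_P_comp hx u v)
  have h2 := DFunLike.congr_fun hp (fderiv ℝ m.P x u v)
  rw [ContinuousLinearMap.comp_apply] at h2
  rw [map_add, h2] at h
  linarith

end CoordModel

/-! ### The dual of the distribution in coordinates and its canonical forms -/

/-- A hyperplane, the kernel of `l`, is spanned by the vectors obtained from a basis by subtracting
multiples of one basis vector on which `l` does not vanish. -/
theorem kernel_frame {X : Type*} [AddCommGroup X] [Module ℝ X] {n : ℕ}
    (b : Module.Basis (Fin (n + 1)) ℝ X) (l : X →ₗ[ℝ] ℝ) (k : Fin (n + 1)) (hk : l (b k) ≠ 0) :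
    LinearIndependent ℝ (fun i : Fin n => b (k.succAbove i) - (l (b (k.succAbove i)) / l (b k)) • b k)
      ∧ Submodule.span ℝ (Set.range fun i : Fin n =>
          b (k.succAbove i) - (l (b (k.succAbove i)) / l (b k)) • b k) = LinearMap.ker l := by
  have hli : LinearIndependent ℝ
      (fun i : Fin n => b (k.succAbove i) - (l (b (k.succAbove i)) / l (b k)) • b k) := by
    rw [Fintype.linearIndependent_iff]
    intro c hc j
    have h := congrArg (b.coord (k.succAbove j)) hc
    simpa [map_sum, Finsupp.single_apply, (Fin.succAbove_ne k j).symm] using h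
  refine ⟨hli, ?_⟩
  have hX : Module.finrank ℝ X = n + 1 := by simp [Module.finrank_eq_card_basis b]
  have : FiniteDimensional ℝ X := b.finiteDimensional_of_finite
  refine Submodule.eq_of_le_of_finrank_le ?_ ?_
  · rw [Submodule.span_le]
    rintro _ ⟨i, rfl⟩
    simp [hk]
  · rw [finrank_span_eq_card hli, Fintype.card_fin]
    have h1 := LinearMap.finrank_range_add_finrank_ker l
    have h2 : 0 < Module.finrank ℝ (LinearMap.range l) := by
      rw [Module.finrank_pos_iff_exists_ne_zero]
      exact ⟨⟨l (b k), LinearMap.mem_range_self l _⟩, fun h => hk (congrArg Subtype.val h)⟩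
    omega

/-- The canonical symplectic form of `E × E^*`. -/
def wform {E : Type*} [NormedAddCommGroup E] [NormedSpace ℝ E] (X Y : E × (E →L[ℝ] ℝ)) : ℝ :=
  Y.2 X.1 - X.2 Y.1

namespace CoordModel
variable {E : Type*} [NormedAddCommGroup E] [NormedSpace ℝ E] [FiniteDimensional ℝ E] {r : ℕ}
  (m : CoordModel E r)

/-- The dual of the distribution in coordinates: covectors that vanish on the orthogonal
complement. -/
def N : Set (E × (E →L[ℝ] ℝ)) := {z | z.1 ∈ m.O ∧ z.2.comp (m.P z.1) = z.2}

/-- The tangent space of `N`. -/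
def TN (z : E × (E →L[ℝ] ℝ)) : Submodule ℝ (E × (E →L[ℝ] ℝ)) where
  carrier := {X | X.2 = X.2.comp (m.P z.1) + z.2.comp (fderiv ℝ m.P z.1 X.1)}
  add_mem' := by
    intro X Y hX hY
    simp only [mem_ofPred_eq, Prod.fst_add, Prod.snd_add, map_add, ContinuousLinearMap.add_comp,
      ContinuousLinearMap.comp_add] at *
    nth_rw 1 [hX, hY]
    abel
  zero_mem' := by simp
  smul_mem' := by
    intro c X hX
    simp only [mem_ofPred_eq, Prod.smul_fst, Prod.smul_snd, map_smul, ContinuousLinearMap.smul_comp,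
      ContinuousLinearMap.comp_smul] at *
    nth_rw 1 [hX]
    rw [smul_add]

/-- The tangent vectors of `N` that project into the distribution. -/
def NT (z : E × (E →L[ℝ] ℝ)) : Submodule ℝ (E × (E →L[ℝ] ℝ)) :=
  m.TN z ⊓ (LinearMap.ker ((m.P z.1 : E →ₗ[ℝ] E) - LinearMap.id)).comap (LinearMap.fst ℝ E _)

variable {m} {z : E × (E →L[ℝ] ℝ)}

theorem mem_TN {X : E × (E →L[ℝ] ℝ)} :
    X ∈ m.TN z ↔ X.2 = X.2.comp (m.P z.1) + z.2.comp (fderiv ℝ m.P z.1 X.1) := Iff.rfl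

theorem mem_NT {X : E × (E →L[ℝ] ℝ)} : X ∈ m.NT z ↔ X ∈ m.TN z ∧ m.P z.1 X.1 = X.1 := by
  rw [NT, Submodule.mem_inf]
  simp [sub_eq_zero]

theorem exists_L_eq {x u : E} (hu : m.P x u = u) : ∃ y, m.L x y = u := by
  obtain ⟨y, hy⟩ := m.P_eq_L x u
  exact ⟨y, hy ▸ hu⟩

variable (m) in
/-- A linear isomorphism of two copies of the standard space onto `NT z`. -/
def frameMap (z : E × (E →L[ℝ] ℝ)) :
    EuclideanSpace ℝ (Fin r) × EuclideanSpace ℝ (Fin r) →L[ℝ] E × (E →L[ℝ] ℝ) :=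
  ((m.L z.1).comp (ContinuousLinearMap.fst ℝ _ _)).prod
    ((((ContinuousLinearMap.compL ℝ E E ℝ z.2).comp (fderiv ℝ m.P z.1)).comp (m.L z.1)).comp
      (ContinuousLinearMap.fst ℝ _ _) + ((m.G z.1).comp (m.L z.1)).comp
        (ContinuousLinearMap.snd ℝ _ _))

theorem frameMap_apply (y : EuclideanSpace ℝ (Fin r) × EuclideanSpace ℝ (Fin r)) :
    m.frameMap z y =
      (m.L z.1 y.1, z.2.comp (fderiv ℝ m.P z.1 (m.L z.1 y.1)) + m.G z.1 (m.L z.1 y.2)) := rfl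

theorem frameMap_injective (hz : z ∈ m.N) : Function.Injective (m.frameMap z) := by
  refine (injective_iff_map_eq_zero _).2 fun y hy => ?_
  rw [frameMap_apply, Prod.mk_eq_zero] at hy
  have h1 : y.1 = 0 := m.inj z.1 hz.1 (hy.1.trans (map_zero _).symm)
  have h2 : m.L z.1 y.2 = 0 := by
    have := hy.2
    rw [hy.1, map_zero, ContinuousLinearMap.comp_zero, zero_add] at this
    refine eq_zero_of_G_L hz.1 fun w => ?_
    rw [this]
    rfl
  exact Prod.ext h1 (m.inj z.1 hz.1 (h2.trans (map_zero _).symm))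

theorem range_frameMap (hz : z ∈ m.N) : (m.frameMap z).range = m.NT z := by
  have hGP : ∀ y, (m.G z.1 (m.L z.1 y)).comp (m.P z.1) = m.G z.1 (m.L z.1 y) := fun y => by
    ext v
    rw [ContinuousLinearMap.comp_apply, ← G_P_left hz.1, P_L hz.1]
  have hDP : ∀ u, (z.2.comp (fderiv ℝ m.P z.1 u)).comp (m.P z.1) = 0 := fun u => by
    ext v
    exact fderiv_P_annihilates hz.1 hz.2 u v
  ext X
  constructor
  · rintro ⟨y, rfl⟩
    rw [mem_NT, mem_TN]
    simp only [ContinuousLinearMap.coe_coe, frameMap_apply, ContinuousLinearMap.add_comp, hDP, hGP,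
      P_L hz.1, and_true]
    abel
  · intro hX
    rw [mem_NT, mem_TN] at hX
    obtain ⟨y, hy⟩ := exists_L_eq hX.2
    have hs : m.P z.1 (m.sharp z.1 (X.2.comp (m.P z.1))) = m.sharp z.1 (X.2.comp (m.P z.1)) := by
      refine P_sharp hz.1 ?_
      ext v
      simp [P_P hz.1]
    obtain ⟨y', hy'⟩ := exists_L_eq hs
    refine ⟨(y, y'), ?_⟩
    rw [ContinuousLinearMap.coe_coe, frameMap_apply, hy, hy']
    refine Prod.ext rfl ?_
    conv_rhs => rw [hX.1]
    change _ + _ = _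
    rw [add_comm]
    congr 1
    ext v
    rw [G_sharp hz.1]

/-- The symplectic form is nondegenerate on `NT z`. -/
theorem wform_nondegenerate (hz : z ∈ m.N) {Z : E × (E →L[ℝ] ℝ)} (hZ : Z ∈ m.NT z)
    (h : ∀ Y ∈ m.NT z, wform Z Y = 0) : Z = 0 := by
  have hr : ∀ y, wform Z (m.frameMap z y) = 0 := fun y =>
    h _ (by rw [← range_frameMap hz]; exact ⟨y, rfl⟩)
  obtain ⟨h1, h2⟩ := mem_NT.1 hZ
  obtain ⟨y, hy⟩ := exists_L_eq h2
  have hu : Z.1 = 0 := by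
    rw [← hy]
    refine eq_zero_of_G_L hz.1 fun y' => ?_
    have := hr (0, y')
    rw [wform, frameMap_apply] at this
    simp only [map_zero, ContinuousLinearMap.comp_zero, zero_add, sub_zero] at this
    rw [← m.symm _ hz.1, hy]
    exact this
  refine Prod.ext hu ?_
  ext v
  rw [mem_TN, hu, map_zero, ContinuousLinearMap.comp_zero, add_zero] at h1
  obtain ⟨w, hw⟩ := m.P_eq_L z.1 v
  have := hr (w, 0)
  rw [wform, frameMap_apply, hu, map_zero, ← hw] at this
  rw [h1]
  simpa using this

variable (m) in
/-- The Hamiltonian with potential `V`. -/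
def ham (V : E → ℝ) (z : E × (E →L[ℝ] ℝ)) : ℝ := 1 / 2 * z.2 (m.sharp z.1 z.2) + V z.1

theorem smooth_ham {V : E → ℝ} (hV : ContDiffOn ℝ ∞ V m.O) :
    ContDiffOn ℝ ∞ (m.ham V) (m.O ×ˢ univ) := by
  have hf : MapsTo (Prod.fst : E × (E →L[ℝ] ℝ) → E) (m.O ×ˢ univ) m.O := fun z hz => hz.1
  have h1 := (smooth_sharp (m := m)).comp contDiffOn_fst hf
  exact (contDiffOn_const.mul (contDiffOn_snd.clm_apply (h1.clm_apply contDiffOn_snd))).add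
    (hV.comp contDiffOn_fst hf)

theorem hasFDerivAt_ham {V : E → ℝ} (hV : ContDiffOn ℝ ∞ V m.O) (hz : z.1 ∈ m.O) :
    HasFDerivAt (m.ham V) (fderiv ℝ (m.ham V) z) z :=
  (((smooth_ham hV).contDiffAt ((m.isOpen.prod isOpen_univ).mem_nhds ⟨hz, trivial⟩)).differentiableAt
    (by simp)).hasFDerivAt

/-- The fibre derivative of the Hamiltonian is the Legendre transformation. -/
theorem fderiv_ham_vertical {V : E → ℝ} (hV : ContDiffOn ℝ ∞ V m.O) (hz : z.1 ∈ m.O)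
    (b : E →L[ℝ] ℝ) : fderiv ℝ (m.ham V) z (0, b) = b (m.sharp z.1 z.2) := by
  have h1 : HasFDerivAt (fun p : E →L[ℝ] ℝ => (z.1, p)) (ContinuousLinearMap.inr ℝ E (E →L[ℝ] ℝ))
      z.2 := hasFDerivAt_prodMk_right z.1 z.2
  have h2 := HasFDerivAt.comp z.2 (hasFDerivAt_ham hV hz) h1
  have h3 : HasFDerivAt (fun p : E →L[ℝ] ℝ => 1 / 2 * p (m.sharp z.1 p) + V z.1) _ z.2 :=
    (((hasFDerivAt_id z.2).clm_apply
      ((m.sharp z.1).hasFDerivAt.comp z.2 (hasFDerivAt_id z.2))).const_mul (1 / 2)).add_const (V z.1)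
  have h4 := DFunLike.congr_fun (h2.unique h3) b
  simp at h4
  rw [h4, sharp_symm hz z.2 b]
  ring

variable (m) in
/-- The nonholonomic Hamiltonian vector field in coordinates. -/
def nhField (V : E → ℝ) (z : E × (E →L[ℝ] ℝ)) : E × (E →L[ℝ] ℝ) :=
  (m.sharp z.1 z.2, -(((fderiv ℝ (m.ham V) z).comp (ContinuousLinearMap.inl ℝ E _)).comp (m.P z.1)) +
    z.2.comp (fderiv ℝ m.P z.1 (m.sharp z.1 z.2)))

theorem smooth_fderiv_P : ContDiffOn ℝ ∞ (fderiv ℝ m.P) m.O :=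
  smooth_P.fderiv_of_isOpen m.isOpen (by simp)

theorem smooth_fderiv_ham {V : E → ℝ} (hV : ContDiffOn ℝ ∞ V m.O) :
    ContDiffOn ℝ ∞ (fderiv ℝ (m.ham V)) (m.O ×ˢ univ) :=
  (smooth_ham hV).fderiv_of_isOpen (m.isOpen.prod isOpen_univ) (by simp)

theorem smooth_nhField {V : E → ℝ} (hV : ContDiffOn ℝ ∞ V m.O) :
    ContDiffOn ℝ ∞ (m.nhField V) (m.O ×ˢ univ) := by
  have hf : MapsTo (Prod.fst : E × (E →L[ℝ] ℝ) → E) (m.O ×ˢ univ) m.O := fun z hz => hz.1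
  have h1 : ContDiffOn ℝ ∞ (fun z : E × (E →L[ℝ] ℝ) => m.sharp z.1 z.2) (m.O ×ˢ univ) :=
    ((smooth_sharp (m := m)).comp contDiffOn_fst hf).clm_apply contDiffOn_snd
  have h2 : ContDiffOn ℝ ∞ (fun z : E × (E →L[ℝ] ℝ) => m.P z.1) (m.O ×ˢ univ) :=
    (smooth_P (m := m)).comp contDiffOn_fst hf
  have h3 : ContDiffOn ℝ ∞ (fun z : E × (E →L[ℝ] ℝ) => fderiv ℝ m.P z.1) (m.O ×ˢ univ) :=
    (smooth_fderiv_P (m := m)).comp contDiffOn_fst hf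
  refine h1.prodMk (ContDiffOn.add ?_ (contDiffOn_snd.clm_comp (h3.clm_apply h1)))
  exact ((((smooth_fderiv_ham hV).clm_comp contDiffOn_const).clm_comp h2)).neg

theorem nhField_mem (V : E → ℝ) (hz : z ∈ m.N) : m.nhField V z ∈ m.NT z := by
  have hs := P_sharp hz.1 hz.2
  rw [mem_NT, mem_TN]
  refine ⟨?_, hs⟩
  ext v
  simp [nhField, P_P hz.1, fderiv_P_annihilates hz.1 hz.2]

theorem wform_nhField {V : E → ℝ} (hV : ContDiffOn ℝ ∞ V m.O) (hz : z ∈ m.N)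
    {Y : E × (E →L[ℝ] ℝ)} (hY : Y ∈ m.NT z) :
    wform (m.nhField V z) Y = fderiv ℝ (m.ham V) z Y := by
  obtain ⟨-, h2⟩ := mem_NT.1 hY
  have h3 : Y = (Y.1, 0) + (0, Y.2) := by simp
  conv_rhs => rw [h3, map_add, fderiv_ham_vertical hV hz.1]
  have h4 := fderiv_P_annihilates hz.1 hz.2 (m.sharp z.1 z.2) Y.1
  rw [h2] at h4
  simp [wform, nhField, h2, h4]
  ring

theorem smooth_frameMap : ContDiffOn ℝ ∞ m.frameMap (m.O ×ˢ univ) := by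
  have hf : MapsTo (Prod.fst : E × (E →L[ℝ] ℝ) → E) (m.O ×ˢ univ) m.O := fun z hz => hz.1
  have hL : ContDiffOn ℝ ∞ (fun z : E × (E →L[ℝ] ℝ) => m.L z.1) (m.O ×ˢ univ) :=
    m.smooth_L.comp contDiffOn_fst hf
  have hG : ContDiffOn ℝ ∞ (fun z : E × (E →L[ℝ] ℝ) => m.G z.1) (m.O ×ˢ univ) :=
    m.smooth_G.comp contDiffOn_fst hf
  have h3 : ContDiffOn ℝ ∞ (fun z : E × (E →L[ℝ] ℝ) => fderiv ℝ m.P z.1) (m.O ×ˢ univ) :=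
    (smooth_fderiv_P (m := m)).comp contDiffOn_fst hf
  refine contDiffOn_clm_apply.2 fun y => ?_
  simp only [frameMap_apply]
  have h4 := hL.clm_apply (contDiffOn_const (c := y.1))
  exact h4.prodMk ((contDiffOn_snd.clm_comp (h3.clm_apply h4)).add
    (hG.clm_apply (hL.clm_apply contDiffOn_const)))

/-- The vertical vector `(0, p)` at `(x, p)` shows that the differential of the Hamiltonian does
not vanish on `NT z`. -/
theorem radial_mem (hz : z ∈ m.N) : ((0 : E), z.2) ∈ m.NT z := by
  rw [mem_NT, mem_TN]
  simp [hz.2]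

theorem fderiv_ham_radial_pos {V : E → ℝ} (hV : ContDiffOn ℝ ∞ V m.O) (hz : z ∈ m.N)
    (h0 : z.2 ≠ 0) : 0 < fderiv ℝ (m.ham V) z (0, z.2) := by
  rw [fderiv_ham_vertical hV hz.1]
  exact sharp_pos hz.1 h0

theorem rank_pos (hz : z ∈ m.N) (h0 : z.2 ≠ 0) : 0 < r := by
  rcases Nat.eq_zero_or_pos r with h | h
  · subst h
    refine absurd ?_ h0
    ext v
    obtain ⟨y, hy⟩ := m.P_eq_L z.1 v
    rw [← hz.2, ContinuousLinearMap.comp_apply, hy, Subsingleton.elim y 0]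
    simp
  · exact h

/-- A local frame of the kernel of `dH` in `NT`. -/
theorem exists_contact_frame {V : E → ℝ} (hV : ContDiffOn ℝ ∞ V m.O) (hz : z ∈ m.N)
    (h0 : z.2 ≠ 0) :
    ∃ W : Set (E × (E →L[ℝ] ℝ)), IsOpen W ∧ z ∈ W ∧ W ⊆ m.O ×ˢ univ ∧
      ∃ s : Fin (2 * (r - 1) + 1) → E × (E →L[ℝ] ℝ) → E × (E →L[ℝ] ℝ),
        (∀ i, ContDiffOn ℝ ∞ (s i) W) ∧ ∀ y ∈ W ∩ m.N,
          LinearIndependent ℝ (fun i => s i y) ∧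
          ∀ X, X ∈ Submodule.span ℝ (Set.range fun i => s i y) ↔
            X ∈ m.NT y ∧ fderiv ℝ (m.ham V) y X = 0 := by
  have hr := rank_pos hz h0
  have hfr : Module.finrank ℝ (EuclideanSpace ℝ (Fin r) × EuclideanSpace ℝ (Fin r)) =
      2 * (r - 1) + 1 + 1 := by
    rw [Module.finrank_prod, finrank_euclideanSpace_fin]
    omega
  set b := Module.finBasisOfFinrankEq ℝ _ hfr with hb
  set l : E × (E →L[ℝ] ℝ) → EuclideanSpace ℝ (Fin r) × EuclideanSpace ℝ (Fin r) →L[ℝ] ℝ :=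
    fun y => (fderiv ℝ (m.ham V) y).comp (m.frameMap y) with hl
  have hls : ContDiffOn ℝ ∞ l (m.O ×ˢ univ) := (smooth_fderiv_ham hV).clm_comp smooth_frameMap
  -- the radial vector lies in the range of the frame, so that `dH` does not vanish on all of `b`
  obtain ⟨k, hk⟩ : ∃ k, l z (b k) ≠ 0 := by
    by_contra! h
    have h1 : (l z : _ →ₗ[ℝ] ℝ) = 0 := b.ext fun i => h i
    have h2 := radial_mem hz
    rw [← range_frameMap hz] at h2
    obtain ⟨y, hy⟩ := h2
    have h3 : l z y = 0 := DFunLike.congr_fun h1 y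
    have h4 : l z y = fderiv ℝ (m.ham V) z (0, z.2) := by rw [← hy]; rfl
    exact (fderiv_ham_radial_pos hV hz h0).ne' (h4.symm.trans h3)
  have hopen : IsOpen (m.O ×ˢ (univ : Set (E →L[ℝ] ℝ))) := m.isOpen.prod isOpen_univ
  have hlk : ContDiffOn ℝ ∞ (fun y => l y (b k)) (m.O ×ˢ univ) := hls.clm_apply contDiffOn_const
  have hfm : ContDiffOn ℝ ∞ (fun y => m.frameMap y) ((m.O ×ˢ univ) ∩ (fun y => l y (b k)) ⁻¹' {0}ᶜ) :=
    (smooth_frameMap (m := m)).mono inter_subset_left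
  refine ⟨(m.O ×ˢ univ) ∩ (fun y => l y (b k)) ⁻¹' {0}ᶜ,
    hlk.continuousOn.isOpen_inter_preimage hopen isOpen_compl_singleton, ⟨⟨hz.1, trivial⟩, hk⟩,
    inter_subset_left,
    fun i y => m.frameMap y (b (k.succAbove i) - (l y (b (k.succAbove i)) / l y (b k)) • b k),
    fun i => ?_, ?_⟩
  · have hq : ContDiffOn ℝ ∞ (fun y => l y (b (k.succAbove i)) / l y (b k))
        ((m.O ×ˢ univ) ∩ (fun y => l y (b k)) ⁻¹' {0}ᶜ) :=
      ((hls.clm_apply contDiffOn_const).mono inter_subset_left).div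
        (hlk.mono inter_subset_left) fun y hy => hy.2
    have hq2 := hq.smul (contDiffOn_const (c := b k))
    exact hfm.clm_apply (contDiffOn_const.sub hq2)
  · rintro y ⟨⟨-, hy2⟩, hyN⟩
    obtain ⟨h1, h2⟩ := kernel_frame b (l y).toLinearMap k hy2
    have hinj := frameMap_injective hyN
    refine ⟨h1.map' (m.frameMap y).toLinearMap (LinearMap.ker_eq_bot.2 hinj), fun X => ?_⟩
    have h3 := Submodule.map_span (m.frameMap y).toLinearMap (Set.range fun i =>
        b (k.succAbove i) - (l y (b (k.succAbove i)) / l y (b k)) • b k)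
    rw [← Set.range_comp] at h3
    erw [h2] at h3
    change X ∈ Submodule.span ℝ (Set.range (m.frameMap y ∘ fun i =>
      b (k.succAbove i) - (l y (b (k.succAbove i)) / l y (b k)) • b k)) ↔ _
    erw [← h3]
    rw [Submodule.mem_map, ← range_frameMap hyN]
    constructor
    · rintro ⟨y', hy', rfl⟩
      exact ⟨⟨y', rfl⟩, hy'⟩
    · rintro ⟨⟨y', rfl⟩, h⟩
      exact ⟨y', h, rfl⟩

end CoordModel

/-! ### Nonvanishing of `θ ∧ ω ^ k` -/

section Permutations

/-- The sign of a permutation of pairs that maps pairs to pairs: a factor `-1` for each pair whose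
order is reversed. -/
theorem sign_of_pairs {k : ℕ} (τ : Equiv.Perm (Fin k × Bool))
    (hτ : ∀ i, τ (i, true) = ((τ (i, false)).1, !(τ (i, false)).2)) :
    ((Equiv.Perm.sign τ : ℤ) : ℝ) = ∏ i : Fin k, if (τ (i, false)).2 then (-1 : ℝ) else 1 := by
  have hsurj : Function.Surjective fun i => (τ (i, false)).1 := by
    intro j
    obtain ⟨⟨i, b⟩, hi⟩ := τ.surjective (j, false)
    refine ⟨i, ?_⟩
    cases b with
    | false => simp [hi]
    | true =>
      rw [hτ] at hi
      exact congrArg Prod.fst hi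
  set ρ : Equiv.Perm (Fin k) := Equiv.ofBijective _ (Finite.surjective_iff_bijective.1 hsurj) with hρ
  set c : Fin k → Equiv.Perm Bool := fun i =>
    if (τ (i, false)).2 then Equiv.swap false true else 1 with hc
  have hdec : τ = Equiv.prodCongrLeft (fun _ : Bool => ρ) * Equiv.prodCongrRight c := by
    ext1 ⟨i, b⟩
    cases b with
    | false =>
      have : τ (i, false) = (ρ i, (τ (i, false)).2) := rfl
      rw [this]
      by_cases h : (τ (i, false)).2 <;> simp [hc, h]
    | true =>
      have : τ (i, true) = (ρ i, !(τ (i, false)).2) := hτ i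
      rw [this]
      by_cases h : (τ (i, false)).2 <;> simp [hc, h]
  have h1 : Equiv.Perm.sign τ = ∏ i, Equiv.Perm.sign (c i) := by
    conv_lhs => rw [hdec]
    rw [Equiv.Perm.sign_mul, Equiv.Perm.sign_prodCongrLeft, Equiv.Perm.sign_prodCongrRight]
    simp
  rw [h1]
  push_cast
  refine Finset.prod_congr rfl fun i _ => ?_
  by_cases h : (τ (i, false)).2 <;> simp [hc, h]

/-- The index set of `2 * k + 1` vectors as one distinguished index and `k` pairs. -/
def pairIndex (k : ℕ) : Option (Fin k × Bool) ≃ Fin (2 * k + 1) :=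
  Equiv.ofBijective
    (fun o => o.elim 0 fun p => ⟨2 * p.1 + 1 + p.2.toNat, by
      have := p.1.2; have := p.2.toNat_le; omega⟩) <| by
    rw [Fintype.bijective_iff_injective_and_card]
    constructor
    · rintro (_ | ⟨i, b⟩) (_ | ⟨j, c⟩) h
      · rfl
      · exact absurd (Fin.ext_iff.1 h) (by simp; omega)
      · exact absurd (Fin.ext_iff.1 h) (by simp)
      · simp only [Option.elim, Fin.mk.injEq] at h
        have hi : i = j := by
          have := b.toNat_le; have := c.toNat_le
          ext; omega
        subst hi
        cases b <;> cases c <;> simp_all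
    · simp; ring

theorem pairIndex_none (k : ℕ) : pairIndex k none = 0 := rfl

theorem pairIndex_false {k : ℕ} (i : Fin k) :
    pairIndex k (some (i, false)) = ⟨2 * i + 1, by omega⟩ := rfl

theorem pairIndex_true {k : ℕ} (i : Fin k) :
    pairIndex k (some (i, true)) = ⟨2 * i + 2, by omega⟩ := rfl

/-- On a vector `R` followed by a symplectic basis, every term of `θ ∧ om ^ k` is nonnegative. -/
theorem wedgePow_ne_zero {T : Type*} {θ : T → ℝ} {om : T → T → ℝ} {k : ℕ} (R : T)
    (f : Fin k × Bool → T) (hR : θ R = 1) (hf : ∀ a, θ (f a) = 0)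
    (hff : ∀ a b, om (f a) (f b) =
      if b = (a.1, !a.2) then (if a.2 then (-1 : ℝ) else 1) else 0) :
    wedgePow θ om k (fun j => ((pairIndex k).symm j).elim R f) ≠ 0 := by
  set v : Fin (2 * k + 1) → T := fun j => ((pairIndex k).symm j).elim R f with hv
  have hve : ∀ o, v (pairIndex k o) = o.elim R f := fun o => by simp [hv]
  set term : Equiv.Perm (Fin (2 * k + 1)) → ℝ := fun σ => ((Equiv.Perm.sign σ : ℤ) : ℝ) *
    (θ (v (σ 0)) * ∏ i : Fin k, om (v (σ ⟨2 * i + 1, by omega⟩)) (v (σ ⟨2 * i + 2, by omega⟩)))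
    with hterm
  have h1 : term 1 = 1 := by
    simp only [hterm, Equiv.Perm.sign_one, Equiv.Perm.one_apply, ← pairIndex_false,
      ← pairIndex_true, ← pairIndex_none, hve]
    simp [hR, hff]
  -- in a nonzero term `σ` fixes the index `0` and permutes the pairs, so that the product of the
  -- pairings is the sign of `σ`
  have h0 : ∀ σ, 0 ≤ term σ := by
    intro σ
    by_cases hσ : term σ = 0
    · exact hσ.ge
    have hθ : θ (v (σ 0)) ≠ 0 := fun h => hσ (by simp [hterm, h])
    have hom : ∀ i : Fin k, om (v (σ ⟨2 * i + 1, by omega⟩)) (v (σ ⟨2 * i + 2, by omega⟩)) ≠ 0 :=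
      fun i h => hσ (by
        simp only [hterm]
        rw [Finset.prod_eq_zero (Finset.mem_univ i) h]
        simp)
    set σ' : Equiv.Perm (Option (Fin k × Bool)) := (pairIndex k).symm.permCongr σ with hσ'
    have hσσ : ∀ o, σ (pairIndex k o) = pairIndex k (σ' o) := fun o => by simp [hσ']
    have hnone : σ' none = none := by
      rw [← pairIndex_none, hσσ, hve] at hθ
      rcases h : σ' none with _ | a
      · rfl
      · rw [h] at hθ
        exact absurd (hf a) hθ
    set τ := Equiv.removeNone σ' with hτ
    have hsome : ∀ a, σ' (some a) = some (τ a) := fun a => by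
      obtain ⟨b, hb⟩ : ∃ b, σ' (some a) = some b := by
        rcases h : σ' (some a) with _ | b
        · exact absurd (σ'.injective (h.trans hnone.symm)) (by simp)
        · exact ⟨b, rfl⟩
      exact (Equiv.removeNone_some σ' ⟨b, hb⟩).symm
    have hσopt : σ' = Equiv.optionCongr τ := by
      ext1 o
      cases o with
      | none => simp [hnone]
      | some a => simp [hsome]
    have hsign : Equiv.Perm.sign σ = Equiv.Perm.sign τ := by
      rw [← Equiv.optionCongr_sign τ, ← hσopt, hσ', Equiv.Perm.sign_permCongr]
    have hpair : ∀ i, om (f (τ (i, false))) (f (τ (i, true))) ≠ 0 := fun i => by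
      have := hom i
      rw [← pairIndex_false, ← pairIndex_true, hσσ, hσσ, hve, hve, hsome, hsome] at this
      exact this
    have hpair2 : ∀ i, τ (i, true) = ((τ (i, false)).1, !(τ (i, false)).2) := fun i => by
      by_contra h
      exact hpair i (by rw [hff, if_neg h])
    have hval : ∀ i, om (f (τ (i, false))) (f (τ (i, true))) =
        if (τ (i, false)).2 then (-1 : ℝ) else 1 := fun i => by
      rw [hff, if_pos (hpair2 i)]
    have : term σ = ((Equiv.Perm.sign τ : ℤ) : ℝ) * ((Equiv.Perm.sign τ : ℤ) : ℝ) := by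
      simp only [hterm]
      rw [hsign, ← pairIndex_none, hσσ, hnone, hve]
      simp only [← pairIndex_false, ← pairIndex_true, hσσ, hve, hsome, Option.elim, hR, one_mul, hval]
      rw [← sign_of_pairs τ hpair2]
    rw [this]
    exact mul_self_nonneg _
  have hsum : 0 < ∑ σ, term σ :=
    Finset.sum_pos' (fun σ _ => h0 σ) ⟨1, Finset.mem_univ _, by rw [h1]; exact one_pos⟩
  rw [wedgePow]
  exact mul_ne_zero (by positivity) hsum.ne'

end Permutations

section Symplectic
variable {T : Type*} [AddCommGroup T] [Module ℝ T]

theorem finrank_range_add_finrank_inf_ker {X : Type*} [AddCommGroup X] [Module ℝ X]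
    (W : Submodule ℝ T) [FiniteDimensional ℝ W] (q : T →ₗ[ℝ] X) :
    Module.finrank ℝ (LinearMap.range (q.domRestrict W)) +
      Module.finrank ℝ (W ⊓ LinearMap.ker q : Submodule ℝ T) = Module.finrank ℝ W := by
  rw [← LinearMap.finrank_range_add_finrank_ker (q.domRestrict W), LinearMap.ker_domRestrict,
    ← Submodule.map_comap_subtype, Submodule.finrank_map_subtype_eq]

/-- A nondegenerate alternating form on a `2 * k`-dimensional subspace has a symplectic basis,
indexed by `k` pairs. -/
theorem exists_symplectic_basis (B : LinearMap.BilinForm ℝ T) (hB : B.IsAlt) (k : ℕ) :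
    ∀ W : Submodule ℝ T, FiniteDimensional ℝ W → Module.finrank ℝ W = 2 * k →
      (∀ x ∈ W, (∀ y ∈ W, B x y = 0) → x = 0) →
      ∃ f : Fin k × Bool → T, (∀ a, f a ∈ W) ∧
        ∀ a b, B (f a) (f b) = if b = (a.1, !a.2) then (if a.2 then (-1 : ℝ) else 1) else 0 := by
  induction k with
  | zero => exact fun W _ _ _ => ⟨fun a => a.1.elim0, fun a => a.1.elim0, fun a => a.1.elim0⟩
  | succ k ih =>
    intro W hW hr hn
    have hsk : ∀ x y, B x y = - B y x := fun x y => by rw [hB.neg_eq]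
    obtain ⟨⟨x, hx⟩, hx0⟩ := Module.finrank_pos_iff_exists_ne_zero.1
      (show 0 < Module.finrank ℝ W by omega)
    have hx0 : x ≠ 0 := fun h => hx0 (Subtype.ext h)
    obtain ⟨y', hy', hxy'⟩ : ∃ y' ∈ W, B x y' ≠ 0 := by
      by_contra! h
      exact hx0 (hn x hx h)
    obtain ⟨y, hy_def⟩ : ∃ y, y = (B x y')⁻¹ • y' := ⟨_, rfl⟩
    have hy : y ∈ W := hy_def ▸ W.smul_mem _ hy'
    have hxy : B x y = 1 := by simp [hy_def, hxy']
    have hyx : B y x = -1 := by rw [hsk, hxy]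
    -- split off the hyperbolic plane spanned by `x` and `y`
    set q : T →ₗ[ℝ] ℝ × ℝ := (B x).prod (B y) with hq
    set W' := W ⊓ LinearMap.ker q with hW'
    have hmem : ∀ {w}, w ∈ W' ↔ w ∈ W ∧ B x w = 0 ∧ B y w = 0 := by
      intro w
      rw [hW', Submodule.mem_inf, LinearMap.mem_ker]
      simp [hq]
    have hrank : Module.finrank ℝ W' = 2 * k := by
      have h1 := finrank_range_add_finrank_inf_ker W q
      have h2 : LinearMap.range (q.domRestrict W) = ⊤ := by
        rw [LinearMap.range_eq_top]
        rintro ⟨s, t⟩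
        refine ⟨⟨s • y - t • x, W.sub_mem (W.smul_mem _ hy) (W.smul_mem _ hx)⟩, ?_⟩
        simp [hq, hxy, hyx, hB.self_eq_zero]
      rw [h2, finrank_top, Module.finrank_prod, Module.finrank_self, ← hW'] at h1
      omega
    obtain ⟨f, hfW, hf⟩ := ih W' (Submodule.finiteDimensional_of_le inf_le_left) hrank (by
      intro w hw h
      have hw' := hmem.1 hw
      refine hn w hw'.1 fun z hz => ?_
      have hz' : z + B y z • x - B x z • y ∈ W' := by
        rw [hmem]
        refine ⟨W.sub_mem (W.add_mem hz (W.smul_mem _ hx)) (W.smul_mem _ hy), ?_, ?_⟩ <;>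
          simp [hxy, hyx, hB.self_eq_zero]
      have := h _ hz'
      rw [map_sub, map_add, map_smul, map_smul, hsk w x, hsk w y, hw'.2.1, hw'.2.2] at this
      simpa only [neg_zero, smul_zero, add_zero, sub_zero] using this)
    refine ⟨fun a => Fin.cases (if a.2 then y else x) (fun i => f (i, a.2)) a.1, ?_, ?_⟩
    · rintro ⟨i, b⟩
      refine Fin.cases ?_ (fun j => ?_) i
      · cases b <;> simp [hx, hy]
      · exact (hmem.1 (hfW _)).1
    · have hf0 := fun a => (hmem.1 (hfW a)).2
      have hf1 : ∀ a, B (f a) x = 0 := fun a => by rw [hsk, (hf0 a).1, neg_zero]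
      have hf2 : ∀ a, B (f a) y = 0 := fun a => by rw [hsk, (hf0 a).2, neg_zero]
      rintro ⟨i, b⟩ ⟨j, c⟩
      refine Fin.cases ?_ (fun i => ?_) i <;> refine Fin.cases ?_ (fun j => ?_) j
      · cases b <;> cases c <;> simp [hxy, hyx, hB.self_eq_zero]
      · cases b <;> simp [(hf0 _).1, (hf0 _).2]
      · cases c <;> simp [hf1, hf2, (Fin.succ_ne_zero _).symm]
      · simp [hf, Prod.ext_iff, Fin.ext_iff]

/-- On a space `C` of dimension `2 * k + 1` on which `B` has the kernel `ℝ R` and `θ R = 1`, the form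
`θ ∧ B ^ k` does not vanish. -/
theorem exists_wedgePow_ne_zero (B : LinearMap.BilinForm ℝ T) (hB : B.IsAlt) (θ : T →ₗ[ℝ] ℝ)
    (C : Submodule ℝ T) {k : ℕ} (hC : FiniteDimensional ℝ C)
    (hr : Module.finrank ℝ C = 2 * k + 1) {R : T} (hRC : R ∈ C) (hR : θ R = 1)
    (hRB : ∀ v ∈ C, B R v = 0) (hn : ∀ x ∈ C, θ x = 0 → (∀ y ∈ C, B x y = 0) → x = 0) :
    ∃ v : Fin (2 * k + 1) → T, (∀ i, v i ∈ C) ∧ wedgePow θ (fun x y => B x y) k v ≠ 0 := by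
  set W := C ⊓ LinearMap.ker θ with hW
  have hmem : ∀ {w}, w ∈ W ↔ w ∈ C ∧ θ w = 0 := by
    intro w
    rw [hW, Submodule.mem_inf, LinearMap.mem_ker]
  have hrank : Module.finrank ℝ W = 2 * k := by
    have h1 := finrank_range_add_finrank_inf_ker C θ
    have h2 : LinearMap.range (θ.domRestrict C) = ⊤ := by
      rw [LinearMap.range_eq_top]
      exact fun s => ⟨⟨s • R, C.smul_mem _ hRC⟩, by simp [hR]⟩
    rw [h2, finrank_top, Module.finrank_self, ← hW] at h1
    omega
  have hRB' : ∀ v ∈ C, B v R = 0 := fun v hv => by rw [← hB.neg_eq, hRB v hv, neg_zero]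
  obtain ⟨f, hfW, hf⟩ := exists_symplectic_basis B hB k W (Submodule.finiteDimensional_of_le inf_le_left)
    hrank (by
      intro x hx h
      rw [hmem] at hx
      refine hn x hx.1 hx.2 fun y hy => ?_
      have := h (y - θ y • R) (hmem.2 ⟨C.sub_mem hy (C.smul_mem _ hRC), by simp [hR]⟩)
      rw [map_sub, map_smul, hRB' x hx.1] at this
      simpa using this)
  have hf' := fun a => hmem.1 (hfW a)
  refine ⟨_, fun i => ?_, wedgePow_ne_zero R f hR (fun a => (hf' a).2) hf⟩
  rcases (pairIndex k).symm i with _ | a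
  · exact hRC
  · exact (hf' a).1

end Symplectic

/-! ### Coordinate models of metrics and distributions -/

section Charts
variable {E : Type*} [NormedAddCommGroup E] [NormedSpace ℝ E]
  {Q : Type*} [TopologicalSpace Q] [ChartedSpace E Q] [IsManifold 𝓘(ℝ, E) ∞ Q]

theorem metricInChart_extChartAt (G : MetricField E Q) (p : Q) {q : Q}
    (hq : q ∈ (extChartAt 𝓘(ℝ, E) p).source) (u w : E) :
    metricInChart G p (extChartAt 𝓘(ℝ, E) p q) u w =
      G q ((dchart 𝓘(ℝ, E) p q).inverse u) ((dchart 𝓘(ℝ, E) p q).inverse w) := by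
  have h := mfderiv_extChartAt_symm_eq (J := 𝓘(ℝ, E)) p ((extChartAt 𝓘(ℝ, E) p).map_source hq)
  have h1 : metricInChart G p (extChartAt 𝓘(ℝ, E) p q) u w =
      G ((extChartAt 𝓘(ℝ, E) p).symm (extChartAt 𝓘(ℝ, E) p q))
        (mfderiv 𝓘(ℝ, E) 𝓘(ℝ, E) (extChartAt 𝓘(ℝ, E) p).symm (extChartAt 𝓘(ℝ, E) p q) u)
        (mfderiv 𝓘(ℝ, E) 𝓘(ℝ, E) (extChartAt 𝓘(ℝ, E) p).symm (extChartAt 𝓘(ℝ, E) p q) w) := rfl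
  rw [h1, h, (extChartAt 𝓘(ℝ, E) p).left_inv hq]
  exact rfl

theorem metricInChart_dchart (G : MetricField E Q) (p : Q) {q : Q}
    (hq : q ∈ (extChartAt 𝓘(ℝ, E) p).source) (u w : TangentSpace 𝓘(ℝ, E) q) :
    metricInChart G p (extChartAt 𝓘(ℝ, E) p q) (dchart 𝓘(ℝ, E) p q u) (dchart 𝓘(ℝ, E) p q w) =
      G q u w := by
  rw [metricInChart_extChartAt G p hq, inverse_dchart_apply hq, inverse_dchart_apply hq]

/-- `G` is a smooth Riemannian metric on the open set `U`. -/
structure IsMetricOn (G : MetricField E Q) (U : Set Q) : Prop where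
  isOpen : IsOpen U
  symm : ∀ q ∈ U, ∀ u v, G q u v = G q v u
  pos : ∀ q ∈ U, ∀ v, v ≠ 0 → 0 < G q v v
  smooth : ∀ p : Q, ContDiffOn ℝ ∞ (metricInChart G p)
    ((extChartAt 𝓘(ℝ, E) p).target ∩ (extChartAt 𝓘(ℝ, E) p).symm ⁻¹' U)

variable [FiniteDimensional ℝ E]

set_option synthInstance.maxHeartbeats 200000 in
theorem contMDiffOn_inner_apply
    (g : ContMDiffRiemannianMetric 𝓘(ℝ, E) ∞ E (fun q : Q => TangentSpace 𝓘(ℝ, E) q))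
    {W : Set Q} {X Y : ∀ q : Q, TangentSpace 𝓘(ℝ, E) q}
    (hX : ContMDiffOn 𝓘(ℝ, E) 𝓘(ℝ, E).tangent ∞
      (fun q => (⟨q, X q⟩ : TangentBundle 𝓘(ℝ, E) Q)) W)
    (hY : ContMDiffOn 𝓘(ℝ, E) 𝓘(ℝ, E).tangent ∞
      (fun q => (⟨q, Y q⟩ : TangentBundle 𝓘(ℝ, E) Q)) W) :
    ContMDiffOn 𝓘(ℝ, E) 𝓘(ℝ, ℝ) ∞ (fun q => g.inner q (X q) (Y q)) W := by
  have h := ContMDiffOn.clm_bundle_apply₂ (F₃ := ℝ) (E₃ := Bundle.Trivial Q ℝ)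
    (b := fun q : Q => q) (ψ := g.inner) g.contMDiff.contMDiffOn hX hY
  intro q hq
  exact ((contMDiffWithinAt_totalSpace).1 (h q hq)).2

theorem contDiffOn_metricInChart
    (g : ContMDiffRiemannianMetric 𝓘(ℝ, E) ∞ E (fun q : Q => TangentSpace 𝓘(ℝ, E) q)) (p : Q) :
    ContDiffOn ℝ ∞ (metricInChart g.inner p) (extChartAt 𝓘(ℝ, E) p).target := by
  refine contDiffOn_clm_apply.2 fun u => contDiffOn_clm_apply.2 fun w => ?_
  have hc : ∀ u : E, ContMDiffOn 𝓘(ℝ, E) 𝓘(ℝ, E).tangent ∞ (fun q =>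
      (⟨q, (dchart 𝓘(ℝ, E) p q).inverse u⟩ : TangentBundle 𝓘(ℝ, E) Q))
      (extChartAt 𝓘(ℝ, E) p).source := fun u =>
    (contMDiffOn_inverse_dchart_field p isOpen_univ (contDiffOn_const (c := u))).mono (by simp)
  have h := contMDiffOn_inner_apply g (hc u) (hc w)
  have h3 := h.comp (contMDiffOn_extChartAt_symm (I := 𝓘(ℝ, E)) (n := ∞) p)
    (fun x hx => (extChartAt 𝓘(ℝ, E) p).map_target hx)
  rw [contMDiffOn_iff_contDiffOn] at h3
  refine h3.congr fun x hx => ?_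
  have := metricInChart_extChartAt g.inner p ((extChartAt 𝓘(ℝ, E) p).map_target hx) u w
  rwa [(extChartAt 𝓘(ℝ, E) p).right_inv hx] at this

theorem proj_mem_and_sub_mem {G : MetricField E Q} {U : Set Q} (hG : IsMetricOn G U)
    (D : DistField E Q) {q : Q} (hq : q ∈ U) (v : TangentSpace 𝓘(ℝ, E) q) :
    proj G D q v ∈ D q ∧ v - proj G D q v ∈ orth G D q := by
  have h := isCompl_orth G D q (hG.symm q hq) (hG.pos q hq)
  rw [proj, dif_pos h]
  exact ⟨Submodule.projection_apply_mem h v, Submodule.sub_projection_mem h v⟩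

theorem eq_proj {G : MetricField E Q} {U : Set Q} (hG : IsMetricOn G U)
    (D : DistField E Q) {q : Q} (hq : q ∈ U) {v w : TangentSpace 𝓘(ℝ, E) q}
    (hw : w ∈ D q) (hvw : v - w ∈ orth G D q) : proj G D q v = w := by
  have h := isCompl_orth G D q (hG.symm q hq) (hG.pos q hq)
  obtain ⟨h1, h2⟩ := proj_mem_and_sub_mem hG D hq v
  have h3 := (Submodule.disjoint_def.1 h.disjoint) (w - proj G D q v) ((D q).sub_mem hw h1) (by
    have := (orth G D q).sub_mem h2 hvw
    simpa using this)
  rw [sub_eq_zero] at h3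
  exact h3.symm

theorem isMetricOn_inner
    (g : ContMDiffRiemannianMetric 𝓘(ℝ, E) ∞ E (fun q : Q => TangentSpace 𝓘(ℝ, E) q)) :
    IsMetricOn g.inner (univ : Set Q) where
  isOpen := isOpen_univ
  symm q _ := g.symm q
  pos q _ := g.pos q
  smooth p := (contDiffOn_metricInChart g p).mono inter_subset_left

theorem contDiffOn_comp_extChartAt_symm {V : Q → ℝ} (hV : ContMDiff 𝓘(ℝ, E) 𝓘(ℝ, ℝ) ∞ V) (p : Q) :
    ContDiffOn ℝ ∞ (fun x => V ((extChartAt 𝓘(ℝ, E) p).symm x)) (extChartAt 𝓘(ℝ, E) p).target := by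
  rw [← contMDiffOn_iff_contDiffOn]
  exact hV.comp_contMDiffOn (contMDiffOn_extChartAt_symm (I := 𝓘(ℝ, E)) (n := ∞) p)

theorem isMetricOn_jacobi
    (g : ContMDiffRiemannianMetric 𝓘(ℝ, E) ∞ E (fun q : Q => TangentSpace 𝓘(ℝ, E) q))
    {V : Q → ℝ} (hV : ContMDiff 𝓘(ℝ, E) 𝓘(ℝ, ℝ) ∞ V) (e : ℝ) :
    IsMetricOn (jacobi g.inner V e) (region V e) where
  isOpen := isOpen_lt hV.continuous continuous_const
  symm q _ u v := by
    change (e - V q) * g.inner q u v = (e - V q) * g.inner q v u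
    rw [g.symm]
  pos q hq v hv := by
    change 0 < (e - V q) * g.inner q v v
    exact mul_pos (sub_pos.2 hq) (g.pos q v hv)
  smooth p := by
    have h1 := (contDiffOn_const (c := e)).sub (contDiffOn_comp_extChartAt_symm hV p)
    refine contDiffOn_clm_apply.2 fun u => contDiffOn_clm_apply.2 fun w => ?_
    exact (h1.mul (((contDiffOn_metricInChart g p).clm_apply (contDiffOn_const (c := u))).clm_apply
      (contDiffOn_const (c := w)))).mono inter_subset_left

/-- `m` describes the metric `G` and the distribution `D` in the chart at `p`, over the
coordinate domain `m.O`, which lies over `U`. -/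
structure IsModelAt {r : ℕ} (m : CoordModel E r) (G : MetricField E Q) (D : DistField E Q)
    (U : Set Q) (p : Q) : Prop where
  O_subset : m.O ⊆ (extChartAt 𝓘(ℝ, E) p).target
  O_subset' : m.O ⊆ (extChartAt 𝓘(ℝ, E) p).symm ⁻¹' U
  G_eq : m.G = metricInChart G p
  mem_iff : ∀ q ∈ (extChartAt 𝓘(ℝ, E) p).source, extChartAt 𝓘(ℝ, E) p q ∈ m.O →
    ∀ v : TangentSpace 𝓘(ℝ, E) q, v ∈ D q ↔
      ∃ y, m.L (extChartAt 𝓘(ℝ, E) p q) y = dchart 𝓘(ℝ, E) p q v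

/-- Every point of `U` has a coordinate model: the frame is the local frame of the distribution, read in
the chart. -/
theorem exists_model {r : ℕ} {G : MetricField E Q} {U : Set Q} (hG : IsMetricOn G U)
    {D : DistField E Q} (hD : IsDistribution D r) {p : Q} (hp : p ∈ U) :
    ∃ m : CoordModel E r, extChartAt 𝓘(ℝ, E) p p ∈ m.O ∧ IsModelAt m G D U p := by
  obtain ⟨W, hW, hpW, s, hs, hsW⟩ := hD p (mem_univ p)
  set φ := extChartAt 𝓘(ℝ, E) p with hφ
  have hpφ : p ∈ φ.source := mem_extChartAt_source p
  have hcont : ContinuousOn φ.symm φ.target := continuousOn_extChartAt_symm p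
  set O := φ.target ∩ φ.symm ⁻¹' (W ∩ U) with hO
  have hOo : IsOpen O := hcont.isOpen_inter_preimage (isOpen_extChartAt_target p) (hW.inter hG.isOpen)
  -- the frame in coordinates
  set f : Fin r → E → E := fun i x => dchart 𝓘(ℝ, E) p (φ.symm x) (s i (φ.symm x)) with hf
  have hfs : ∀ i, ContDiffOn ℝ ∞ (f i) O := fun i => by
    have h1 := (contMDiffOn_field_iff p (s i) (hW.inter (isOpen_extChartAt_source p))
      inter_subset_right).1 ((hs i).mono inter_subset_left)
    rw [← contMDiffOn_iff_contDiffOn]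
    exact h1.comp ((contMDiffOn_extChartAt_symm (I := 𝓘(ℝ, E)) (n := ∞) p).mono inter_subset_left)
      fun x hx => ⟨hx.2.1, φ.map_target hx.1⟩
  set L : E → EuclideanSpace ℝ (Fin r) →L[ℝ] E := fun x =>
    ∑ i, (EuclideanSpace.proj i : EuclideanSpace ℝ (Fin r) →L[ℝ] ℝ).smulRight (f i x) with hL
  have hLa : ∀ x y, L x y = ∑ i, y i • f i x := fun x y => by
    simp [hL]
  have hinj : ∀ x ∈ O, Function.Injective (L x) := by
    intro x hx
    refine (injective_iff_map_eq_zero _).2 fun y hy => ?_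
    have h1 := (hsW _ ⟨hx.2.1, mem_univ _⟩).1
    have h2 := (dchart_isInvertible (J := 𝓘(ℝ, E)) (x₀ := p) (φ.map_target hx.1)).injective
    rw [hLa] at hy
    have h3 : ∑ i, y i • s i (φ.symm x) = 0 := by
      refine h2 ?_
      rw [map_sum, map_zero, ← hy]
      exact Finset.sum_congr rfl fun i _ => map_smul _ _ _
    ext i
    exact Fintype.linearIndependent_iff.1 h1 _ h3 i
  refine ⟨⟨O, metricInChart G p, L, hOo, (hG.smooth p).mono ?_, ?_, ?_, ?_, hinj⟩, ?_, ?_⟩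
  · exact fun x hx => ⟨hx.1, hx.2.2⟩
  · refine contDiffOn_clm_apply.2 fun y => ?_
    simp only [hLa]
    exact ContDiffOn.sum fun i _ => (contDiffOn_const (c := y i)).smul (hfs i)
  · intro x hx u v
    have h1 := metricInChart_extChartAt G p (φ.map_target hx.1)
    rw [φ.right_inv hx.1] at h1
    rw [h1, h1, hG.symm _ hx.2.2]
  · intro x hx u hu
    have h1 := metricInChart_extChartAt G p (φ.map_target hx.1)
    rw [φ.right_inv hx.1] at h1
    rw [h1]
    refine hG.pos _ hx.2.2 _ fun h => hu ?_
    rw [← dchart_inverse_apply (J := 𝓘(ℝ, E)) (φ.map_target hx.1) u, h, map_zero]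
  · exact ⟨φ.map_source hpφ, by rw [mem_preimage, φ.left_inv hpφ]; exact ⟨hpW, hp⟩⟩
  · refine ⟨inter_subset_left, fun x hx => hx.2.2, rfl, ?_⟩
    intro q hq hqO v
    have h1 := (hsW q ⟨by have := hqO.2.1; rwa [φ.left_inv hq] at this, mem_univ _⟩).2
    have h2 := (dchart_isInvertible (J := 𝓘(ℝ, E)) (x₀ := p) hq).injective
    have h3 : ∀ y, L (φ q) y = dchart 𝓘(ℝ, E) p q (∑ i, y i • s i q) := fun y => by
      rw [hLa, map_sum]
      refine Finset.sum_congr rfl fun i _ => ?_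
      rw [map_smul]
      simp only [hf]
      rw [φ.left_inv hq]
    have h4 : v ∈ D q ↔ v ∈ Submodule.span ℝ (Set.range fun i => s i q) := (Set.ext_iff.1 h1 v).symm
    rw [h4, Submodule.mem_span_range_iff_exists_fun]
    constructor
    · rintro ⟨c, rfl⟩
      exact ⟨WithLp.toLp 2 c, h3 _⟩
    · rintro ⟨y, hy⟩
      exact ⟨y, h2 ((h3 y).symm.trans hy)⟩

variable {r : ℕ} {m : CoordModel E r} {G : MetricField E Q} {D : DistField E Q} {U : Set Q} {p q : Q}

/-- A covector in the chart at `p`. -/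
def covec (p : Q) {q : Q} (α : TangentSpace 𝓘(ℝ, E) q →L[ℝ] ℝ) : E →L[ℝ] ℝ :=
  α.comp (dchart 𝓘(ℝ, E) p q).inverse

theorem covec_apply (α : TangentSpace 𝓘(ℝ, E) q →L[ℝ] ℝ) (u : E) :
    covec p α u = α ((dchart 𝓘(ℝ, E) p q).inverse u) := rfl

theorem covec_dchart (hq : q ∈ (extChartAt 𝓘(ℝ, E) p).source)
    (α : TangentSpace 𝓘(ℝ, E) q →L[ℝ] ℝ) (v : TangentSpace 𝓘(ℝ, E) q) :
    covec p α (dchart 𝓘(ℝ, E) p q v) = α v := by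
  rw [covec_apply, inverse_dchart_apply hq]

namespace IsModelAt

theorem mem_U (h : IsModelAt m G D U p) (hq : q ∈ (extChartAt 𝓘(ℝ, E) p).source)
    (hqO : extChartAt 𝓘(ℝ, E) p q ∈ m.O) : q ∈ U := by
  have := h.O_subset' hqO
  rwa [mem_preimage, (extChartAt 𝓘(ℝ, E) p).left_inv hq] at this

theorem G_dchart (h : IsModelAt m G D U p) (hq : q ∈ (extChartAt 𝓘(ℝ, E) p).source)
    (u w : TangentSpace 𝓘(ℝ, E) q) :
    m.G (extChartAt 𝓘(ℝ, E) p q) (dchart 𝓘(ℝ, E) p q u) (dchart 𝓘(ℝ, E) p q w) = G q u w := by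
  rw [h.G_eq, metricInChart_dchart G p hq]

theorem P_dchart (hG : IsMetricOn G U) (h : IsModelAt m G D U p)
    (hq : q ∈ (extChartAt 𝓘(ℝ, E) p).source) (hqO : extChartAt 𝓘(ℝ, E) p q ∈ m.O)
    (v : TangentSpace 𝓘(ℝ, E) q) :
    m.P (extChartAt 𝓘(ℝ, E) p q) (dchart 𝓘(ℝ, E) p q v) = dchart 𝓘(ℝ, E) p q (proj G D q v) := by
  obtain ⟨y, hy⟩ := m.P_eq_L (extChartAt 𝓘(ℝ, E) p q) (dchart 𝓘(ℝ, E) p q v)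
  set w := (dchart 𝓘(ℝ, E) p q).inverse (m.P (extChartAt 𝓘(ℝ, E) p q) (dchart 𝓘(ℝ, E) p q v))
    with hw
  have hw' : dchart 𝓘(ℝ, E) p q w = m.P (extChartAt 𝓘(ℝ, E) p q) (dchart 𝓘(ℝ, E) p q v) :=
    dchart_inverse_apply hq _
  rw [← hw', eq_proj hG D (h.mem_U hq hqO) (w := w)]
  · exact (h.mem_iff q hq hqO w).2 ⟨y, by rw [hw', hy]⟩
  · intro u hu
    obtain ⟨z, hz⟩ := (h.mem_iff q hq hqO u).1 hu
    have hU := h.mem_U hq hqO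
    rw [hG.symm q hU, map_sub, sub_apply, ← h.G_dchart hq, ← h.G_dchart hq,
      hw', ← hz, CoordModel.G_P_L hqO, sub_self]

theorem isInvertible (hG : IsMetricOn G U) (hq : q ∈ U) : (G q).IsInvertible := by
  refine isInvertible_of_pos (E := E) (G q) (hG.pos q hq)

theorem sharp_apply (hG : IsMetricOn G U) (hq : q ∈ U) (α : TangentSpace 𝓘(ℝ, E) q →L[ℝ] ℝ) :
    G q (sharp G q α) = α :=
  (isInvertible hG hq).self_apply_inverse α

theorem dchart_sharp (hG : IsMetricOn G U) (h : IsModelAt m G D U p)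
    (hq : q ∈ (extChartAt 𝓘(ℝ, E) p).source) (hqO : extChartAt 𝓘(ℝ, E) p q ∈ m.O)
    (α : TangentSpace 𝓘(ℝ, E) q →L[ℝ] ℝ) :
    dchart 𝓘(ℝ, E) p q (sharp G q α) = m.sharp (extChartAt 𝓘(ℝ, E) p q) (covec p α) := by
  refine CoordModel.eq_of_G_eq hqO fun w => ?_
  rw [CoordModel.G_sharp hqO, covec_apply, ← dchart_inverse_apply (J := 𝓘(ℝ, E)) hq w,
    h.G_dchart hq, sharp_apply hG (h.mem_U hq hqO), inverse_dchart_apply hq]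

theorem cometric_eq (hG : IsMetricOn G U) (h : IsModelAt m G D U p)
    (hq : q ∈ (extChartAt 𝓘(ℝ, E) p).source) (hqO : extChartAt 𝓘(ℝ, E) p q ∈ m.O)
    (α : TangentSpace 𝓘(ℝ, E) q →L[ℝ] ℝ) :
    cometric G q α α = covec p α (m.sharp (extChartAt 𝓘(ℝ, E) p q) (covec p α)) := by
  rw [cometric, sharp_apply hG (h.mem_U hq hqO), ← h.dchart_sharp hG hq hqO, covec_dchart hq]

theorem mem_D_iff (h : IsModelAt m G D U p)
    (hq : q ∈ (extChartAt 𝓘(ℝ, E) p).source) (hqO : extChartAt 𝓘(ℝ, E) p q ∈ m.O)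
    (v : TangentSpace 𝓘(ℝ, E) q) :
    v ∈ D q ↔ m.P (extChartAt 𝓘(ℝ, E) p q) (dchart 𝓘(ℝ, E) p q v) = dchart 𝓘(ℝ, E) p q v := by
  rw [h.mem_iff q hq hqO]
  constructor
  · rintro ⟨y, hy⟩
    rw [← hy, CoordModel.P_L hqO]
  · exact CoordModel.exists_L_eq

theorem annihilates_orth_iff (hG : IsMetricOn G U) (h : IsModelAt m G D U p)
    (hq : q ∈ (extChartAt 𝓘(ℝ, E) p).source) (hqO : extChartAt 𝓘(ℝ, E) p q ∈ m.O)
    (α : TangentSpace 𝓘(ℝ, E) q →L[ℝ] ℝ) :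
    (∀ v ∈ orth G D q, α v = 0) ↔
      (covec p α).comp (m.P (extChartAt 𝓘(ℝ, E) p q)) = covec p α := by
  have hU := h.mem_U hq hqO
  constructor
  · intro hα
    ext u
    obtain ⟨v, rfl⟩ : ∃ v, dchart 𝓘(ℝ, E) p q v = u := ⟨_, dchart_inverse_apply hq u⟩
    have h1 := hα _ (proj_mem_and_sub_mem hG D hU v).2
    rw [map_sub, sub_eq_zero] at h1
    rw [ContinuousLinearMap.comp_apply, h.P_dchart hG hq hqO, covec_dchart hq, covec_dchart hq, h1]
  · intro hα v hv
    have h1 : proj G D q v = 0 := eq_proj hG D hU (D q).zero_mem (by rwa [sub_zero])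
    rw [← covec_dchart hq, ← hα, ContinuousLinearMap.comp_apply, h.P_dchart hG hq hqO, h1, map_zero,
      map_zero]

end IsModelAt

end Charts

/-! ### The canonical forms of the cotangent bundle in charts -/

section Cot
variable {E : Type*} [NormedAddCommGroup E] [NormedSpace ℝ E] [FiniteDimensional ℝ E]
  {Q : Type*} [TopologicalSpace Q] [ChartedSpace E Q] [IsManifold 𝓘(ℝ, E) ∞ Q]

/-- The charts of the cotangent bundle are `(q, α) ↦ (φ q, α ∘ (dφ_q)⁻¹)`; their domains are the
preimages of the chart domains of the base. -/
theorem mem_cotChart_source {α₀ α : Cotangent E Q} :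
    α ∈ (extChartAt (cotModel E) α₀).source ↔ α.proj ∈ (extChartAt 𝓘(ℝ, E) α₀.proj).source := by
  rw [extChartAt_source, extChartAt_source, FiberBundle.chartedSpace_chartAt]
  simp
  exact fun h => h

theorem cotChart_apply {α₀ α : Cotangent E Q}
    (h : α.proj ∈ (extChartAt 𝓘(ℝ, E) α₀.proj).source) :
    extChartAt (cotModel E) α₀ α =
      (extChartAt 𝓘(ℝ, E) α₀.proj α.proj, covec α₀.proj α.snd) := by
  have hI : IsManifold 𝓘(ℝ, E) 1 Q := IsManifold.of_le (n := ∞) (by simp)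
  have h0 := h
  rw [extChartAt_source] at h0
  have h1 : extChartAt (cotModel E) α₀ α = (chartAt (ModelProd E (E →L[ℝ] ℝ)) α₀ α) := rfl
  rw [h1, hom_chart]
  refine Prod.ext rfl ?_
  ext u
  have h2 : (trivializationAt E (TangentSpace 𝓘(ℝ, E)) α₀.proj).symmL ℝ α.proj =
      (dchart 𝓘(ℝ, E) α₀.proj α.proj).inverse := by
    rw [TangentBundle.symmL_trivializationAt h0]
    simp only [modelWithCornersSelf_coe, range_id, mfderivWithin_univ]
    have := mfderiv_extChartAt_symm_eq (J := 𝓘(ℝ, E)) α₀.proj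
      ((extChartAt 𝓘(ℝ, E) α₀.proj).map_source h)
    rw [(extChartAt 𝓘(ℝ, E) α₀.proj).left_inv h] at this
    exact this
  rw [covec_apply, ← h2]
  simp [ContinuousLinearMap.inCoordinates]

theorem cotChart_target {α₀ : Cotangent E Q} :
    (extChartAt (cotModel E) α₀).target = (extChartAt 𝓘(ℝ, E) α₀.proj).target ×ˢ univ := by
  rw [extChartAt, extChartAt, FiberBundle.chartedSpace_chartAt]
  simp only [mfld_simps]
  refine inter_eq_left.2 fun z hz => ⟨?_, trivial⟩
  exact ⟨(chartAt E α₀.proj).map_target hz.1, trivial⟩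

theorem cotChart_symm_proj {α₀ : Cotangent E Q} {z : E × (E →L[ℝ] ℝ)}
    (hz : z.1 ∈ (extChartAt 𝓘(ℝ, E) α₀.proj).target) :
    ((extChartAt (cotModel E) α₀).symm z).proj = (extChartAt 𝓘(ℝ, E) α₀.proj).symm z.1 := by
  have hz' : z ∈ (extChartAt (cotModel E) α₀).target := by
    rw [cotChart_target]; exact ⟨hz, trivial⟩
  have h1 := (extChartAt (cotModel E) α₀).map_target hz'
  have h2 := (extChartAt (cotModel E) α₀).right_inv hz'
  rw [mem_cotChart_source] at h1
  rw [cotChart_apply h1] at h2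
  rw [← (extChartAt 𝓘(ℝ, E) α₀.proj).left_inv h1]
  exact congrArg (extChartAt 𝓘(ℝ, E) α₀.proj).symm (congrArg Prod.fst h2)

theorem dPi_cotChart {α₀ α : Cotangent E Q}
    (h : α.proj ∈ (extChartAt 𝓘(ℝ, E) α₀.proj).source) (X : TangentSpace (cotModel E) α) :
    dchart 𝓘(ℝ, E) α₀.proj α.proj (dPi α X) = (dchart (cotModel E) α₀ α X).1 := by
  have hI : IsManifold 𝓘(ℝ, E) 1 Q := IsManifold.of_le (n := ∞) (by simp)
  have hI' : IsManifold (cotModel E) 1 (Cotangent E Q) := IsManifold.of_le (n := ∞) (by simp)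
  have hα := mem_cotChart_source.2 h
  have h1 : MDifferentiableAt (cotModel E) 𝓘(ℝ, E) (fun β : Cotangent E Q => β.proj) α :=
    (contMDiff_proj (IB := 𝓘(ℝ, E)) (n := ∞)
      (fun q : Q => TangentSpace 𝓘(ℝ, E) q →L[ℝ] ℝ) α).mdifferentiableAt (by simp)
  have h2 : MDifferentiableAt 𝓘(ℝ, E) 𝓘(ℝ, E) (extChartAt 𝓘(ℝ, E) α₀.proj) α.proj :=
    mdifferentiableAt_extChartAt (by simpa using h)
  have h3 : MDifferentiableAt (cotModel E) 𝓘(ℝ, E × (E →L[ℝ] ℝ)) (extChartAt (cotModel E) α₀) α :=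
    mdifferentiableAt_extChartAt (by simpa using hα)
  have h4 : (extChartAt 𝓘(ℝ, E) α₀.proj) ∘ (fun β : Cotangent E Q => β.proj) =ᶠ[𝓝 α]
      Prod.fst ∘ extChartAt (cotModel E) α₀ := by
    filter_upwards [extChartAt_source_mem_nhds' hα] with β hβ
    rw [Function.comp_apply, Function.comp_apply, cotChart_apply (mem_cotChart_source.1 hβ)]
  have h5 := mfderiv_comp α h2 h1
  rw [h4.mfderiv_eq] at h5
  have h6 := mfderiv_comp α (I' := 𝓘(ℝ, E × (E →L[ℝ] ℝ))) (I'' := 𝓘(ℝ, E))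
    (g := (Prod.fst : E × (E →L[ℝ] ℝ) → E))
    (differentiableAt_fst.mdifferentiableAt) h3
  rw [h5, mfderiv_eq_fderiv, fderiv_fst] at h6
  exact DFunLike.congr_fun h6 X

theorem liouville_cotChart {α₀ α : Cotangent E Q}
    (h : α.proj ∈ (extChartAt 𝓘(ℝ, E) α₀.proj).source) (X : TangentSpace (cotModel E) α) :
    liouville α X = (extChartAt (cotModel E) α₀ α).2 (dchart (cotModel E) α₀ α X).1 := by
  rw [← dPi_cotChart h, cotChart_apply h, covec_dchart h]
  rfl

set_option synthInstance.maxHeartbeats 200000 in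
/-- The canonical `1`-form in coordinates, `(x, p) ↦ ((u, a) ↦ p u)`, is a linear map. -/
theorem exists_canonical_form : ∃ η₀ : E × (E →L[ℝ] ℝ) → E × (E →L[ℝ] ℝ) →L[ℝ] ℝ,
    (∀ z X, η₀ z X = z.2 X.1) ∧ ∀ z, DifferentiableAt ℝ η₀ z ∧
      ∀ X Y, fderiv ℝ η₀ z X Y = X.2 Y.1 := by
  let η : E × (E →L[ℝ] ℝ) →L[ℝ] E × (E →L[ℝ] ℝ) →L[ℝ] ℝ :=
    (ContinuousLinearMap.precomp ℝ (ContinuousLinearMap.fst ℝ E (E →L[ℝ] ℝ))).comp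
      (ContinuousLinearMap.snd ℝ E (E →L[ℝ] ℝ))
  have hη : ∀ z, HasFDerivAt (fun z => η z) η z := fun z => by
    exact ContinuousLinearMap.hasFDerivAt (𝕜 := ℝ) (E := E × (E →L[ℝ] ℝ))
      (F := E × (E →L[ℝ] ℝ) →L[ℝ] ℝ) η
  refine ⟨fun z => η z, fun z X => rfl, fun z => ⟨(hη z).differentiableAt, fun X Y => ?_⟩⟩
  rw [(hη z).fderiv]
  rfl

/-- In a chart of the cotangent bundle `ω_Q` is the canonical form. -/
theorem omegaQ_cotChart {α₀ α : Cotangent E Q}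
    (h : α.proj ∈ (extChartAt 𝓘(ℝ, E) α₀.proj).source) (X Y : TangentSpace (cotModel E) α) :
    omegaQ α X Y = wform (dchart (cotModel E) α₀ α X) (dchart (cotModel E) α₀ α Y) := by
  obtain ⟨η₀, hη, hd⟩ := exists_canonical_form (E := E)
  have h1 := extDerivOneForm_eq_chart (J := cotModel E) liouville α₀ (mem_cotChart_source.2 h)
    (η₀ := η₀) (fun β hβ v => (hη _ _).trans (liouville_cotChart (mem_cotChart_source.1 hβ) v).symm)
    (hd _).1 X Y
  rw [omegaQ, h1, (hd _).2, (hd _).2, wform]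
  ring

theorem differential_chart {α₀ α : Cotangent E Q}
    (h : α.proj ∈ (extChartAt 𝓘(ℝ, E) α₀.proj).source) {H : Cotangent E Q → ℝ}
    {H₀ : E × (E →L[ℝ] ℝ) → ℝ} (hH : H =ᶠ[𝓝 α] H₀ ∘ extChartAt (cotModel E) α₀)
    (hd : DifferentiableAt ℝ H₀ (extChartAt (cotModel E) α₀ α)) (X : TangentSpace (cotModel E) α) :
    MDifferentiableAt (cotModel E) 𝓘(ℝ, ℝ) H α ∧ differential H α X =
      fderiv ℝ H₀ (extChartAt (cotModel E) α₀ α) (dchart (cotModel E) α₀ α X) := by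
  have hI' : IsManifold (cotModel E) 1 (Cotangent E Q) := IsManifold.of_le (n := ∞) (by simp)
  have hα := mem_cotChart_source.2 h
  have h3 : MDifferentiableAt (cotModel E) 𝓘(ℝ, E × (E →L[ℝ] ℝ)) (extChartAt (cotModel E) α₀) α :=
    mdifferentiableAt_extChartAt (by simpa using hα)
  refine ⟨(hd.mdifferentiableAt.comp α h3).congr_of_eventuallyEq hH, ?_⟩
  have h6 := mfderiv_comp α (I' := 𝓘(ℝ, E × (E →L[ℝ] ℝ))) (I'' := 𝓘(ℝ, ℝ)) (g := H₀)
    hd.mdifferentiableAt h3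
  rw [← hH.mfderiv_eq, mfderiv_eq_fderiv] at h6
  exact DFunLike.congr_fun h6 X

end Cot

/-! ### The nonholonomic Hamiltonian field -/

namespace CoordModel
variable {E : Type*} [NormedAddCommGroup E] [NormedSpace ℝ E] [FiniteDimensional ℝ E] {r : ℕ}
  {m : CoordModel E r}

/-- Velocities of curves in `N` satisfy the linearized equation of `N`. -/
theorem mem_TN_of_curve {γ : ℝ → E × (E →L[ℝ] ℝ)} {X : E × (E →L[ℝ] ℝ)} (hγ : HasDerivAt γ X 0)
    (hN : ∀ᶠ t in 𝓝 (0 : ℝ), γ t ∈ m.N) : X ∈ m.TN (γ 0) := by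
  have h1 : HasDerivAt (fun t => (γ t).1) X.1 0 := hγ.fst
  have h2 : HasDerivAt (fun t => (γ t).2) X.2 0 := hγ.snd
  have h3 : HasDerivAt (fun t => m.P (γ t).1) (fderiv ℝ m.P (γ 0).1 X.1) 0 := by
    simpa [Function.comp_def] using
      HasFDerivAt.comp_hasDerivAt (0 : ℝ) (hasFDerivAt_P hN.self_of_nhds.1) h1
  have h4 := h2.clm_comp h3
  have h5 : (fun t => (γ t).2.comp (m.P (γ t).1)) =ᶠ[𝓝 0] fun t => (γ t).2 :=
    hN.mono fun t ht => ht.2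
  exact mem_TN.2 (h2.unique (h4.congr_of_eventuallyEq h5.symm))

/-- A solution of the linearized equation is the velocity of the straight line, projected to `N` by
`p ↦ p ∘ P x`. -/
theorem exists_curve_of_mem_TN {z X : E × (E →L[ℝ] ℝ)} (hz : z ∈ m.N) (hX : X ∈ m.TN z) :
    ∃ γ : ℝ → E × (E →L[ℝ] ℝ), γ 0 = z ∧ ContDiffAt ℝ ∞ γ 0 ∧ HasDerivAt γ X 0 ∧
      ∀ᶠ t in 𝓝 (0 : ℝ), γ t ∈ m.N := by
  have hx : ContDiff ℝ ∞ (fun t : ℝ => z.1 + t • X.1) := by fun_prop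
  have hp : ContDiff ℝ ∞ (fun t : ℝ => z.2 + t • X.2) := by fun_prop
  have h0 : z.1 + (0 : ℝ) • X.1 ∈ m.O := by simpa using hz.1
  have hP : ContDiffAt ℝ ∞ m.P (z.1 + (0 : ℝ) • X.1) :=
    smooth_P.contDiffAt (m.isOpen.mem_nhds h0)
  have hPx : ContDiffAt ℝ ∞ (fun t : ℝ => m.P (z.1 + t • X.1)) 0 :=
    ContDiffAt.comp (f := fun t : ℝ => z.1 + t • X.1) (g := m.P) (0 : ℝ) hP hx.contDiffAt
  have hq : ContDiffAt ℝ ∞ (fun t : ℝ => (z.2 + t • X.2).comp (m.P (z.1 + t • X.1))) 0 :=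
    hp.contDiffAt.clm_comp hPx
  refine ⟨fun t => (z.1 + t • X.1, (z.2 + t • X.2).comp (m.P (z.1 + t • X.1))), ?_,
    hx.contDiffAt.prodMk hq, ?_, ?_⟩
  · simp only [zero_smul, add_zero, hz.2]
  · have h1 : HasDerivAt (fun t : ℝ => z.1 + t • X.1) X.1 0 := by
      simpa using ((hasDerivAt_id (0 : ℝ)).smul_const X.1).const_add z.1
    have h2 : HasDerivAt (fun t : ℝ => z.2 + t • X.2) X.2 0 := by
      simpa using ((hasDerivAt_id (0 : ℝ)).smul_const X.2).const_add z.2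
    have h5 : HasDerivAt (fun t : ℝ => m.P (z.1 + t • X.1)) (fderiv ℝ m.P (z.1 + (0 : ℝ) • X.1) X.1)
        0 := HasFDerivAt.comp_hasDerivAt (f := fun t : ℝ => z.1 + t • X.1) (0 : ℝ) (hasFDerivAt_P h0) h1
    have h4 := h1.prodMk (h2.clm_comp h5)
    simp only [zero_smul, add_zero] at h4
    rw [← mem_TN.1 hX] at h4
    exact h4
  · filter_upwards [hx.continuous.continuousAt.preimage_mem_nhds (m.isOpen.mem_nhds h0)] with t ht
    refine ⟨ht, ?_⟩
    ext v
    simp only [ContinuousLinearMap.comp_apply, P_P ht]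

end CoordModel

section Ham
variable {E : Type*} [NormedAddCommGroup E] [NormedSpace ℝ E] [FiniteDimensional ℝ E]
  {Q : Type*} [TopologicalSpace Q] [ChartedSpace E Q] [IsManifold 𝓘(ℝ, E) ∞ Q]
  {r : ℕ} {m : CoordModel E r} {G : MetricField E Q} {D : DistField E Q} {U : Set Q}
  {V : Q → ℝ}

variable (m) in
/-- The covectors over the domain of the coordinate model `m` at `α₀`. -/
def modelDomain (α₀ : Cotangent E Q) : Set (Cotangent E Q) :=
  {α | α.proj ∈ (extChartAt 𝓘(ℝ, E) α₀.proj).source ∧ extChartAt 𝓘(ℝ, E) α₀.proj α.proj ∈ m.O}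

/-- A function on `Q` in the chart at `p`. -/
def inChart (V : Q → ℝ) (p : Q) (x : E) : ℝ := V ((extChartAt 𝓘(ℝ, E) p).symm x)

variable {α₀ α : Cotangent E Q}

theorem modelDomain_eq : modelDomain m α₀ =
    (extChartAt (cotModel E) α₀).source ∩ extChartAt (cotModel E) α₀ ⁻¹' (m.O ×ˢ univ) := by
  ext α
  rw [mem_inter_iff, mem_preimage, mem_cotChart_source]
  refine and_congr_right fun h => ?_
  rw [cotChart_apply h, mem_prod]
  simp

theorem isOpen_modelDomain : IsOpen (modelDomain m α₀) := by
  rw [modelDomain_eq]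
  exact (continuousOn_extChartAt α₀).isOpen_inter_preimage (isOpen_extChartAt_source α₀)
    (m.isOpen.prod isOpen_univ)

theorem cotChart_symm_mem (h : IsModelAt m G D U α₀.proj) {z : E × (E →L[ℝ] ℝ)} (hz : z.1 ∈ m.O) :
    (extChartAt (cotModel E) α₀).symm z ∈ modelDomain m α₀ ∧
      extChartAt (cotModel E) α₀ ((extChartAt (cotModel E) α₀).symm z) = z := by
  have h1 : z ∈ (extChartAt (cotModel E) α₀).target := by
    rw [cotChart_target]
    exact ⟨h.O_subset hz, trivial⟩
  have h2 := (extChartAt (cotModel E) α₀).right_inv h1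
  refine ⟨?_, h2⟩
  rw [modelDomain_eq]
  refine ⟨(extChartAt (cotModel E) α₀).map_target h1, ?_⟩
  rw [mem_preimage, h2]
  exact ⟨hz, trivial⟩

theorem mem_dualDist_iff (hG : IsMetricOn G U) (h : IsModelAt m G D U α₀.proj)
    (hα : α ∈ modelDomain m α₀) :
    α ∈ dualDist G D U ↔ extChartAt (cotModel E) α₀ α ∈ m.N := by
  rw [cotChart_apply hα.1]
  constructor
  · exact fun h1 => ⟨hα.2, (h.annihilates_orth_iff hG hα.1 hα.2 _).1 h1.2⟩
  · exact fun h1 => ⟨h.mem_U hα.1 hα.2, (h.annihilates_orth_iff hG hα.1 hα.2 _).2 h1.2⟩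

theorem hamiltonian_eq_ham (hG : IsMetricOn G U) (h : IsModelAt m G D U α₀.proj)
    (hα : α ∈ modelDomain m α₀) :
    hamiltonian G V α = m.ham (inChart V α₀.proj) (extChartAt (cotModel E) α₀ α) := by
  rw [cotChart_apply hα.1, hamiltonian, CoordModel.ham, h.cometric_eq hG hα.1 hα.2, inChart,
    (extChartAt 𝓘(ℝ, E) α₀.proj).left_inv hα.1]

theorem contDiffOn_inChart (hV : ContMDiff 𝓘(ℝ, E) 𝓘(ℝ, ℝ) ∞ V) {p : Q}
    (h : IsModelAt m G D U p) : ContDiffOn ℝ ∞ (inChart V p) m.O :=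
  (contDiffOn_comp_extChartAt_symm hV p).mono h.O_subset

theorem cotChart_fst_mem (hα : α ∈ modelDomain m α₀) :
    (extChartAt (cotModel E) α₀ α).1 ∈ m.O := by
  rw [cotChart_apply hα.1]
  exact hα.2

theorem differential_hamiltonian (hV : ContMDiff 𝓘(ℝ, E) 𝓘(ℝ, ℝ) ∞ V) (hG : IsMetricOn G U)
    (h : IsModelAt m G D U α₀.proj) (hα : α ∈ modelDomain m α₀) (X : TangentSpace (cotModel E) α) :
    MDifferentiableAt (cotModel E) 𝓘(ℝ, ℝ) (hamiltonian G V) α ∧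
    differential (hamiltonian G V) α X =
      fderiv ℝ (m.ham (inChart V α₀.proj)) (extChartAt (cotModel E) α₀ α)
        (dchart (cotModel E) α₀ α X) := by
  refine differential_chart hα.1 ?_
    (CoordModel.hasFDerivAt_ham (contDiffOn_inChart hV h) (cotChart_fst_mem hα)).differentiableAt X
  filter_upwards [isOpen_modelDomain.mem_nhds hα] with β hβ
  exact hamiltonian_eq_ham hG h hβ

/-- The submodule `TN` is the tangent space of the dual of the distribution. -/
theorem mem_tangentSet_dualDist_iff (hG : IsMetricOn G U) (h : IsModelAt m G D U α₀.proj)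
    (hα : α ∈ modelDomain m α₀) (hαN : α ∈ dualDist G D U) (X : TangentSpace (cotModel E) α) :
    X ∈ tangentSet (cotModel E) (dualDist G D U) α ↔
      dchart (cotModel E) α₀ α X ∈ m.TN (extChartAt (cotModel E) α₀ α) := by
  have hs : α ∈ (chartAt (ModelProd E (E →L[ℝ] ℝ)) α₀).source := by
    rw [← extChartAt_source (I := cotModel E)]
    exact mem_cotChart_source.2 hα.1
  have h1 := mem_tangentSet_iff_extend (J := cotModel E)
    (IsManifold.chart_mem_maximalAtlas (I := cotModel E) (n := ∞) α₀) hs (dualDist G D U) X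
  rw [h1]
  change (∃ γ : ℝ → E × (E →L[ℝ] ℝ), γ 0 = extChartAt (cotModel E) α₀ α ∧ ContDiffAt ℝ ∞ γ 0 ∧
      HasDerivAt γ (dchart (cotModel E) α₀ α X) 0 ∧
      ∀ᶠ t in 𝓝 (0 : ℝ), (extChartAt (cotModel E) α₀).symm (γ t) ∈ dualDist G D U) ↔ _
  constructor
  · rintro ⟨γ, h0, hc, hd, hN⟩
    rw [← h0]
    refine CoordModel.mem_TN_of_curve hd ?_
    have hO : ∀ᶠ t in 𝓝 (0 : ℝ), (γ t).1 ∈ m.O := by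
      refine (continuousAt_fst.comp hd.continuousAt).preimage_mem_nhds (m.isOpen.mem_nhds ?_)
      rw [Function.comp_apply, h0]
      exact cotChart_fst_mem hα
    filter_upwards [hN, hO] with t ht hto
    obtain ⟨h2, h3⟩ := cotChart_symm_mem h hto
    rw [mem_dualDist_iff hG h h2, h3] at ht
    exact ht
  · intro hX
    obtain ⟨γ, h0, hc, hd, hN⟩ :=
      CoordModel.exists_curve_of_mem_TN ((mem_dualDist_iff hG h hα).1 hαN) hX
    refine ⟨γ, h0, hc, hd, hN.mono fun t ht => ?_⟩
    obtain ⟨h2, h3⟩ := cotChart_symm_mem h ht.1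
    rw [mem_dualDist_iff hG h h2, h3]
    exact ht

theorem mem_nhTangent_iff (hG : IsMetricOn G U) (h : IsModelAt m G D U α₀.proj)
    (hα : α ∈ modelDomain m α₀) (hαN : α ∈ dualDist G D U) (X : TangentSpace (cotModel E) α) :
    X ∈ nhTangent D (dualDist G D U) α ↔
      dchart (cotModel E) α₀ α X ∈ m.NT (extChartAt (cotModel E) α₀ α) := by
  rw [CoordModel.mem_NT, ← mem_tangentSet_dualDist_iff hG h hα hαN, ← dPi_cotChart hα.1]
  have h1 := h.mem_D_iff hα.1 hα.2 (dPi α X)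
  rw [cotChart_apply hα.1, ← h1]
  rfl

theorem mem_modelDomain_self (h0 : extChartAt 𝓘(ℝ, E) α.proj α.proj ∈ m.O) :
    α ∈ modelDomain m α := ⟨mem_extChartAt_source _, h0⟩

theorem inverse_dchart_mem_nhTangent (hG : IsMetricOn G U) (h : IsModelAt m G D U α₀.proj)
    (hα : α ∈ modelDomain m α₀) (hαN : α ∈ dualDist G D U) {Z : E × (E →L[ℝ] ℝ)}
    (hZ : Z ∈ m.NT (extChartAt (cotModel E) α₀ α)) :
    (dchart (cotModel E) α₀ α).inverse Z ∈ nhTangent D (dualDist G D U) α := by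
  rw [mem_nhTangent_iff hG h hα hαN, dchart_inverse_apply (mem_cotChart_source.2 hα.1)]
  exact hZ

theorem nhField_spec (hV : ContMDiff 𝓘(ℝ, E) 𝓘(ℝ, ℝ) ∞ V) (hG : IsMetricOn G U)
    (h : IsModelAt m G D U α₀.proj) (hα : α ∈ modelDomain m α₀) (hαN : α ∈ dualDist G D U) :
    (dchart (cotModel E) α₀ α).inverse
        (m.nhField (inChart V α₀.proj) (extChartAt (cotModel E) α₀ α)) ∈
          nhTangent D (dualDist G D U) α ∧
      ∀ Y ∈ nhTangent D (dualDist G D U) α, omegaQ α ((dchart (cotModel E) α₀ α).inverse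
        (m.nhField (inChart V α₀.proj) (extChartAt (cotModel E) α₀ α))) Y =
          differential (hamiltonian G V) α Y := by
  have hN := (mem_dualDist_iff hG h hα).1 hαN
  refine ⟨inverse_dchart_mem_nhTangent hG h hα hαN (CoordModel.nhField_mem _ hN), fun Y hY => ?_⟩
  rw [omegaQ_cotChart hα.1, dchart_inverse_apply (mem_cotChart_source.2 hα.1),
    (differential_hamiltonian hV hG h hα Y).2]
  exact CoordModel.wform_nhField (contDiffOn_inChart hV h) hN
    ((mem_nhTangent_iff hG h hα hαN Y).1 hY)

/-- The form `ω_Q` is nondegenerate on `𝒯N`. -/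
theorem eq_of_omegaQ_eq (hG : IsMetricOn G U) (hD : IsDistribution D r)
    (hαN : α ∈ dualDist G D U) {X X' : TangentSpace (cotModel E) α}
    (hX : X ∈ nhTangent D (dualDist G D U) α) (hX' : X' ∈ nhTangent D (dualDist G D U) α)
    (hXX : ∀ Y ∈ nhTangent D (dualDist G D U) α, omegaQ α X Y = omegaQ α X' Y) : X = X' := by
  obtain ⟨m, h0, h⟩ := exists_model hG hD hαN.1
  have hα : α ∈ modelDomain m α := mem_modelDomain_self h0
  have hN := (mem_dualDist_iff hG h hα).1 hαN
  have hs := mem_cotChart_source.2 hα.1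
  have h1 := (mem_nhTangent_iff hG h hα hαN X).1 hX
  have h2 := (mem_nhTangent_iff hG h hα hαN X').1 hX'
  have h3 := CoordModel.wform_nondegenerate hN (Submodule.sub_mem _ h1 h2) fun Y hY => by
    have h4 := hXX _ (inverse_dchart_mem_nhTangent hG h hα hαN hY)
    rw [omegaQ_cotChart hα.1, omegaQ_cotChart hα.1, dchart_inverse_apply hs, wform, wform] at h4
    simp only [wform, Prod.fst_sub, Prod.snd_sub, map_sub, sub_apply]
    linarith
  rw [← inverse_dchart_apply hs X, sub_eq_zero.1 h3, inverse_dchart_apply hs]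

/-- The field exists pointwise by the coordinate formula `nhField`; by uniqueness it agrees with the
coordinate formula of any fixed chart, hence is smooth. -/
theorem exists_nhHamiltonianField (hV : ContMDiff 𝓘(ℝ, E) 𝓘(ℝ, ℝ) ∞ V) (hG : IsMetricOn G U)
    (hD : IsDistribution D r) : ∃ X : ∀ α : Cotangent E Q, TangentSpace (cotModel E) α,
      IsNHHamiltonianField D (dualDist G D U) (hamiltonian G V) X := by
  have hex : ∀ α : Cotangent E Q, ∃ X : TangentSpace (cotModel E) α, α ∈ dualDist G D U →
      X ∈ nhTangent D (dualDist G D U) α ∧ ∀ Y ∈ nhTangent D (dualDist G D U) α,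
        omegaQ α X Y = differential (hamiltonian G V) α Y := fun α => by
    by_cases hαN : α ∈ dualDist G D U
    · obtain ⟨m, h0, h⟩ := exists_model hG hD hαN.1
      exact ⟨_, fun _ => nhField_spec hV hG h (mem_modelDomain_self h0) hαN⟩
    · exact ⟨0, fun h => absurd h hαN⟩
  choose X hX using hex
  refine ⟨X, ⟨fun α₀ hα₀ => ?_, fun α hα => (hX α hα).1⟩, fun α hα => (hX α hα).2⟩
  obtain ⟨m, h0, h⟩ := exists_model hG hD hα₀.1
  refine ⟨modelDomain m α₀, isOpen_modelDomain, mem_modelDomain_self h0, fun β =>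
    (dchart (cotModel E) α₀ β).inverse
      (m.nhField (inChart V α₀.proj) (extChartAt (cotModel E) α₀ β)), ?_, fun β hβ => ?_⟩
  · rw [modelDomain_eq]
    exact contMDiffOn_inverse_dchart_field α₀ (m.isOpen.prod isOpen_univ)
      (CoordModel.smooth_nhField (contDiffOn_inChart hV h))
  · obtain ⟨h1, h2⟩ := nhField_spec hV hG h hβ.1 hβ.2
    exact eq_of_omegaQ_eq hG hD hβ.2 h1 (hX β hβ.2).1 fun Y hY =>
      (h2 Y hY).trans ((hX β hβ.2).2 Y hY).symm

theorem IsNHHamiltonianField.unique (hG : IsMetricOn G U) (hD : IsDistribution D r)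
    {H : Cotangent E Q → ℝ} {X X' : ∀ α : Cotangent E Q, TangentSpace (cotModel E) α}
    (hX : IsNHHamiltonianField D (dualDist G D U) H X)
    (hX' : IsNHHamiltonianField D (dualDist G D U) H X') :
    ∀ α ∈ dualDist G D U, X' α = X α := fun α hα =>
  eq_of_omegaQ_eq hG hD hα (hX'.1.2 α hα) (hX.1.2 α hα) fun Y hY =>
    (hX'.2 α hα Y hY).trans (hX.2 α hα Y hY).symm

end Ham

/-! ### Straightening of a level set -/

/-- The inverse function theorem, with a smooth inverse on the whole target. -/
theorem exists_smooth_openPartialHomeomorph {X : Type*} [NormedAddCommGroup X] [NormedSpace ℝ X]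
    [FiniteDimensional ℝ X] {f : X → X} {O : Set X} (hO : IsOpen O) (hf : ContDiffOn ℝ ∞ f O)
    {z : X} (hz : z ∈ O) (hi : Function.Injective (fderiv ℝ f z)) :
    ∃ φ : OpenPartialHomeomorph X X, z ∈ φ.source ∧ φ.source ⊆ O ∧ (∀ y, φ y = f y) ∧
      ContDiffOn ℝ ∞ φ φ.source ∧ ContDiffOn ℝ ∞ φ.symm φ.target := by
  have hca : ∀ y ∈ O, ContDiffAt ℝ ∞ f y := fun y hy => hf.contDiffAt (hO.mem_nhds hy)
  obtain ⟨f', hf'⟩ := isInvertible_of_injective _ hi rfl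
  have hd : HasFDerivAt f (f' : X →L[ℝ] X) z := by
    rw [hf']
    exact ((hca z hz).differentiableAt (by simp)).hasFDerivAt
  have hcf : ContinuousOn (fderiv ℝ f) O := hf.continuousOn_fderiv_of_isOpen hO (by simp)
  set O' : Set X := O ∩ fderiv ℝ f ⁻¹' (range fun e : X ≃L[ℝ] X => (e : X →L[ℝ] X)) with hO'
  have hO'o : IsOpen O' := hcf.isOpen_inter_preimage hO ContinuousLinearEquiv.isOpen
  have hzO' : z ∈ O' := ⟨hz, f', hf'⟩
  set φ := ((hca z hz).toOpenPartialHomeomorph f hd (by simp)).restrOpen O' hO'o with hφ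
  have hc : ∀ y, φ y = f y := fun y => rfl
  have hs : φ.source ⊆ O' := by
    rw [hφ, OpenPartialHomeomorph.restrOpen_source]
    exact inter_subset_right
  refine ⟨φ, ?_, hs.trans inter_subset_left, hc, ?_, ?_⟩
  · rw [hφ, OpenPartialHomeomorph.restrOpen_source]
    exact ⟨(hca z hz).mem_toOpenPartialHomeomorph_source hd (by simp), hzO'⟩
  · exact hf.mono (hs.trans inter_subset_left)
  · intro y hy
    obtain ⟨h1, e, he⟩ := hs (φ.map_target hy)
    refine (φ.contDiffAt_symm hy (f₀' := e) ?_ (hca _ h1)).contDiffWithinAt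
    rw [show (e : X →L[ℝ] X) = _ from he]
    exact ((hca _ h1).differentiableAt (by simp)).hasFDerivAt

namespace CoordModel
variable {E : Type*} [NormedAddCommGroup E] [NormedSpace ℝ E] [FiniteDimensional ℝ E] {r : ℕ}
  {m : CoordModel E r}

variable (m) in
/-- A field of endomorphisms that carries the splitting of `E` into the distribution and its
orthogonal complement at `x₀` to the splitting at `x`. -/
def splitting (x₀ x : E) : E →L[ℝ] E :=
  (m.P x).comp (m.P x₀) + (ContinuousLinearMap.id ℝ E - m.P x).comp
    (ContinuousLinearMap.id ℝ E - m.P x₀)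

theorem splitting_self {x₀ : E} (hx : x₀ ∈ m.O) :
    m.splitting x₀ x₀ = ContinuousLinearMap.id ℝ E := by
  ext v
  simp [splitting, P_P hx]

theorem smooth_splitting (x₀ : E) : ContDiffOn ℝ ∞ (m.splitting x₀) m.O :=
  (smooth_P.clm_comp contDiffOn_const).add
    ((contDiffOn_const.sub smooth_P).clm_comp contDiffOn_const)

/-- Composition with `splitting` carries the fibre of `N` over `x` to the fibre over `x₀`. -/
theorem comp_P_eq_iff {x₀ x : E} (hx₀ : x₀ ∈ m.O) (hx : x ∈ m.O)
    (hA : (m.splitting x₀ x).IsInvertible) (p : E →L[ℝ] ℝ) :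
    p.comp (m.P x) = p ↔ (p.comp (m.splitting x₀ x)).comp (m.P x₀) = p.comp (m.splitting x₀ x) := by
  constructor
  · intro h
    ext v
    have h1 : ∀ w, p (m.P x w) = p w := fun w => DFunLike.congr_fun h w
    simp [splitting, P_P hx₀, h1]
  · intro h
    ext v
    obtain ⟨w, rfl⟩ : ∃ w, m.splitting x₀ x w = v := ⟨_, hA.self_apply_inverse v⟩
    have h1 := DFunLike.congr_fun h w
    have h2 := DFunLike.congr_fun h (w - m.P x₀ w)
    simp [splitting, P_P hx₀, P_P hx] at h1 h2 ⊢
    linarith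

/-- A chart of `E × E^*` in which `N` is a linear subspace `K` and a level set of the Hamiltonian in `N`
is a hyperplane of `K`. The fibres of `N` are first made constant by `splitting`; a shear along the
radial vector then makes the Hamiltonian an affine function. -/
theorem exists_straightening {V : E → ℝ} (hV : ContDiffOn ℝ ∞ V m.O) {z : E × (E →L[ℝ] ℝ)}
    (hz : z ∈ m.N) (h0 : z.2 ≠ 0) :
    ∃ φ : OpenPartialHomeomorph (E × (E →L[ℝ] ℝ)) (E × (E →L[ℝ] ℝ)), z ∈ φ.source ∧
      φ.source ⊆ m.O ×ˢ univ ∧ ContDiffOn ℝ ∞ φ φ.source ∧ ContDiffOn ℝ ∞ φ.symm φ.target ∧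
      ∃ K K' : Submodule ℝ (E × (E →L[ℝ] ℝ)), K' ≤ K ∧
        Module.finrank ℝ K = Module.finrank ℝ K' + 1 ∧
        ∀ y ∈ φ.source, (y ∈ m.N ↔ φ y ∈ K) ∧ (y ∈ m.N ∧ m.ham V y = m.ham V z ↔ φ y ∈ K') := by
  set A := m.splitting z.1 with hA
  set O' : Set E := m.O ∩ A ⁻¹' (range fun e : E ≃L[ℝ] E => (e : E →L[ℝ] E)) with hO'
  have hO'o : IsOpen O' :=
    (smooth_splitting z.1).continuousOn.isOpen_inter_preimage m.isOpen ContinuousLinearEquiv.isOpen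
  have hzO' : z.1 ∈ O' := ⟨hz.1, ContinuousLinearEquiv.refl ℝ E, (splitting_self hz.1).symm⟩
  set T : E × (E →L[ℝ] ℝ) → E × (E →L[ℝ] ℝ) := fun y => (y.1, y.2.comp (A y.1)) with hT
  have hTs : ContDiffOn ℝ ∞ T (O' ×ˢ univ) :=
    contDiffOn_fst.prodMk (contDiffOn_snd.clm_comp
      ((smooth_splitting z.1).comp contDiffOn_fst fun y hy => hy.1.1))
  have hOo : IsOpen (O' ×ˢ (univ : Set (E →L[ℝ] ℝ))) := hO'o.prod isOpen_univ
  have hzO : z ∈ O' ×ˢ (univ : Set (E →L[ℝ] ℝ)) := ⟨hzO', trivial⟩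
  have hTd : HasFDerivAt T (fderiv ℝ T z) z :=
    ((hTs.contDiffAt (hOo.mem_nhds hzO)).differentiableAt (by simp)).hasFDerivAt
  set B := fderiv ℝ T z with hB
  have hTz : T z = z := by
    simp only [hT, hA, splitting_self hz.1]
    rfl
  -- the derivative of `T` at `z` is the identity on the base and on the fibre
  have hB1 : ∀ X, (B X).1 = X.1 := fun X => by
    have h1 : HasFDerivAt (fun y : E × (E →L[ℝ] ℝ) => (T y).1)
      ((ContinuousLinearMap.fst ℝ _ _).comp B) z := hTd.fst
    exact DFunLike.congr_fun (h1.unique hasFDerivAt_fst) X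
  have hB2 : ∀ a, B (0, a) = (0, a) := fun a => by
    have h1 : HasDerivAt (fun t : ℝ => z + t • ((0 : E), a)) ((0 : E), a) 0 := by
      simpa using ((hasDerivAt_id (0 : ℝ)).smul_const ((0 : E), a)).const_add z
    have h2 : HasFDerivAt T B (z + (0 : ℝ) • ((0 : E), a)) := by simpa using hTd
    have h3 := h2.comp_hasDerivAt (f := fun t : ℝ => z + t • ((0 : E), a)) (0 : ℝ) h1
    have h4 : T ∘ (fun t : ℝ => z + t • ((0 : E), a)) = fun t : ℝ => z + t • ((0 : E), a) := by
      funext t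
      simp only [hT, hA, Function.comp_apply, Prod.fst_add, Prod.smul_fst, smul_zero, add_zero,
        splitting_self hz.1]
      ext <;> simp
    rw [h4] at h3
    exact h3.unique h1
  have hBi : Function.Injective B := by
    rw [injective_iff_map_eq_zero]
    intro X hX
    have h1 : X.1 = 0 := by rw [← hB1, hX]; rfl
    have h2 : X = (0, X.2) := Prod.ext h1 rfl
    rw [h2, hB2] at hX
    rw [h2, hX]
  -- `k` is the radial vector, scaled so that `ℓ k = 1`; adding a multiple of it to `T y - z` makes `ℓ`
  -- of the result equal to `H y - H z`, and does not change the derivative at `z`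
  have hBv := isInvertible_of_injective B hBi rfl
  have hpos := fderiv_ham_radial_pos hV hz h0
  have hHd := hasFDerivAt_ham hV hz.1
  set dH := fderiv ℝ (m.ham V) z with hdH
  set ℓ : E × (E →L[ℝ] ℝ) →L[ℝ] ℝ := dH.comp B.inverse with hℓ
  have hℓB : ∀ X, ℓ (B X) = dH X := fun X => by
    rw [hℓ, ContinuousLinearMap.comp_apply, hBv.inverse_apply_self]
  set k : E × (E →L[ℝ] ℝ) := (dH (0, z.2))⁻¹ • ((0 : E), z.2) with hk
  have hℓk : ℓ k = 1 := by
    have h1 := hℓB (0, z.2)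
    rw [hB2] at h1
    rw [hk, map_smul, h1, smul_eq_mul, inv_mul_cancel₀ hpos.ne']
  set f : E × (E →L[ℝ] ℝ) → E × (E →L[ℝ] ℝ) := fun y =>
    T y - z + (m.ham V y - m.ham V z - ℓ (T y - z)) • k with hf
  have hℓf : ∀ y, ℓ (f y) = m.ham V y - m.ham V z := fun y => by
    simp only [hf, map_add, map_smul, hℓk, smul_eq_mul]
    ring
  have hfs : ContDiffOn ℝ ∞ f (O' ×ˢ univ) := by
    have h1 : ContDiffOn ℝ ∞ (fun y => T y - z) (O' ×ˢ univ) := hTs.sub contDiffOn_const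
    have h2 : ContDiffOn ℝ ∞ (m.ham V) (O' ×ˢ univ) :=
      (smooth_ham hV).mono (prod_mono inter_subset_left subset_rfl)
    have h3 : ContDiffOn ℝ ∞ (fun y => m.ham V y - m.ham V z - ℓ (T y - z)) (O' ×ˢ univ) :=
      (h2.sub contDiffOn_const).sub (ℓ.contDiff.comp_contDiffOn h1)
    exact h1.add (h3.smul contDiffOn_const)
  have hfd : HasFDerivAt f B z := by
    have h1 : HasFDerivAt (fun y => T y - z) B z := hTd.sub_const z
    have h2 := h1.add (((hHd.sub_const (m.ham V z)).sub (ℓ.hasFDerivAt.comp z h1)).smul_const k)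
    refine h2.congr_fderiv ?_
    refine ContinuousLinearMap.ext fun X => ?_
    simp [hℓB]
  obtain ⟨φ, hφz, hφs, hφf, hφ1, hφ2⟩ :=
    exists_smooth_openPartialHomeomorph hOo hfs hzO (by rw [hfd.fderiv]; exact hBi)
  let K : Submodule ℝ (E × (E →L[ℝ] ℝ)) :=
    { carrier := {X | X.2.comp (m.P z.1) = X.2}
      add_mem' := fun {X Y} hX hY => by
        simp only [mem_ofPred_eq, Prod.snd_add, ContinuousLinearMap.add_comp] at *
        rw [hX, hY]
      zero_mem' := by simp
      smul_mem' := fun c X hX => by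
        simp only [mem_ofPred_eq, Prod.smul_snd, ContinuousLinearMap.smul_comp] at *
        rw [hX] }
  have hzK : z ∈ K := hz.2
  have hkK : k ∈ K := K.smul_mem _ (show ((0 : E), z.2) ∈ K from hz.2)
  have hNK : ∀ y ∈ φ.source, y ∈ m.N ↔ φ y ∈ K := fun y hy => by
    obtain ⟨⟨h1, e, he⟩, -⟩ := hφs hy
    have h2 : y ∈ m.N ↔ T y ∈ K := by
      refine Iff.trans ⟨fun h => h.2, fun h => ⟨h1, h⟩⟩ (comp_P_eq_iff hz.1 h1 ⟨e, he⟩ y.2)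
    rw [h2, hφf, hf, K.add_mem_iff_left (K.smul_mem _ hkK), K.sub_mem_iff_left hzK]
  refine ⟨φ, hφz, hφs.trans (prod_mono inter_subset_left subset_rfl), hφ1, hφ2, K,
    K ⊓ LinearMap.ker (ℓ : E × (E →L[ℝ] ℝ) →ₗ[ℝ] ℝ), inf_le_left, ?_, fun y hy => ⟨hNK y hy, ?_⟩⟩
  · rw [← finrank_range_add_finrank_inf_ker K (ℓ : E × (E →L[ℝ] ℝ) →ₗ[ℝ] ℝ), add_comm]
    congr 1
    have : LinearMap.range ((ℓ : E × (E →L[ℝ] ℝ) →ₗ[ℝ] ℝ).domRestrict K) = ⊤ :=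
      LinearMap.range_eq_top.2 fun t => ⟨t • ⟨k, hkK⟩, by simp [hℓk]⟩
    rw [this, finrank_top, Module.finrank_self]
  · rw [hNK y hy, Submodule.mem_inf, LinearMap.mem_ker, ContinuousLinearMap.coe_coe, hφf, hℓf,
      sub_eq_zero]

end CoordModel

/-! ### Level sets of the Hamiltonian -/

theorem mem_contDiffGroupoid_cotModel {E : Type*} [NormedAddCommGroup E] [NormedSpace ℝ E]
    {φ : OpenPartialHomeomorph (ModelProd E (E →L[ℝ] ℝ)) (ModelProd E (E →L[ℝ] ℝ))}
    (h1 : ContDiffOn ℝ ∞ (E := E × (E →L[ℝ] ℝ)) (F := E × (E →L[ℝ] ℝ)) φ φ.source)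
    (h2 : ContDiffOn ℝ ∞ (E := E × (E →L[ℝ] ℝ)) (F := E × (E →L[ℝ] ℝ)) φ.symm φ.target) :
    φ ∈ contDiffGroupoid ∞ (cotModel E) := by
  rw [contDiffGroupoid, mem_groupoid_of_pregroupoid]
  constructor
  · exact h1.mono inter_subset_left
  · exact h2.mono inter_subset_left

namespace CoordModel
variable {E : Type*} [NormedAddCommGroup E] [NormedSpace ℝ E] [FiniteDimensional ℝ E] {r : ℕ}
  {m : CoordModel E r} {z : E × (E →L[ℝ] ℝ)}

/-- On the kernel of `dH` the canonical forms have no common degenerate direction: the radial vector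
`(0, p)`, on which `dH` does not vanish, pairs with `Z` to `θ(Z)`. -/
theorem eq_zero_of_contact {V : E → ℝ} (hV : ContDiffOn ℝ ∞ V m.O) (hz : z ∈ m.N) (h0 : z.2 ≠ 0)
    {Z : E × (E →L[ℝ] ℝ)} (hZ : Z ∈ m.NT z) (hθ : z.2 Z.1 = 0)
    (hω : ∀ Y ∈ m.NT z, fderiv ℝ (m.ham V) z Y = 0 → wform Z Y = 0) : Z = 0 := by
  refine wform_nondegenerate hz hZ fun Y hY => ?_
  set ρ : E × (E →L[ℝ] ℝ) := ((0 : E), z.2) with hρ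
  have hρm : ρ ∈ m.NT z := radial_mem hz
  have hpos := fderiv_ham_radial_pos hV hz h0
  set c := fderiv ℝ (m.ham V) z Y / fderiv ℝ (m.ham V) z ρ with hc
  have h1 := hω (Y - c • ρ) (Submodule.sub_mem _ hY (Submodule.smul_mem _ _ hρm)) (by
    rw [map_sub, map_smul, smul_eq_mul, hc, div_mul_cancel₀ _ hpos.ne', sub_self])
  simp only [wform, hρ, Prod.snd_sub, Prod.smul_snd, Prod.fst_sub, Prod.smul_fst, smul_zero,
    sub_zero, sub_apply, smul_apply, hθ] at h1
  simpa [wform] using h1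

/-- The Hamiltonian field, of energy `1`, serves as the first vector. -/
theorem exists_contact_wedgePow_ne_zero {V : E → ℝ} (hV : ContDiffOn ℝ ∞ V m.O) (hz : z ∈ m.N)
    (h0 : z.2 ≠ 0) (hR : 1 / 2 * z.2 (m.sharp z.1 z.2) = 1)
    (hc : fderiv ℝ (m.ham V) z (m.nhField V z) = 0) :
    ∃ v : Fin (2 * (r - 1) + 1) → E × (E →L[ℝ] ℝ),
      (∀ i, v i ∈ m.NT z ∧ fderiv ℝ (m.ham V) z (v i) = 0) ∧
      wedgePow (fun X : E × (E →L[ℝ] ℝ) => 1 / 2 * z.2 X.1) (fun X Y => 1 / 2 * wform X Y)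
        (r - 1) v ≠ 0 := by
  let B : LinearMap.BilinForm ℝ (E × (E →L[ℝ] ℝ)) :=
    LinearMap.mk₂ ℝ (fun X Y => 1 / 2 * wform X Y)
      (fun _ _ _ => by simp [wform]; ring) (fun _ _ _ => by simp [wform]; ring)
      (fun _ _ _ => by simp [wform]; ring) (fun _ _ _ => by simp [wform]; ring)
  let θ : E × (E →L[ℝ] ℝ) →ₗ[ℝ] ℝ := (1 / 2 : ℝ) • (z.2 : E →ₗ[ℝ] ℝ).comp (LinearMap.fst ℝ _ _)
  have hθ : ∀ X, θ X = 1 / 2 * z.2 X.1 := fun X => rfl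
  have hB' : ∀ X Y, B X Y = 1 / 2 * wform X Y := fun X Y => rfl
  have hB : B.IsAlt := fun X => by rw [hB', wform, sub_self, mul_zero]
  let C : Submodule ℝ (E × (E →L[ℝ] ℝ)) :=
    m.NT z ⊓ LinearMap.ker (fderiv ℝ (m.ham V) z : E × (E →L[ℝ] ℝ) →ₗ[ℝ] ℝ)
  have hCm : ∀ X, X ∈ C ↔ X ∈ m.NT z ∧ fderiv ℝ (m.ham V) z X = 0 := fun X => Iff.rfl
  obtain ⟨W, -, hzW, -, s, -, hs⟩ := exists_contact_frame hV hz h0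
  obtain ⟨hl, hsp⟩ := hs z ⟨hzW, hz⟩
  have hCs : C = Submodule.span ℝ (range fun i => s i z) := by
    ext X
    rw [hsp, hCm]
  have hr : Module.finrank ℝ C = 2 * (r - 1) + 1 := by
    rw [hCs, finrank_span_eq_card hl, Fintype.card_fin]
  obtain ⟨v, hv, hne⟩ := exists_wedgePow_ne_zero B hB θ C inferInstance hr
    (R := m.nhField V z) ((hCm _).2 ⟨nhField_mem V hz, hc⟩) (by rw [hθ]; exact hR)
    (fun Y hY => by
      rw [hB', wform_nhField hV hz ((hCm _).1 hY).1, ((hCm _).1 hY).2, mul_zero])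
    (fun Z hZ hθZ hωZ => eq_zero_of_contact hV hz h0 ((hCm _).1 hZ).1
      (by rw [hθ] at hθZ; linarith) fun Y hY hHY => by
        have := hωZ Y ((hCm _).2 ⟨hY, hHY⟩)
        rw [hB'] at this
        linarith)
  exact ⟨v, fun i => (hCm _).1 (hv i), hne⟩

end CoordModel

theorem frame_of_isInvertible {T F ι : Type*} [AddCommGroup T] [Module ℝ T] [TopologicalSpace T]
    [AddCommGroup F] [Module ℝ F] [TopologicalSpace F] {A : T →L[ℝ] F} (hA : A.IsInvertible)
    {s : ι → F} (hs : LinearIndependent ℝ s) :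
    LinearIndependent ℝ (fun i => A.inverse (s i)) ∧
      ∀ X, X ∈ Submodule.span ℝ (range fun i => A.inverse (s i)) ↔
        A X ∈ Submodule.span ℝ (range s) := by
  obtain ⟨e, rfl⟩ := hA
  rw [ContinuousLinearMap.inverse_equiv]
  refine ⟨hs.map' (e.symm.toLinearEquiv : F →ₗ[ℝ] T) (LinearEquiv.ker e.symm.toLinearEquiv),
    fun X => ?_⟩
  have hr : (range fun i => (e.symm : F →L[ℝ] T) (s i)) =
      (e.symm.toLinearEquiv : F →ₗ[ℝ] T) '' range s := by
    rw [← range_comp]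
    rfl
  rw [hr, Submodule.span_image, Submodule.mem_map_equiv]
  rfl

section Level
variable {E : Type*} [NormedAddCommGroup E] [NormedSpace ℝ E] [FiniteDimensional ℝ E]
  {Q : Type*} [TopologicalSpace Q] [ChartedSpace E Q] [IsManifold 𝓘(ℝ, E) ∞ Q]
  {r : ℕ} {G : MetricField E Q} {D : DistField E Q} {U : Set Q} {V : Q → ℝ} {c : ℝ}

/-- The level set of the Hamiltonian in the dual of the distribution. -/
def levelSet (G : MetricField E Q) (V : Q → ℝ) (D : DistField E Q) (U : Set Q) (c : ℝ) :
    Set (Cotangent E Q) := {α | α ∈ dualDist G D U ∧ hamiltonian G V α = c}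

theorem covec_ne_zero {p q : Q} (hq : q ∈ (extChartAt 𝓘(ℝ, E) p).source)
    {α : TangentSpace 𝓘(ℝ, E) q →L[ℝ] ℝ} (hα : α ≠ 0) : covec p α ≠ 0 := fun h => hα <| by
  ext v
  rw [← covec_dchart hq α v, h]
  rfl

theorem isSubmanifoldOfCodim_levelSet (hV : ContMDiff 𝓘(ℝ, E) 𝓘(ℝ, ℝ) ∞ V) (hG : IsMetricOn G U)
    (hD : IsDistribution D r) (hne : ∀ α ∈ levelSet G V D U c, α.snd ≠ 0) :
    IsSubmanifoldOfCodim (cotModel E) (levelSet G V D U c) (dualDist G D U) 1 := by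
  refine ⟨fun α hα => hα.1, fun α hα => ?_⟩
  obtain ⟨m, h0, h⟩ := exists_model hG hD hα.1.1
  have hαm : α ∈ modelDomain m α := mem_modelDomain_self h0
  have hN := (mem_dualDist_iff hG h hαm).1 hα.1
  have hz0 : (extChartAt (cotModel E) α α).2 ≠ 0 := by
    rw [cotChart_apply hαm.1]
    exact covec_ne_zero hαm.1 (hne α hα)
  obtain ⟨φ, hzφ, hφO, hφ1, hφ2, K, K', hKK, hK, hy⟩ :=
    CoordModel.exists_straightening (contDiffOn_inChart hV h) hN hz0
  rw [← hamiltonian_eq_ham hG h hαm, hα.2] at hy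
  let φ' : OpenPartialHomeomorph (ModelProd E (E →L[ℝ] ℝ)) (ModelProd E (E →L[ℝ] ℝ)) := φ
  refine ⟨chartAt (ModelProd E (E →L[ℝ] ℝ)) α ≫ₕ φ',
    trans_mem_maximalAtlas (IsManifold.chart_mem_maximalAtlas (I := cotModel E) (n := ∞) α)
      (mem_contDiffGroupoid_cotModel hφ1 hφ2), ?_, K, K', hKK, hK, fun β hβ => ?_⟩
  · rw [OpenPartialHomeomorph.trans_source]
    exact ⟨mem_chart_source _ α, hzφ⟩
  · rw [OpenPartialHomeomorph.trans_source] at hβ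
    have h1 : extChartAt (cotModel E) α β ∈ φ.source := hβ.2
    have hβm : β ∈ modelDomain m α := by
      rw [modelDomain_eq]
      refine ⟨?_, hφO h1⟩
      rw [extChartAt_source]
      exact hβ.1
    obtain ⟨h2, h3⟩ := hy _ h1
    refine ⟨(mem_dualDist_iff hG h hβm).trans h2, Iff.trans ?_ h3⟩
    rw [← hamiltonian_eq_ham hG h hβm, ← mem_dualDist_iff hG h hβm]
    rfl

/-- The fibre derivative of the Hamiltonian in the radial direction does not vanish. -/
theorem exists_differential_pos (hV : ContMDiff 𝓘(ℝ, E) 𝓘(ℝ, ℝ) ∞ V) (hG : IsMetricOn G U)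
    (hD : IsDistribution D r) {α : Cotangent E Q} (hα : α ∈ dualDist G D U) (hne : α.snd ≠ 0) :
    ∃ Y ∈ nhTangent D (dualDist G D U) α, 0 < differential (hamiltonian G V) α Y := by
  obtain ⟨m, h0, h⟩ := exists_model hG hD hα.1
  have hαm : α ∈ modelDomain m α := mem_modelDomain_self h0
  have hN := (mem_dualDist_iff hG h hαm).1 hα
  have hz0 : (extChartAt (cotModel E) α α).2 ≠ 0 := by
    rw [cotChart_apply hαm.1]
    exact covec_ne_zero hαm.1 hne
  refine ⟨_, inverse_dchart_mem_nhTangent hG h hαm hα (CoordModel.radial_mem hN), ?_⟩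
  rw [(differential_hamiltonian hV hG h hαm _).2,
    dchart_inverse_apply (mem_cotChart_source.2 hαm.1)]
  exact CoordModel.fderiv_ham_radial_pos (contDiffOn_inChart hV h) hN hz0

theorem mdifferentiableAt_hamiltonian (hV : ContMDiff 𝓘(ℝ, E) 𝓘(ℝ, ℝ) ∞ V) (hG : IsMetricOn G U)
    (hD : IsDistribution D r) {α : Cotangent E Q} (hα : α.proj ∈ U) :
    MDifferentiableAt (cotModel E) 𝓘(ℝ, ℝ) (hamiltonian G V) α := by
  obtain ⟨m, h0, h⟩ := exists_model hG hD hα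
  exact (differential_hamiltonian hV hG h (mem_modelDomain_self h0) 0).1

theorem tangentSet_levelSet (hV : ContMDiff 𝓘(ℝ, E) 𝓘(ℝ, ℝ) ∞ V) (hG : IsMetricOn G U)
    (hD : IsDistribution D r) (hne : ∀ α ∈ levelSet G V D U c, α.snd ≠ 0) {α : Cotangent E Q}
    (hα : α ∈ levelSet G V D U c) :
    tangentSet (cotModel E) (levelSet G V D U c) α =
      {X | X ∈ tangentSet (cotModel E) (dualDist G D U) α ∧
        differential (hamiltonian G V) α X = 0} := by
  obtain ⟨Y, hY, hpos⟩ := exists_differential_pos hV hG hD hα.1 (hne α hα)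
  exact tangentSet_eq_of_codim_one (isSubmanifoldOfCodim_levelSet hV hG hD hne) (fun β hβ => hβ.2)
    hα (mdifferentiableAt_hamiltonian hV hG hD hα.1.1) ⟨Y, hY.1, hpos.ne'⟩

/-- The tangent vectors to the level set that project into the distribution. -/
def levelBundle (G : MetricField E Q) (V : Q → ℝ) (D : DistField E Q) (U : Set Q) (c : ℝ)
    (α : Cotangent E Q) : Set (TangentSpace (cotModel E) α) :=
  tangentSet (cotModel E) (levelSet G V D U c) α ∩ nhTangent D (dualDist G D U) α

theorem mem_levelBundle (hV : ContMDiff 𝓘(ℝ, E) 𝓘(ℝ, ℝ) ∞ V) (hG : IsMetricOn G U)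
    (hD : IsDistribution D r) (hne : ∀ α ∈ levelSet G V D U c, α.snd ≠ 0) {α : Cotangent E Q}
    (hα : α ∈ levelSet G V D U c) (X : TangentSpace (cotModel E) α) :
    X ∈ levelBundle G V D U c α ↔ X ∈ nhTangent D (dualDist G D U) α ∧
      differential (hamiltonian G V) α X = 0 := by
  rw [levelBundle, tangentSet_levelSet hV hG hD hne hα]
  exact ⟨fun h => ⟨h.2, h.1.2⟩, fun h => ⟨⟨h.1.1, h.2⟩, h.1⟩⟩

theorem mem_levelBundle_chart {m : CoordModel E r} {α₀ : Cotangent E Q}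
    (hV : ContMDiff 𝓘(ℝ, E) 𝓘(ℝ, ℝ) ∞ V) (hG : IsMetricOn G U)
    (hD : IsDistribution D r) (hne : ∀ α ∈ levelSet G V D U c, α.snd ≠ 0)
    (h : IsModelAt m G D U α₀.proj) {α : Cotangent E Q} (hαm : α ∈ modelDomain m α₀)
    (hα : α ∈ levelSet G V D U c) (X : TangentSpace (cotModel E) α) :
    X ∈ levelBundle G V D U c α ↔
      dchart (cotModel E) α₀ α X ∈ m.NT (extChartAt (cotModel E) α₀ α) ∧
        fderiv ℝ (m.ham (inChart V α₀.proj)) (extChartAt (cotModel E) α₀ α)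
          (dchart (cotModel E) α₀ α X) = 0 := by
  rw [mem_levelBundle hV hG hD hne hα, mem_nhTangent_iff hG h hαm hα.1,
    (differential_hamiltonian hV hG h hαm X).2]

theorem isSmoothSubbundle_levelBundle (hV : ContMDiff 𝓘(ℝ, E) 𝓘(ℝ, ℝ) ∞ V) (hG : IsMetricOn G U)
    (hD : IsDistribution D r) (hne : ∀ α ∈ levelSet G V D U c, α.snd ≠ 0) :
    IsSmoothSubbundle (cotModel E) (levelSet G V D U c) (levelBundle G V D U c)
      (2 * (r - 1) + 1) := by
  intro α hα
  obtain ⟨m, h0, h⟩ := exists_model hG hD hα.1.1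
  have hαm : α ∈ modelDomain m α := mem_modelDomain_self h0
  have hN := (mem_dualDist_iff hG h hαm).1 hα.1
  have hz0 : (extChartAt (cotModel E) α α).2 ≠ 0 := by
    rw [cotChart_apply hαm.1]
    exact covec_ne_zero hαm.1 (hne α hα)
  obtain ⟨W, hW, hzW, hWO, s, hs, hsW⟩ :=
    CoordModel.exists_contact_frame (contDiffOn_inChart hV h) hN hz0
  refine ⟨(extChartAt (cotModel E) α).source ∩ extChartAt (cotModel E) α ⁻¹' W,
    (continuousOn_extChartAt α).isOpen_inter_preimage (isOpen_extChartAt_source α) hW,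
    ⟨mem_extChartAt_source α, hzW⟩,
    fun i β => (dchart (cotModel E) α β).inverse (s i (extChartAt (cotModel E) α β)),
    fun i => contMDiffOn_inverse_dchart_field α hW (hs i), fun β hβ => ?_⟩
  have hβm : β ∈ modelDomain m α := by
    rw [modelDomain_eq]
    exact ⟨hβ.1.1, hWO hβ.1.2⟩
  obtain ⟨hl, hsp⟩ := hsW _ ⟨hβ.1.2, (mem_dualDist_iff hG h hβm).1 hβ.2.1⟩
  obtain ⟨h1, h2⟩ := frame_of_isInvertible (dchart_isInvertible (J := cotModel E) hβ.1.1) hl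
  refine ⟨h1, ?_⟩
  ext X
  exact (h2 X).trans ((hsp _).trans (mem_levelBundle_chart hV hG hD hne h hβm hβ.2 X).symm)

end Level

/-! ### The contact bundle and its Reeb section -/

section Contact
variable {E : Type*} [NormedAddCommGroup E] [NormedSpace ℝ E] [FiniteDimensional ℝ E]
  {Q : Type*} [TopologicalSpace Q] [ChartedSpace E Q] [IsManifold 𝓘(ℝ, E) ∞ Q]
  {r : ℕ} {G : MetricField E Q} {D : DistField E Q} {U : Set Q} {V : Q → ℝ} {c : ℝ}

/-- A smooth vector field in the chart at `α₀`. -/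
theorem contMDiffOn_dchart_field {Y : ∀ α : Cotangent E Q, TangentSpace (cotModel E) α}
    {W : Set (Cotangent E Q)} (hW : IsOpen W)
    (hY : ContMDiffOn (cotModel E) (cotModel E).tangent ∞
      (fun y => (⟨y, Y y⟩ : TangentBundle (cotModel E) (Cotangent E Q))) W) (α₀ : Cotangent E Q) :
    ContMDiffOn (cotModel E) 𝓘(ℝ, E × (E →L[ℝ] ℝ)) ∞
      (fun y => dchart (cotModel E) α₀ y (Y y)) (W ∩ (extChartAt (cotModel E) α₀).source) :=
  (contMDiffOn_field_iff α₀ Y (hW.inter (isOpen_extChartAt_source α₀)) inter_subset_right).1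
    (hY.mono inter_subset_left)

theorem IsSmoothAlong.contMDiffOn_liouville {S : Set (Cotangent E Q)}
    {X : ∀ α : Cotangent E Q, TangentSpace (cotModel E) α} (hX : IsSmoothAlong (cotModel E) S X) :
    ContMDiffOn (cotModel E) 𝓘(ℝ, ℝ) ∞ (fun α => liouville α (X α)) S := by
  intro α hα
  obtain ⟨W, hW, hαW, Y, hY, hYX⟩ := hX α hα
  have h1 := contMDiffOn_dchart_field hW hY α
  have h2 : ContMDiffOn (cotModel E) 𝓘(ℝ, E × (E →L[ℝ] ℝ)) ∞ (extChartAt (cotModel E) α)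
      (W ∩ (extChartAt (cotModel E) α).source) := by
    rw [extChartAt_source]
    exact contMDiffOn_extChartAt.mono inter_subset_right
  have h3 : ContDiff ℝ ∞
      (fun w : (E × (E →L[ℝ] ℝ)) × (E × (E →L[ℝ] ℝ)) => w.1.2 w.2.1) :=
    (contDiff_snd.comp contDiff_fst).clm_apply (contDiff_fst.comp contDiff_snd)
  have h4 := h3.contMDiff.comp_contMDiffOn (h2.prodMk_space h1)
  have hα' : α ∈ W ∩ (extChartAt (cotModel E) α).source := ⟨hαW, mem_extChartAt_source α⟩
  have hWo := hW.inter (isOpen_extChartAt_source (I := cotModel E) α)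
  have h5 : ∀ β ∈ S ∩ (W ∩ (extChartAt (cotModel E) α).source), liouville β (X β) =
      (extChartAt (cotModel E) α β).2 (dchart (cotModel E) α β (Y β)).1 := fun β hβ => by
    rw [← hYX β ⟨hβ.2.1, hβ.1⟩, liouville_cotChart (mem_cotChart_source.1 hβ.2.2)]
  have h6 := (h4.contMDiffAt (hWo.mem_nhds hα')).contMDiffWithinAt (s := S)
  refine h6.congr_of_eventuallyEq ?_ (h5 α ⟨hα, hα'⟩)
  filter_upwards [self_mem_nhdsWithin, mem_nhdsWithin_of_mem_nhds (hWo.mem_nhds hα')] with β h7 h8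
  exact h5 β ⟨h7, h8⟩

theorem IsSmoothAlong.contMDiffOn_omegaQ {S : Set (Cotangent E Q)}
    {X X' : ∀ α : Cotangent E Q, TangentSpace (cotModel E) α}
    (hX : IsSmoothAlong (cotModel E) S X) (hX' : IsSmoothAlong (cotModel E) S X') :
    ContMDiffOn (cotModel E) 𝓘(ℝ, ℝ) ∞ (fun α => omegaQ α (X α) (X' α)) S := by
  intro α hα
  obtain ⟨W, hW, hαW, Y, hY, hYX⟩ := hX α hα
  obtain ⟨W', hW', hαW', Y', hY', hYX'⟩ := hX' α hα
  have h1 := (contMDiffOn_dchart_field hW hY α).contMDiffAt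
    ((hW.inter (isOpen_extChartAt_source α)).mem_nhds ⟨hαW, mem_extChartAt_source α⟩)
  have h2 := (contMDiffOn_dchart_field hW' hY' α).contMDiffAt
    ((hW'.inter (isOpen_extChartAt_source α)).mem_nhds ⟨hαW', mem_extChartAt_source α⟩)
  have h3 : ContDiff ℝ ∞
      (fun w : (E × (E →L[ℝ] ℝ)) × (E × (E →L[ℝ] ℝ)) => wform w.1 w.2) :=
    ((contDiff_snd.comp contDiff_snd).clm_apply (contDiff_fst.comp contDiff_fst)).sub
      ((contDiff_snd.comp contDiff_fst).clm_apply (contDiff_fst.comp contDiff_snd))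
  have h4 := (h3.contMDiff.contMDiffAt).comp α (h1.prodMk_space h2)
  have hWo := (hW.inter hW').inter (isOpen_extChartAt_source (I := cotModel E) α)
  have hα' : α ∈ W ∩ W' ∩ (extChartAt (cotModel E) α).source :=
    ⟨⟨hαW, hαW'⟩, mem_extChartAt_source α⟩
  have h5 : ∀ β ∈ S ∩ (W ∩ W' ∩ (extChartAt (cotModel E) α).source), omegaQ β (X β) (X' β) =
      wform (dchart (cotModel E) α β (Y β)) (dchart (cotModel E) α β (Y' β)) := fun β hβ => by
    rw [← hYX β ⟨hβ.2.1.1, hβ.1⟩, ← hYX' β ⟨hβ.2.1.2, hβ.1⟩,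
      omegaQ_cotChart (mem_cotChart_source.1 hβ.2.2)]
  have h6 := h4.contMDiffWithinAt (s := S)
  refine h6.congr_of_eventuallyEq ?_ (h5 α ⟨hα, hα'⟩)
  filter_upwards [self_mem_nhdsWithin, mem_nhdsWithin_of_mem_nhds (hWo.mem_nhds hα')] with β h7 h8
  exact h5 β ⟨h7, h8⟩

theorem wedgePow_comp {T T' : Type*} {θ : T → ℝ} {om : T → T → ℝ} {θ' : T' → ℝ}
    {om' : T' → T' → ℝ} {k : ℕ} (f : T' → T) (h1 : ∀ X, θ (f X) = θ' X)
    (h2 : ∀ X Y, om (f X) (f Y) = om' X Y) (v : Fin (2 * k + 1) → T') :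
    wedgePow θ om k (fun i => f (v i)) = wedgePow θ' om' k v := by
  simp only [wedgePow, h1, h2]

theorem omegaQ_linear (α : Cotangent E Q) (a b : ℝ) (u v w : TangentSpace (cotModel E) α) :
    omegaQ α (a • u + b • v) w = a * omegaQ α u w + b * omegaQ α v w := by
  have h : α.proj ∈ (extChartAt 𝓘(ℝ, E) α.proj).source := mem_extChartAt_source _
  rw [omegaQ_cotChart h, omegaQ_cotChart h, omegaQ_cotChart h,
    show dchart (cotModel E) α α (a • u + b • v) =
      a • dchart (cotModel E) α α u + b • dchart (cotModel E) α α v from by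
        rw [ContinuousLinearMap.map_add, ContinuousLinearMap.map_smul,
          ContinuousLinearMap.map_smul]]
  simp only [wform, map_add, map_smul, Prod.fst_add, Prod.snd_add,
    Prod.smul_fst, Prod.smul_snd, add_apply, smul_apply, smul_eq_mul]
  ring

theorem omegaQ_alternating (α : Cotangent E Q) (u v : TangentSpace (cotModel E) α) :
    omegaQ α u v = -omegaQ α v u := by
  have h : α.proj ∈ (extChartAt 𝓘(ℝ, E) α.proj).source := mem_extChartAt_source _
  simp only [omegaQ_cotChart h, wform]
  ring

theorem snd_ne_zero_of_hamiltonian_eq_one {α : Cotangent E Q}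
    (h : hamiltonian G (fun _ => 0) α = 1) : α.snd ≠ 0 := fun h0 => by
  rw [hamiltonian, h0, cometric, map_zero, map_zero] at h
  simp at h

theorem levelSet_snd_ne_zero : ∀ α ∈ levelSet G (fun _ => 0) D U 1, α.snd ≠ 0 :=
  fun _ hα => snd_ne_zero_of_hamiltonian_eq_one hα.2

/-- For a kinetic Hamiltonian the canonical `1`-form takes the value `2 H` on the Hamiltonian
field (Euler's identity). -/
theorem IsNHHamiltonianField.liouville_eq (hG : IsMetricOn G U) (hD : IsDistribution D r)
    {X : ∀ α : Cotangent E Q, TangentSpace (cotModel E) α}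
    (hX : IsNHHamiltonianField D (dualDist G D U) (hamiltonian G (fun _ => 0)) X)
    {α : Cotangent E Q} (hα : α ∈ dualDist G D U) :
    liouville α (X α) = 2 * hamiltonian G (fun _ => 0) α := by
  obtain ⟨m, h0, h⟩ := exists_model hG hD hα.1
  have hαm : α ∈ modelDomain m α := mem_modelDomain_self h0
  obtain ⟨h1, h2⟩ := nhField_spec (V := fun _ => 0) contMDiff_const hG h hαm hα
  have h3 := eq_of_omegaQ_eq hG hD hα (hX.1.2 α hα) h1 fun Y hY =>
    (hX.2 α hα Y hY).trans (h2 Y hY).symm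
  rw [h3, liouville_cotChart hαm.1, dchart_inverse_apply (mem_cotChart_source.2 hαm.1),
    hamiltonian_eq_ham hG h hαm]
  simp [CoordModel.nhField, CoordModel.ham, inChart]

theorem omegaQ_self (α : Cotangent E Q) (u : TangentSpace (cotModel E) α) : omegaQ α u u = 0 := by
  have := omegaQ_alternating α u u
  linarith

/-- The Hamiltonian field is tangent to the level sets, as `dH(X) = ω_Q(X, X) = 0`. -/
theorem IsNHHamiltonianField.mem_levelBundle (hV : ContMDiff 𝓘(ℝ, E) 𝓘(ℝ, ℝ) ∞ V)
    (hG : IsMetricOn G U) (hD : IsDistribution D r)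
    (hne : ∀ α ∈ levelSet G V D U c, α.snd ≠ 0)
    {X : ∀ α : Cotangent E Q, TangentSpace (cotModel E) α}
    (hX : IsNHHamiltonianField D (dualDist G D U) (hamiltonian G V) X)
    {α : Cotangent E Q} (hα : α ∈ levelSet G V D U c) : X α ∈ levelBundle G V D U c α := by
  rw [Nonholonomic.mem_levelBundle hV hG hD hne hα]
  refine ⟨hX.1.2 α hα.1, ?_⟩
  rw [← hX.2 α hα.1 _ (hX.1.2 α hα.1), omegaQ_self]

theorem IsSmoothAlong.mono {S S' : Set (Cotangent E Q)}
    {X : ∀ α : Cotangent E Q, TangentSpace (cotModel E) α} (hX : IsSmoothAlong (cotModel E) S X)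
    (h : S' ⊆ S) : IsSmoothAlong (cotModel E) S' X := fun α hα => by
  obtain ⟨W, hW, hαW, Y, hY, hYX⟩ := hX α (h hα)
  exact ⟨W, hW, hαW, Y, hY, fun β hβ => hYX β ⟨hβ.1, h hβ.2⟩⟩

/-- The Hamiltonian field of the kinetic energy is the Reeb section of the level set `H = 1`. -/
theorem isReebSection_levelSet (hG : IsMetricOn G U) (hD : IsDistribution D r)
    {X : ∀ α : Cotangent E Q, TangentSpace (cotModel E) α}
    (hX : IsNHHamiltonianField D (dualDist G D U) (hamiltonian G (fun _ => 0)) X) :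
    IsReebSection (cotModel E) (levelSet G (fun _ => 0) D U 1) (levelBundle G (fun _ => 0) D U 1)
      thetaE omegaE X where
  section_mem := ⟨hX.1.1.mono fun _ hα => hα.1, fun _ hα =>
    hX.mem_levelBundle contMDiff_const hG hD levelSet_snd_ne_zero hα⟩
  theta_eq α hα := by
    rw [thetaE, hX.liouville_eq hG hD hα.1, hα.2]
    norm_num
  omega_eq α hα Y hY := by
    rw [mem_levelBundle contMDiff_const hG hD levelSet_snd_ne_zero hα] at hY
    rw [omegaE, hX.2 α hα.1 Y hY.1, hY.2, mul_zero]

/-- The Reeb section is unique: a difference `Z` of two of them has `θ(Z) = 0` and `i_Z ω = 0` on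
the contact bundle, hence pairs to zero also with the radial direction. -/
theorem IsReebSection.unique (hG : IsMetricOn G U) (hD : IsDistribution D r)
    {X X' : ∀ α : Cotangent E Q, TangentSpace (cotModel E) α}
    (hX : IsReebSection (cotModel E) (levelSet G (fun _ => 0) D U 1)
      (levelBundle G (fun _ => 0) D U 1) thetaE omegaE X)
    (hX' : IsReebSection (cotModel E) (levelSet G (fun _ => 0) D U 1)
      (levelBundle G (fun _ => 0) D U 1) thetaE omegaE X')
    {α : Cotangent E Q} (hα : α ∈ levelSet G (fun _ => 0) D U 1) : X' α = X α := by
  obtain ⟨m, h0, h⟩ := exists_model hG hD hα.1.1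
  have hαm : α ∈ modelDomain m α := mem_modelDomain_self h0
  have hN := (mem_dualDist_iff hG h hαm).1 hα.1
  have hs := mem_cotChart_source.2 hαm.1
  have hz0 : (extChartAt (cotModel E) α α).2 ≠ 0 := by
    rw [cotChart_apply hαm.1]
    exact covec_ne_zero hαm.1 (levelSet_snd_ne_zero α hα)
  have hm := mem_levelBundle_chart (V := fun _ => 0) (c := 1) contMDiff_const hG hD
    levelSet_snd_ne_zero h hαm hα
  have h1 := (hm _).1 (hX.section_mem.2 α hα)
  have h2 := (hm _).1 (hX'.section_mem.2 α hα)
  have h3 := hX.theta_eq α hα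
  have h4 := hX'.theta_eq α hα
  rw [thetaE, liouville_cotChart hαm.1] at h3 h4
  have h5 := CoordModel.eq_zero_of_contact (contDiffOn_inChart contMDiff_const h) hN hz0
    (Submodule.sub_mem _ h2.1 h1.1) (by rw [Prod.fst_sub, map_sub]; linarith) fun Y hY hHY => by
      have h6 : (dchart (cotModel E) α α).inverse Y ∈ levelBundle G (fun _ => 0) D U 1 α := by
        rw [hm, dchart_inverse_apply hs]
        exact ⟨hY, hHY⟩
      have h7 := hX.omega_eq α hα _ h6
      have h8 := hX'.omega_eq α hα _ h6
      rw [omegaE, omegaQ_cotChart hαm.1, dchart_inverse_apply hs, wform] at h7 h8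
      simp only [wform, Prod.fst_sub, Prod.snd_sub, map_sub, sub_apply]
      linarith
  rw [← inverse_dchart_apply hs (X α), ← sub_eq_zero.1 h5, inverse_dchart_apply hs]

theorem isContactBundle_levelSet (hG : IsMetricOn G U) (hD : IsDistribution D r) :
    IsContactBundle (cotModel E) (levelSet G (fun _ => 0) D U 1)
      (levelBundle G (fun _ => 0) D U 1) thetaE omegaE (r - 1) where
  subbundle := isSmoothSubbundle_levelBundle contMDiff_const hG hD levelSet_snd_ne_zero
  theta_linear α _ a b u _ v _ := by
    rw [thetaE, thetaE, thetaE, ContinuousLinearMap.map_add, ContinuousLinearMap.map_smul,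
      ContinuousLinearMap.map_smul, smul_eq_mul, smul_eq_mul]
    ring
  omega_linear α _ a b u _ v _ w _ := by
    simp only [omegaE, omegaQ_linear]
    ring
  omega_alternating α _ u _ v _ := by
    rw [omegaE, omegaQ_alternating, omegaE]
    ring
  theta_smooth W _ X hX := by
    have h1 := hX.1.contMDiffOn_liouville
    have h2 : ContDiff ℝ ∞ (fun t : ℝ => 1 / 2 * t) := contDiff_const.mul contDiff_id
    exact h2.contMDiff.comp_contMDiffOn h1
  omega_smooth W _ X Y hX hY := by
    have h1 := hX.1.contMDiffOn_omegaQ hY.1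
    have h2 : ContDiff ℝ ∞ (fun t : ℝ => 1 / 2 * t) := contDiff_const.mul contDiff_id
    exact h2.contMDiff.comp_contMDiffOn h1
  nonvanishing α hα := by
    obtain ⟨m, h0, h⟩ := exists_model hG hD hα.1.1
    have hαm : α ∈ modelDomain m α := mem_modelDomain_self h0
    have hN := (mem_dualDist_iff hG h hαm).1 hα.1
    have hs := mem_cotChart_source.2 hαm.1
    have hz0 : (extChartAt (cotModel E) α α).2 ≠ 0 := by
      rw [cotChart_apply hαm.1]
      exact covec_ne_zero hαm.1 (levelSet_snd_ne_zero α hα)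
    have hV' := contDiffOn_inChart (V := fun _ : Q => 0) contMDiff_const h
    have hH := hα.2
    rw [hamiltonian_eq_ham hG h hαm, CoordModel.ham, inChart, add_zero] at hH
    obtain ⟨v, hv, hne⟩ := CoordModel.exists_contact_wedgePow_ne_zero hV' hN hz0 hH (by
      rw [← CoordModel.wform_nhField hV' hN (CoordModel.nhField_mem _ hN), wform, sub_self])
    refine ⟨fun i => (dchart (cotModel E) α α).inverse (v i), fun i => ?_, ?_⟩
    · rw [mem_levelBundle_chart contMDiff_const hG hD levelSet_snd_ne_zero h hαm hα,
        dchart_inverse_apply hs]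
      exact hv i
    · rwa [wedgePow_comp (θ := thetaE α) (om := omegaE α) (dchart (cotModel E) α α).inverse
        (fun X => ?_) fun X Y => ?_]
      · rw [thetaE, liouville_cotChart hαm.1, dchart_inverse_apply hs]
      · rw [omegaE, omegaQ_cotChart hαm.1, dchart_inverse_apply hs, dchart_inverse_apply hs]

end Contact

/-! ### The sphere bundle -/

section DualVec
variable {r : ℕ}

/-- The vector of `ℝ^r` that represents a linear form. -/
def dualVec (f : EuclideanSpace ℝ (Fin r) →L[ℝ] ℝ) : EuclideanSpace ℝ (Fin r) :=
  (InnerProductSpace.toDual ℝ _).symm f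

theorem inner_dualVec (f : EuclideanSpace ℝ (Fin r) →L[ℝ] ℝ) (y : EuclideanSpace ℝ (Fin r)) :
    inner ℝ (dualVec f) y = f y := InnerProductSpace.toDual_symm_apply

theorem dualVec_apply (f : EuclideanSpace ℝ (Fin r) →L[ℝ] ℝ) (i : Fin r) :
    dualVec f i = f (EuclideanSpace.single i 1) := by
  rw [← inner_dualVec, EuclideanSpace.inner_single_right]
  simp

theorem dualVec_eq {f : EuclideanSpace ℝ (Fin r) →L[ℝ] ℝ} {y : EuclideanSpace ℝ (Fin r)}
    (h : ∀ z, f z = inner ℝ y z) : dualVec f = y :=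
  ext_inner_right ℝ fun z => by rw [inner_dualVec, h]

end DualVec

namespace CoordModel
variable {E : Type*} [NormedAddCommGroup E] [NormedSpace ℝ E] [FiniteDimensional ℝ E] {r : ℕ}
  {m : CoordModel E r} {x : E}

variable (m) in
/-- The covector in the dual of the distribution with components `y` in the frame. -/
def flatOf (x : E) (y : EuclideanSpace ℝ (Fin r)) : E →L[ℝ] ℝ :=
  m.G x (m.lift x (innerSL ℝ y))

theorem flatOf_L (hx : x ∈ m.O) (y z : EuclideanSpace ℝ (Fin r)) :
    m.flatOf x y (m.L x z) = inner ℝ y z := G_lift hx _ _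

theorem flatOf_comp_P (hx : x ∈ m.O) (y : EuclideanSpace ℝ (Fin r)) :
    (m.flatOf x y).comp (m.P x) = m.flatOf x y := by
  ext v
  rw [ContinuousLinearMap.comp_apply, flatOf, ← G_P_left hx]
  congr 2
  exact P_L hx _

theorem eq_of_L_eq {p q : E →L[ℝ] ℝ} (hp : p.comp (m.P x) = p) (hq : q.comp (m.P x) = q)
    (h : ∀ z, p (m.L x z) = q (m.L x z)) : p = q := by
  ext v
  obtain ⟨z, hz⟩ := m.P_eq_L x v
  rw [← hp, ← hq, ContinuousLinearMap.comp_apply, ContinuousLinearMap.comp_apply, hz, h]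

theorem flatOf_dualVec (hx : x ∈ m.O) {p : E →L[ℝ] ℝ} (hp : p.comp (m.P x) = p) :
    m.flatOf x (dualVec (p.comp (m.L x))) = p :=
  eq_of_L_eq (flatOf_comp_P hx _) hp fun z => by
    rw [flatOf_L hx, inner_dualVec, ContinuousLinearMap.comp_apply]

theorem flatOf_smul (x : E) (c : ℝ) (y : EuclideanSpace ℝ (Fin r)) :
    m.flatOf x (c • y) = c • m.flatOf x y := by
  simp only [flatOf, map_smul]

theorem flatOf_ne_zero (hx : x ∈ m.O) {y : EuclideanSpace ℝ (Fin r)} (hy : y ≠ 0) :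
    m.flatOf x y ≠ 0 := fun h => hy <| by
  have h1 := flatOf_L hx y y
  rw [h] at h1
  exact inner_self_eq_zero.1 h1.symm

theorem sharp_nonneg (hx : x ∈ m.O) (p : E →L[ℝ] ℝ) : 0 ≤ p (m.sharp x p) := by
  rcases eq_or_ne p 0 with h | h
  · simp [h]
  · exact (sharp_pos hx h).le

variable (m) in
/-- The quantity under the square root in `toSphere`. The second summand vanishes on the
covectors of the distribution of squared length `2`, and keeps the sum positive elsewhere. -/
def toSphereDen (z : E × (E →L[ℝ] ℝ)) : ℝ :=
  ‖dualVec (z.2.comp (m.L z.1))‖ ^ 2 +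
    (2 - (z.2.comp (m.P z.1)) (m.sharp z.1 (z.2.comp (m.P z.1)))) ^ 2

variable (m) in
/-- The radial projection of the components of a covector to the unit sphere. -/
def toSphere (z : E × (E →L[ℝ] ℝ)) : EuclideanSpace ℝ (Fin r) :=
  (√(m.toSphereDen z))⁻¹ • dualVec (z.2.comp (m.L z.1))

variable (m) in
/-- The quantity under the square root in `ofSphere`. -/
def ofSphereDen (w : E × EuclideanSpace ℝ (Fin r)) : ℝ :=
  m.flatOf w.1 w.2 (m.sharp w.1 (m.flatOf w.1 w.2)) + (1 - ‖w.2‖ ^ 2) ^ 2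

variable (m) in
/-- The covector of squared length `2` whose components point in a given direction. -/
def ofSphere (w : E × EuclideanSpace ℝ (Fin r)) : E →L[ℝ] ℝ :=
  (√2 * (√(m.ofSphereDen w))⁻¹) • m.flatOf w.1 w.2

theorem toSphereDen_pos (z : E × (E →L[ℝ] ℝ)) : 0 < m.toSphereDen z := by
  by_cases h : dualVec (z.2.comp (m.L z.1)) = 0
  · have h1 : z.2.comp (m.P z.1) = 0 := by
      ext v
      obtain ⟨y, hy⟩ := m.P_eq_L z.1 v
      rw [ContinuousLinearMap.comp_apply, hy, ← ContinuousLinearMap.comp_apply, ← inner_dualVec, h,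
        inner_zero_left]
      rfl
    rw [toSphereDen, h, h1]
    norm_num
  · have := norm_pos_iff.2 h
    rw [toSphereDen]
    positivity

theorem ofSphereDen_pos {w : E × EuclideanSpace ℝ (Fin r)} (hw : w.1 ∈ m.O) :
    0 < m.ofSphereDen w := by
  by_cases h : w.2 = 0
  · rw [ofSphereDen, h, norm_zero]
    have := sharp_nonneg hw (m.flatOf w.1 0)
    norm_num
    linarith
  · have := sharp_pos hw (flatOf_ne_zero hw h)
    rw [ofSphereDen]
    positivity

theorem smooth_toSphere : ContDiffOn ℝ ∞ m.toSphere (m.O ×ˢ univ) := by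
  have hf : MapsTo (Prod.fst : E × (E →L[ℝ] ℝ) → E) (m.O ×ˢ univ) m.O := fun z hz => hz.1
  have hL : ContDiffOn ℝ ∞ (fun z : E × (E →L[ℝ] ℝ) => m.L z.1) (m.O ×ˢ univ) :=
    m.smooth_L.comp contDiffOn_fst hf
  have hP : ContDiffOn ℝ ∞ (fun z : E × (E →L[ℝ] ℝ) => m.P z.1) (m.O ×ˢ univ) :=
    (smooth_P (m := m)).comp contDiffOn_fst hf
  have hS : ContDiffOn ℝ ∞ (fun z : E × (E →L[ℝ] ℝ) => m.sharp z.1) (m.O ×ˢ univ) :=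
    (smooth_sharp (m := m)).comp contDiffOn_fst hf
  have h1 : ContDiffOn ℝ ∞ (fun z : E × (E →L[ℝ] ℝ) => dualVec (z.2.comp (m.L z.1)))
      (m.O ×ˢ univ) := by
    rw [contDiffOn_euclidean]
    intro i
    simp only [dualVec_apply, ContinuousLinearMap.comp_apply]
    exact contDiffOn_snd.clm_apply (hL.clm_apply contDiffOn_const)
  have h2 : ContDiffOn ℝ ∞ (fun z : E × (E →L[ℝ] ℝ) => z.2.comp (m.P z.1)) (m.O ×ˢ univ) :=
    contDiffOn_snd.clm_comp hP
  have h3 : ContDiffOn ℝ ∞ m.toSphereDen (m.O ×ˢ univ) :=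
    (h1.norm_sq ℝ).add ((contDiffOn_const.sub (h2.clm_apply (hS.clm_apply h2))).pow 2)
  exact ((h3.sqrt fun z _ => (toSphereDen_pos z).ne').inv
    fun z _ => (Real.sqrt_pos.2 (toSphereDen_pos z)).ne').smul h1

theorem smooth_ofSphere : ContDiffOn ℝ ∞ m.ofSphere (m.O ×ˢ univ) := by
  have hf : MapsTo (Prod.fst : E × EuclideanSpace ℝ (Fin r) → E) (m.O ×ˢ univ) m.O :=
    fun z hz => hz.1
  have h1 : ContDiffOn ℝ ∞ (fun w : E × EuclideanSpace ℝ (Fin r) => m.flatOf w.1 w.2)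
      (m.O ×ˢ univ) :=
    (m.smooth_G.comp contDiffOn_fst hf).clm_apply
      (((smooth_lift (m := m)).comp contDiffOn_fst hf).clm_apply
        ((innerSL ℝ).contDiff.comp_contDiffOn contDiffOn_snd))
  have h2 : ContDiffOn ℝ ∞ m.ofSphereDen (m.O ×ˢ univ) :=
    (h1.clm_apply (((smooth_sharp (m := m)).comp contDiffOn_fst hf).clm_apply h1)).add
      ((contDiffOn_const.sub (contDiffOn_snd.norm_sq ℝ)).pow 2)
  exact (contDiffOn_const.mul ((h2.sqrt fun w hw => (ofSphereDen_pos hw.1).ne').inv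
    fun w hw => (Real.sqrt_pos.2 (ofSphereDen_pos hw.1)).ne')).smul h1

theorem dualVec_ne_zero {z : E × (E →L[ℝ] ℝ)} (hz : z ∈ m.N) (h0 : z.2 ≠ 0) :
    dualVec (z.2.comp (m.L z.1)) ≠ 0 := fun h => h0 <| by
  rw [← flatOf_dualVec hz.1 hz.2, h, flatOf]
  simp

theorem toSphere_eq {z : E × (E →L[ℝ] ℝ)} (hz : z ∈ m.N) (h2 : z.2 (m.sharp z.1 z.2) = 2) :
    m.toSphere z = ‖dualVec (z.2.comp (m.L z.1))‖⁻¹ • dualVec (z.2.comp (m.L z.1)) := by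
  rw [toSphere, toSphereDen, hz.2, h2, sub_self, zero_pow two_ne_zero, add_zero,
    Real.sqrt_sq (norm_nonneg _)]

theorem toSphere_mem {z : E × (E →L[ℝ] ℝ)} (hz : z ∈ m.N) (h2 : z.2 (m.sharp z.1 z.2) = 2) :
    m.toSphere z ∈ Metric.sphere 0 1 := by
  have h0 : z.2 ≠ 0 := fun h => by simp [h] at h2
  rw [toSphere_eq hz h2, mem_sphere_zero_iff_norm, norm_smul, norm_inv, norm_norm,
    inv_mul_cancel₀ (norm_ne_zero_iff.2 (dualVec_ne_zero hz h0))]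

theorem ofSphere_eq {w : E × EuclideanSpace ℝ (Fin r)} (hw : ‖w.2‖ = 1) :
    m.ofSphere w = (√2 * (√(m.flatOf w.1 w.2 (m.sharp w.1 (m.flatOf w.1 w.2))))⁻¹) •
      m.flatOf w.1 w.2 := by
  rw [ofSphere, ofSphereDen, hw]
  norm_num

theorem sqrt_two_mul_inv {n : ℝ} (hn : 0 < n) : √2 * (√(n⁻¹ * (n⁻¹ * 2)))⁻¹ * n⁻¹ = 1 := by
  have h3 : √(n⁻¹ * (n⁻¹ * 2)) = n⁻¹ * √2 := by
    rw [← mul_assoc, Real.sqrt_mul (by positivity), Real.sqrt_mul_self (by positivity)]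
  have h2 : √2 ≠ 0 := by positivity
  rw [h3]
  field_simp

theorem ofSphere_toSphere {z : E × (E →L[ℝ] ℝ)} (hz : z ∈ m.N)
    (h2 : z.2 (m.sharp z.1 z.2) = 2) : m.ofSphere (z.1, m.toSphere z) = z.2 := by
  have h0 : z.2 ≠ 0 := fun h => by simp [h] at h2
  have hn := norm_pos_iff.2 (dualVec_ne_zero hz h0)
  have hf : m.flatOf z.1 (m.toSphere z) = ‖dualVec (z.2.comp (m.L z.1))‖⁻¹ • z.2 := by
    rw [toSphere_eq hz h2, flatOf_smul, flatOf_dualVec hz.1 hz.2]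
  have he := ofSphere_eq (m := m) (w := (z.1, m.toSphere z))
    (mem_sphere_zero_iff_norm.1 (toSphere_mem hz h2))
  dsimp only at he
  have h3 : (‖dualVec (z.2.comp (m.L z.1))‖⁻¹ • z.2)
      (m.sharp z.1 (‖dualVec (z.2.comp (m.L z.1))‖⁻¹ • z.2)) =
        ‖dualVec (z.2.comp (m.L z.1))‖⁻¹ * (‖dualVec (z.2.comp (m.L z.1))‖⁻¹ * 2) := by
    rw [map_smul, map_smul, smul_apply, h2, smul_eq_mul, smul_eq_mul]
  rw [he, hf, h3, smul_smul, sqrt_two_mul_inv hn, one_smul]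

theorem ofSphere_spec {x : E} (hx : x ∈ m.O) {y : EuclideanSpace ℝ (Fin r)}
    (hy : y ∈ Metric.sphere 0 1) :
    (x, m.ofSphere (x, y)) ∈ m.N ∧
      m.ofSphere (x, y) (m.sharp x (m.ofSphere (x, y))) = 2 ∧
      m.toSphere (x, m.ofSphere (x, y)) = y := by
  have hy1 := mem_sphere_zero_iff_norm.1 hy
  have hy0 : y ≠ 0 := norm_ne_zero_iff.1 (by rw [hy1]; exact one_ne_zero)
  have hpos := sharp_pos hx (flatOf_ne_zero hx hy0)
  have he := ofSphere_eq (m := m) (w := (x, y)) hy1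
  simp only at he
  set s := m.flatOf x y (m.sharp x (m.flatOf x y)) with hs
  set k := √2 * (√s)⁻¹ with hk
  have hk0 : 0 < k := by positivity
  have h1 : (x, m.ofSphere (x, y)) ∈ m.N := by
    refine ⟨hx, ?_⟩
    rw [he]
    simp only [ContinuousLinearMap.smul_comp, flatOf_comp_P hx]
  have h2 : m.ofSphere (x, y) (m.sharp x (m.ofSphere (x, y))) = 2 := by
    rw [he]
    simp only [map_smul, smul_apply, smul_eq_mul]
    rw [← hs, hk]
    have h3 : √s * √s = s := Real.mul_self_sqrt hpos.le
    have h4 : √2 * √2 = (2 : ℝ) := Real.mul_self_sqrt (by norm_num)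
    have h5 : √s ≠ 0 := (Real.sqrt_pos.2 hpos).ne'
    field_simp
    nlinarith
  refine ⟨h1, h2, ?_⟩
  have h3 : dualVec ((m.ofSphere (x, y)).comp (m.L x)) = k • y := dualVec_eq fun z => by
    rw [he, ContinuousLinearMap.comp_apply, smul_apply, flatOf_L hx, inner_smul_left]
    simp
  rw [toSphere_eq h1 h2]
  simp only [h3]
  rw [norm_smul, hy1, mul_one, Real.norm_of_nonneg hk0.le, smul_smul, inv_mul_cancel₀ hk0.ne',
    one_smul]

end CoordModel

section Sphere
variable {E : Type*} [NormedAddCommGroup E] [NormedSpace ℝ E] [FiniteDimensional ℝ E]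
  {Q : Type*} [TopologicalSpace Q] [ChartedSpace E Q] [IsManifold 𝓘(ℝ, E) ∞ Q]
  {r : ℕ} {G : MetricField E Q} {D : DistField E Q} {U : Set Q}

theorem mem_levelSet_iff {m : CoordModel E r} {α₀ α : Cotangent E Q} (hG : IsMetricOn G U)
    (h : IsModelAt m G D U α₀.proj) (hα : α ∈ modelDomain m α₀) :
    α ∈ levelSet G (fun _ => 0) D U 1 ↔ extChartAt (cotModel E) α₀ α ∈ m.N ∧
      (extChartAt (cotModel E) α₀ α).2 (m.sharp (extChartAt (cotModel E) α₀ α).1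
        (extChartAt (cotModel E) α₀ α).2) = 2 := by
  rw [← mem_dualDist_iff hG h hα, levelSet, mem_ofPred_eq, hamiltonian_eq_ham hG h hα,
    CoordModel.ham, inChart, add_zero]
  refine and_congr_right fun _ => ⟨fun h => by linarith, fun h => by linarith⟩

/-- Over a chart domain the level set `‖α‖² = 2` is trivialized by the components of `α` in the frame,
radially projected to the unit sphere. -/
theorem isSphereBundle_levelSet (hG : IsMetricOn G U) (hD : IsDistribution D r) :
    IsSphereBundle (cotModel E) 𝓘(ℝ, E) (fun α : Cotangent E Q => α.proj)
      (levelSet G (fun _ => 0) D U 1) U r := by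
  refine ⟨fun α hα => hα.1.1, fun b hb => ?_⟩
  obtain ⟨m, h0, h⟩ := exists_model hG hD hb
  let α₀ : Cotangent E Q := ⟨b, 0⟩
  let W : Set Q := (extChartAt 𝓘(ℝ, E) b).source ∩ extChartAt 𝓘(ℝ, E) b ⁻¹' m.O
  have hWo : IsOpen W := (continuousOn_extChartAt b).isOpen_inter_preimage
    (isOpen_extChartAt_source b) m.isOpen
  have hWm : ∀ α : Cotangent E Q, α.proj ∈ W → α ∈ modelDomain m α₀ := fun α hα => hα
  have hsymm : ∀ q ∈ W, ∀ p : E →L[ℝ] ℝ,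
      ((extChartAt (cotModel E) α₀).symm (extChartAt 𝓘(ℝ, E) b q, p)).proj = q ∧
      extChartAt (cotModel E) α₀ ((extChartAt (cotModel E) α₀).symm (extChartAt 𝓘(ℝ, E) b q, p)) =
        (extChartAt 𝓘(ℝ, E) b q, p) := fun q hq p => by
    refine ⟨?_, (cotChart_symm_mem (m := m) (α₀ := α₀) h (z := (extChartAt 𝓘(ℝ, E) b q, p)) hq.2).2⟩
    rw [cotChart_symm_proj (α₀ := α₀) (z := (extChartAt 𝓘(ℝ, E) b q, p)) (h.O_subset hq.2)]
    exact (extChartAt 𝓘(ℝ, E) b).left_inv hq.1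
  refine ⟨W, hWo, ⟨mem_extChartAt_source b, h0⟩, fun q hq => h.mem_U hq.1 hq.2,
    fun α => m.toSphere (extChartAt (cotModel E) α₀ α),
    fun w => (extChartAt (cotModel E) α₀).symm
      (extChartAt 𝓘(ℝ, E) b w.1, m.ofSphere (extChartAt 𝓘(ℝ, E) b w.1, w.2)),
    ?_, ?_, fun α hα hαW => ?_, fun q hq y hy => ?_⟩
  · have h1 : ContMDiffOn (cotModel E) 𝓘(ℝ, E × (E →L[ℝ] ℝ)) ∞ (extChartAt (cotModel E) α₀)
        (modelDomain m α₀) := by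
      rw [modelDomain_eq, extChartAt_source]
      exact contMDiffOn_extChartAt.mono inter_subset_left
    refine (CoordModel.smooth_toSphere (m := m)).contMDiffOn.comp h1 fun α hα => ?_
    have h2 := hWm α hα
    rw [modelDomain_eq] at h2
    exact h2.2
  · have h1 : ContMDiffOn (𝓘(ℝ, E).prod 𝓘(ℝ, EuclideanSpace ℝ (Fin r))) 𝓘(ℝ, E) ∞
        (fun w : Q × EuclideanSpace ℝ (Fin r) => extChartAt 𝓘(ℝ, E) b w.1) (W ×ˢ univ) := by
      refine (contMDiffOn_extChartAt (I := 𝓘(ℝ, E)) (x := b)).comp contMDiffOn_fst fun w hw => ?_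
      rw [← extChartAt_source (I := 𝓘(ℝ, E))]
      exact hw.1.1
    have h2 := h1.prodMk_space (contMDiffOn_snd (I := 𝓘(ℝ, E))
      (J := 𝓘(ℝ, EuclideanSpace ℝ (Fin r))) (s := W ×ˢ univ) (n := ∞))
    have h3 := (CoordModel.smooth_ofSphere (m := m)).contMDiffOn.comp h2
      fun w hw => ⟨hw.1.2, trivial⟩
    refine (contMDiffOn_extChartAt_symm α₀).comp (h1.prodMk_space h3) fun w hw => ?_
    rw [mem_preimage, cotChart_target]
    exact ⟨h.O_subset hw.1.2, trivial⟩
  · have hz := (mem_levelSet_iff (α₀ := α₀) hG h (hWm α hαW)).1 hα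
    refine ⟨CoordModel.toSphere_mem hz.1 hz.2, ?_⟩
    have h1 : (extChartAt (cotModel E) α₀ α).1 = extChartAt 𝓘(ℝ, E) b α.proj := by
      rw [cotChart_apply (α₀ := α₀) hαW.1]
    have h2 := CoordModel.ofSphere_toSphere hz.1 hz.2
    simp only [← h1, h2]
    exact (extChartAt (cotModel E) α₀).left_inv (mem_cotChart_source.2 hαW.1)
  · obtain ⟨h1, h2⟩ := hsymm q hq (m.ofSphere (extChartAt 𝓘(ℝ, E) b q, y))
    obtain ⟨h3, h4, h5⟩ := CoordModel.ofSphere_spec hq.2 hy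
    refine ⟨?_, h1, ?_⟩
    · rw [mem_levelSet_iff (α₀ := α₀) hG h (hWm _ (by rw [h1]; exact hq)), h2]
      exact ⟨h3, h4⟩
    · simp only [h2]
      exact h5

end Sphere

/-! ### The Jacobi metric and its Hamiltonian -/

section Jacobi
variable {E : Type*} [NormedAddCommGroup E] [NormedSpace ℝ E] [FiniteDimensional ℝ E]
  {Q : Type*} [TopologicalSpace Q] [ChartedSpace E Q] [IsManifold 𝓘(ℝ, E) ∞ Q]
  {r : ℕ} {G : MetricField E Q} {D : DistField E Q} {U : Set Q} {V : Q → ℝ} {e : ℝ}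

theorem jacobi_apply (q : Q) (u v : TangentSpace 𝓘(ℝ, E) q) :
    jacobi G V e q u v = (e - V q) * G q u v := rfl

theorem orth_jacobi {q : Q} (hq : q ∈ region V e) : orth (jacobi G V e) D q = orth G D q := by
  have h : e - V q ≠ 0 := (sub_pos.2 hq).ne'
  ext v
  refine forall₂_congr fun u _ => ?_
  rw [jacobi_apply, mul_eq_zero]
  exact ⟨fun h1 => h1.resolve_left h, Or.inr⟩

theorem dualDist_jacobi : dualDist (jacobi G V e) D (region V e) = dualDistE G V D e := by
  ext α
  refine and_congr_right fun h => ?_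
  rw [orth_jacobi h]

theorem sharp_jacobi (hG : IsMetricOn G univ) {q : Q} (hq : q ∈ region V e)
    (α : TangentSpace 𝓘(ℝ, E) q →L[ℝ] ℝ) :
    sharp (jacobi G V e) q α = (e - V q)⁻¹ • sharp G q α := by
  have h : e - V q ≠ 0 := (sub_pos.2 hq).ne'
  have hi := IsModelAt.isInvertible hG (mem_univ q)
  have h1 : jacobi G V e q ((e - V q)⁻¹ • sharp G q α) = α := by
    change (e - V q) • G q ((e - V q)⁻¹ • sharp G q α) = α
    rw [map_smul, smul_smul, mul_inv_cancel₀ h, one_smul, IsModelAt.sharp_apply hG (mem_univ q)]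
  have hi' : (jacobi G V e q).IsInvertible :=
    isInvertible_of_pos (E := E) _ fun v hv => mul_pos (sub_pos.2 hq) (hG.pos q (mem_univ q) v hv)
  conv_lhs => rw [← h1]
  exact hi'.inverse_apply_self _

theorem cometric_jacobi (hG : IsMetricOn G univ) {q : Q} (hq : q ∈ region V e)
    (α : TangentSpace 𝓘(ℝ, E) q →L[ℝ] ℝ) :
    cometric (jacobi G V e) q α α = (e - V q)⁻¹ * cometric G q α α := by
  have h : e - V q ≠ 0 := (sub_pos.2 hq).ne'
  rw [cometric, sharp_jacobi hG hq, jacobi_apply, cometric, map_smul, map_smul, smul_apply,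
    smul_eq_mul, smul_eq_mul]
  field_simp

/-- The two Hamiltonians are related by `H_(g,V) = (e - V) H_(g_e) + V` on all of `T^*U_e`. -/
theorem hamiltonian_eq_jacobi (hG : IsMetricOn G univ) {α : Cotangent E Q}
    (hα : α.proj ∈ region V e) :
    hamiltonian G V α = (e - V α.proj) * jacobiHamiltonian G V e α + V α.proj := by
  have h : e - V α.proj ≠ 0 := (sub_pos.2 hα).ne'
  rw [jacobiHamiltonian, hamiltonian, hamiltonian, cometric_jacobi hG hα]
  field_simp
  ring

theorem sphereSet_eq :
    sphereSet G V D e = {α | α ∈ dualDistE G V D e ∧ hamiltonian G V α = e} := by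
  ext α
  refine and_congr_right fun _ => ?_
  rw [hamiltonian]
  exact ⟨fun h => by rw [h]; ring, fun h => by linarith⟩

theorem sphereSet_eq_jacobi (hG : IsMetricOn G univ) :
    sphereSet G V D e = {α | α ∈ dualDistE G V D e ∧ jacobiHamiltonian G V e α = 1} := by
  rw [sphereSet_eq]
  ext α
  refine and_congr_right fun hα => ?_
  have h : e - V α.proj ≠ 0 := (sub_pos.2 hα.1).ne'
  rw [hamiltonian_eq_jacobi hG hα.1]
  constructor
  · intro h1
    exact mul_left_cancel₀ h (by linarith)
  · intro h1
    rw [h1]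
    ring

theorem levelSet_jacobi (hG : IsMetricOn G univ) :
    levelSet (jacobi G V e) (fun _ => 0) D (region V e) 1 = sphereSet G V D e := by
  rw [levelSet, dualDist_jacobi, sphereSet_eq_jacobi hG, jacobiHamiltonian]

theorem levelBundle_jacobi (hG : IsMetricOn G univ) :
    levelBundle (jacobi G V e) (fun _ => 0) D (region V e) 1 = contactBundle G V D e := by
  funext α
  rw [levelBundle, levelSet_jacobi hG, dualDist_jacobi, contactBundle]

/-- On the sphere bundle `H = (e - V) H_e + V` and `H_e = 1`, so that the terms with `dV` cancel. -/
theorem differential_hamiltonian_eq (hV : ContMDiff 𝓘(ℝ, E) 𝓘(ℝ, ℝ) ∞ V) (hG : IsMetricOn G univ)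
    (hJ : IsMetricOn (jacobi G V e) (region V e)) (hD : IsDistribution D r) {α : Cotangent E Q}
    (hα : α.proj ∈ region V e) (h1 : jacobiHamiltonian G V e α = 1)
    (X : TangentSpace (cotModel E) α) :
    differential (hamiltonian G V) α X =
      (e - V α.proj) * differential (jacobiHamiltonian G V e) α X := by
  obtain ⟨m, h0, h⟩ := exists_model hJ hD hα
  have hαm : α ∈ modelDomain m α := mem_modelDomain_self h0
  have hz := cotChart_fst_mem hαm
  set z := extChartAt (cotModel E) α α with hzd
  have hz1 : z.1 = extChartAt 𝓘(ℝ, E) α.proj α.proj := by rw [hzd, cotChart_apply hαm.1]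
  have hHe := CoordModel.hasFDerivAt_ham (V := inChart (fun _ : Q => 0) α.proj)
    (contDiffOn_inChart contMDiff_const h) hz
  have hVd : HasFDerivAt (fun w : E × (E →L[ℝ] ℝ) => inChart V α.proj w.1)
      ((fderiv ℝ (inChart V α.proj) z.1).comp (ContinuousLinearMap.fst ℝ E _)) z :=
    HasFDerivAt.comp (g := inChart V α.proj) z
      (((contDiffOn_inChart hV h).contDiffAt (m.isOpen.mem_nhds hz)).differentiableAt
        (by simp)).hasFDerivAt hasFDerivAt_fst
  have hH := ((hVd.const_sub e).mul hHe).add hVd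
  have hHeq : hamiltonian G V =ᶠ[𝓝 α] (fun w : E × (E →L[ℝ] ℝ) => (e - inChart V α.proj w.1) *
      m.ham (inChart (fun _ : Q => 0) α.proj) w + inChart V α.proj w.1) ∘
        extChartAt (cotModel E) α := by
    filter_upwards [isOpen_modelDomain.mem_nhds hαm] with β hβ
    rw [hamiltonian_eq_jacobi hG (h.mem_U hβ.1 hβ.2), jacobiHamiltonian,
      hamiltonian_eq_ham hJ h hβ, Function.comp_apply]
    have : inChart V α.proj (extChartAt (cotModel E) α β).1 = V β.proj := by
      rw [cotChart_apply hβ.1, inChart, (extChartAt 𝓘(ℝ, E) α.proj).left_inv hβ.1]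
    rw [this]
  have hd := (differential_chart hαm.1 hHeq hH.differentiableAt X).2
  have hde := (differential_hamiltonian (V := fun _ => 0) contMDiff_const hJ h hαm X).2
  have hVz : inChart V α.proj z.1 = V α.proj := by
    rw [hz1, inChart, (extChartAt 𝓘(ℝ, E) α.proj).left_inv hαm.1]
  have hH1 : m.ham (inChart (fun _ : Q => 0) α.proj) z = 1 := by
    rw [← hamiltonian_eq_ham hJ h hαm]
    exact h1
  have hfd : fderiv ℝ (fun w : E × (E →L[ℝ] ℝ) => (e - inChart V α.proj w.1) *
      m.ham (inChart (fun _ : Q => 0) α.proj) w + inChart V α.proj w.1) z = _ :=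
    HasFDerivAt.fderiv hH
  rw [jacobiHamiltonian, hde, hd, ← hzd, hfd, hVz, hH1]
  simp only [add_apply, smul_apply, neg_apply, smul_eq_mul]
  ring

theorem tangentSet_inter_open {N : Set (Cotangent E Q)} {W : Set (Cotangent E Q)} (hW : IsOpen W)
    {α : Cotangent E Q} (hα : α ∈ W) :
    tangentSet (cotModel E) (N ∩ W) α = tangentSet (cotModel E) N α := by
  ext X
  constructor
  · rintro ⟨γ, h0, hc, hN, hX⟩
    exact ⟨γ, h0, hc, hN.mono fun _ h => h.1, hX⟩
  · rintro ⟨γ, h0, hc, hN, hX⟩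
    refine ⟨γ, h0, hc, ?_, hX⟩
    filter_upwards [hN, hc.continuousAt.preimage_mem_nhds (hW.mem_nhds (h0 ▸ hα))] with t h1 h2
    exact ⟨h1, h2⟩

theorem nhTangent_dualDistE (hV : Continuous V) {α : Cotangent E Q} (hα : α.proj ∈ region V e) :
    nhTangent D (dualDistE G V D e) α = nhTangent D (dualDist G D univ) α := by
  have hW : IsOpen {β : Cotangent E Q | β.proj ∈ region V e} :=
    (isOpen_lt hV continuous_const).preimage (FiberBundle.continuous_proj (E →L[ℝ] ℝ)
      (fun q : Q => TangentSpace 𝓘(ℝ, E) q →L[ℝ] ℝ))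
  have h1 : dualDistE G V D e = dualDist G D univ ∩ {β : Cotangent E Q | β.proj ∈ region V e} := by
    ext β
    exact ⟨fun h => ⟨⟨trivial, h.2⟩, h.1⟩, fun h => ⟨h.2, h.1.2⟩⟩
  rw [nhTangent, h1, tangentSet_inter_open hW hα]
  rfl

/-- The statements on the level set: equations, differentials, tangent spaces and fibres. -/
theorem level_set_facts (hV : ContMDiff 𝓘(ℝ, E) 𝓘(ℝ, ℝ) ∞ V) (hG : IsMetricOn G univ)
    (hJ : IsMetricOn (jacobi G V e) (region V e)) (hD : IsDistribution D r) :
    (sphereSet G V D e = {α | α ∈ dualDistE G V D e ∧ hamiltonian G V α = e} ∧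
      sphereSet G V D e = {α | α ∈ dualDistE G V D e ∧ jacobiHamiltonian G V e α = 1} ∧
      (∀ α ∈ sphereSet G V D e,
        (∀ Y ∈ nhTangent D (dualDistE G V D e) α, differential (hamiltonian G V) α Y =
            (e - V α.proj) * differential (jacobiHamiltonian G V e) α Y) ∧
        (∃ Y ∈ nhTangent D (dualDistE G V D e) α, differential (hamiltonian G V) α Y ≠ 0 ∧
          differential (jacobiHamiltonian G V e) α Y ≠ 0)) ∧
      IsSubmanifoldOfCodim (cotModel E) (sphereSet G V D e) (dualDistE G V D e) 1 ∧
      (∀ α ∈ sphereSet G V D e,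
        tangentSet (cotModel E) (sphereSet G V D e) α =
          {X | X ∈ tangentSet (cotModel E) (dualDistE G V D e) α ∧
            differential (hamiltonian G V) α X = 0} ∧
        tangentSet (cotModel E) (sphereSet G V D e) α =
          {X | X ∈ tangentSet (cotModel E) (dualDistE G V D e) α ∧
            differential (jacobiHamiltonian G V e) α X = 0}) ∧
      IsSphereBundle (cotModel E) 𝓘(ℝ, E) (fun α : Cotangent E Q => α.proj)
        (sphereSet G V D e) (region V e) r ∧
      (∀ q ∈ region V e, ∀ α : TangentSpace 𝓘(ℝ, E) q →L[ℝ] ℝ,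
        (⟨q, α⟩ : Cotangent E Q) ∈ sphereSet G V D e ↔
          (∀ v ∈ orth G D q, α v = 0) ∧
            √(cometric G q α α) = √(2 * (e - V q)))) := by
  have hS1 := sphereSet_eq_jacobi (V := V) (e := e) (D := D) hG
  have hd : ∀ α ∈ sphereSet G V D e, ∀ Y, differential (hamiltonian G V) α Y =
      (e - V α.proj) * differential (jacobiHamiltonian G V e) α Y := fun α hα Y =>
    differential_hamiltonian_eq hV hG hJ hD hα.1.1 ((hS1 ▸ hα : α ∈ {α | _ ∧ _}).2) Y
  have hlam : ∀ α ∈ sphereSet G V D e, 0 < e - V α.proj := fun α hα => sub_pos.2 hα.1.1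
  have hne := levelSet_snd_ne_zero (G := jacobi G V e) (D := D) (U := region V e)
  refine ⟨sphereSet_eq, hS1, fun α hα => ⟨fun Y _ => hd α hα Y, ?_⟩, ?_, fun α hα => ?_, ?_,
    fun q hq α => ?_⟩
  · have hα' := hα
    rw [← levelSet_jacobi hG] at hα'
    obtain ⟨Y, hY, hpos⟩ := exists_differential_pos (V := fun _ => 0) contMDiff_const hJ hD hα'.1
      (hne α hα')
    rw [dualDist_jacobi] at hY
    refine ⟨Y, hY, ?_, hpos.ne'⟩
    rw [hd α hα]
    exact (mul_pos (hlam α hα) hpos).ne'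
  · rw [← levelSet_jacobi hG, ← dualDist_jacobi]
    exact isSubmanifoldOfCodim_levelSet contMDiff_const hJ hD hne
  · have h1 : tangentSet (cotModel E) (sphereSet G V D e) α =
        {X | X ∈ tangentSet (cotModel E) (dualDistE G V D e) α ∧
          differential (jacobiHamiltonian G V e) α X = 0} := by
      have hα' := hα
      rw [← levelSet_jacobi hG] at hα'
      rw [← levelSet_jacobi hG, ← dualDist_jacobi]
      exact tangentSet_levelSet contMDiff_const hJ hD hne hα'
    refine ⟨?_, h1⟩
    rw [h1]
    ext X
    refine and_congr_right fun _ => ?_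
    rw [hd α hα, mul_eq_zero]
    exact ⟨Or.inr, fun h => h.resolve_left (hlam α hα).ne'⟩
  · rw [← levelSet_jacobi hG]
    exact isSphereBundle_levelSet hJ hD
  · have hc : 0 ≤ cometric G q α α := by
      rcases eq_or_ne (sharp G q α) 0 with h | h
      · rw [cometric, h, map_zero]
      · exact (hG.pos q (mem_univ q) _ h).le
    rw [Real.sqrt_inj hc (by have : V q < e := hq; linarith)]
    exact ⟨fun h => ⟨h.1.2, h.2⟩, fun h => ⟨⟨hq, h.1⟩, h.2⟩⟩

/-- The statements on the contact bundle, the Reeb section and the two Hamiltonian fields. -/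
theorem contact_facts (hV : ContMDiff 𝓘(ℝ, E) 𝓘(ℝ, ℝ) ∞ V) (hG : IsMetricOn G univ)
    (hJ : IsMetricOn (jacobi G V e) (region V e)) (hD : IsDistribution D r) :
    IsContactBundle (cotModel E) (sphereSet G V D e) (contactBundle G V D e)
        thetaE omegaE (r - 1) ∧
      ∃ X Xe : ∀ α : Cotangent E Q, TangentSpace (cotModel E) α,
        IsNHHamiltonianField D (dualDist G D univ) (hamiltonian G V) X ∧
        (∀ X', IsNHHamiltonianField D (dualDist G D univ) (hamiltonian G V) X' →
          ∀ α ∈ dualDist G D univ, X' α = X α) ∧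
        IsNHHamiltonianField D (dualDistE G V D e) (jacobiHamiltonian G V e) Xe ∧
        (∀ X', IsNHHamiltonianField D (dualDistE G V D e) (jacobiHamiltonian G V e) X' →
          ∀ α ∈ dualDistE G V D e, X' α = Xe α) ∧
        IsReebSection (cotModel E) (sphereSet G V D e) (contactBundle G V D e) thetaE omegaE Xe ∧
        ∀ Re : ∀ α : Cotangent E Q, TangentSpace (cotModel E) α,
          IsReebSection (cotModel E) (sphereSet G V D e) (contactBundle G V D e)
            thetaE omegaE Re →
          ∀ α ∈ sphereSet G V D e, Re α = Xe α ∧ (e - V α.proj) • Re α = X α := by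
  obtain ⟨X, hX⟩ := exists_nhHamiltonianField hV hG hD
  obtain ⟨Xe, hXe⟩ := exists_nhHamiltonianField (V := fun _ => 0) contMDiff_const hJ hD
  have hRe := isReebSection_levelSet hJ hD hXe
  have hcb := isContactBundle_levelSet hJ hD
  have hun := fun X' h => hXe.unique (X' := X') hJ hD h
  have hru := fun R h α => IsReebSection.unique (X' := R) (α := α) hJ hD hRe h
  rw [levelSet_jacobi hG, levelBundle_jacobi hG] at hRe hcb hru
  rw [dualDist_jacobi] at hXe hun
  refine ⟨hcb, X, Xe, hX, fun X' h => hX.unique hG hD h, hXe, hun, hRe, fun Re h α hα => ?_⟩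
  have h1 := hru Re h α hα
  refine ⟨h1, ?_⟩
  rw [h1]
  have hαN : α ∈ dualDist G D univ := ⟨trivial, hα.1.2⟩
  have hnh := nhTangent_dualDistE (G := G) (D := D) hV.continuous hα.1.1
  have hH1 : jacobiHamiltonian G V e α = 1 := by
    have := hα
    rw [sphereSet_eq_jacobi hG] at this
    exact this.2
  have hXeα := hXe.1.2 α hα.1
  rw [hnh] at hXeα
  -- both sides represent `dH` on the vectors that project into the distribution
  refine eq_of_omegaQ_eq hG hD hαN ?_ (hX.1.2 α hαN) fun Y hY => ?_
  · obtain ⟨m, h0, h⟩ := exists_model hG hD hαN.1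
    rw [mem_nhTangent_iff hG h (mem_modelDomain_self h0) hαN] at hXeα ⊢
    rw [ContinuousLinearMap.map_smul]
    exact Submodule.smul_mem _ _ hXeα
  · have h2 := omegaQ_linear α (e - V α.proj) 0 (Xe α) 0 Y
    rw [smul_zero, add_zero, zero_mul, add_zero] at h2
    rw [hX.2 α hαN Y hY, differential_hamiltonian_eq hV hG hJ hD hα.1.1 hH1, h2,
      hXe.2 α hα.1 Y (hnh ▸ hY), jacobiHamiltonian]

end Jacobi

/-! ### Covariant derivatives along curves in charts -/

section Christoffel
variable {E : Type*} [NormedAddCommGroup E] [NormedSpace ℝ E]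

set_option synthInstance.maxHeartbeats 200000 in
/-- The Christoffel symbols of a field of bilinear forms on an open subset of a vector space. -/
def vectorChristoffel (G : E → E →L[ℝ] E →L[ℝ] ℝ) (y u w : E) : E :=
  ContinuousLinearMap.inverse (G y)
    ((1 / 2 : ℝ) • (fderiv ℝ G y u w + fderiv ℝ G y w u - ((fderiv ℝ G y).flip u).flip w))

theorem vectorChristoffel_spec {G : E → E →L[ℝ] E →L[ℝ] ℝ} {y : E} (hi : (G y).IsInvertible)
    (u w z : E) : G y (vectorChristoffel G y u w) z =
      1 / 2 * (fderiv ℝ G y u w z + fderiv ℝ G y w u z - fderiv ℝ G y z u w) := by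
  rw [vectorChristoffel, hi.self_apply_inverse]
  rfl

theorem hasDerivAt_comp_of_eq {F : Type*} [NormedAddCommGroup F] [NormedSpace ℝ F] {f : E → F}
    {γ : ℝ → E} {x γ' : E} {t : ℝ} (hf : DifferentiableAt ℝ f x) (hγ : HasDerivAt γ γ' t)
    (h : γ t = x) : HasDerivAt (fun s => f (γ s)) (fderiv ℝ f x γ') t := by
  subst h
  exact hf.hasFDerivAt.comp_hasDerivAt t hγ

theorem hasDerivAt_comp_line {F : Type*} [NormedAddCommGroup F] [NormedSpace ℝ F] {f : E → F}
    {x : E} (hf : DifferentiableAt ℝ f x) (a : E) :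
    HasDerivAt (fun t : ℝ => f (x + t • a)) (fderiv ℝ f x a) 0 := by
  have hl : HasDerivAt (fun t : ℝ => x + t • a) a 0 := by
    simpa using ((hasDerivAt_id (0 : ℝ)).smul_const a).const_add x
  exact hasDerivAt_comp_of_eq hf hl (by simp)

set_option synthInstance.maxHeartbeats 200000 in
/-- The derivative of the coefficients of a metric, pulled back by `σ`. -/
theorem fderiv_pullback {Gp Gq : E → E →L[ℝ] E →L[ℝ] ℝ} {σ : E → E} {x : E}
    (hσ : ContDiffAt ℝ ∞ σ x) (hp : DifferentiableAt ℝ Gp x) (hq : DifferentiableAt ℝ Gq (σ x))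
    (hpull : ∀ᶠ y in 𝓝 x, ∀ u w, Gp y u w = Gq (σ y) (fderiv ℝ σ y u) (fderiv ℝ σ y w))
    (a u w : E) : fderiv ℝ Gp x a u w =
      fderiv ℝ Gq (σ x) (fderiv ℝ σ x a) (fderiv ℝ σ x u) (fderiv ℝ σ x w) +
        Gq (σ x) (fderiv ℝ (fderiv ℝ σ) x a u) (fderiv ℝ σ x w) +
        Gq (σ x) (fderiv ℝ σ x u) (fderiv ℝ (fderiv ℝ σ) x a w) := by
  have h0 : x + (0 : ℝ) • a = x := by simp
  have h1 := hasDerivAt_comp_line (hσ.differentiableAt (by simp)) a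
  have h2 := hasDerivAt_comp_line ((hσ.fderiv_right (m := 1)
    (by rw [one_add_one_eq_two]; exact two_le_infty)).differentiableAt (by simp)) a
  have h3 := hasDerivAt_comp_line (F := E →L[ℝ] E →L[ℝ] ℝ) hp a
  have h4 := hasDerivAt_comp_of_eq (F := E →L[ℝ] E →L[ℝ] ℝ) hq h1 (by rw [h0])
  have h5 := (h4.clm_apply (h2.clm_apply (hasDerivAt_const (0 : ℝ) u))).clm_apply
    (h2.clm_apply (hasDerivAt_const (0 : ℝ) w))
  have h6 := (h3.clm_apply (hasDerivAt_const (0 : ℝ) u)).clm_apply (hasDerivAt_const (0 : ℝ) w)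
  have h7 : (fun t : ℝ => Gp (x + t • a) u w) =ᶠ[𝓝 0] fun t : ℝ =>
      Gq (σ (x + t • a)) (fderiv ℝ σ (x + t • a) u) (fderiv ℝ σ (x + t • a) w) := by
    have : Filter.Tendsto (fun t : ℝ => x + t • a) (𝓝 0) (𝓝 x) := by
      have h : ContinuousAt (fun t : ℝ => x + t • a) 0 := by fun_prop
      have := h.tendsto
      rwa [h0] at this
    exact (this.eventually hpull).mono fun t ht => ht u w
  have h8 := (h5.congr_of_eventuallyEq h7).unique h6
  simp only [h0, map_zero, add_zero, add_apply] at h8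
  rw [← h8]

/-- The transformation law of the Christoffel symbols. -/
theorem vectorChristoffel_transform {Gp Gq : E → E →L[ℝ] E →L[ℝ] ℝ} {σ : E → E} {x : E}
    (hσ : ContDiffAt ℝ ∞ σ x) (hp : DifferentiableAt ℝ Gp x) (hq : DifferentiableAt ℝ Gq (σ x))
    (hpi : (Gp x).IsInvertible) (hqi : (Gq (σ x)).IsInvertible)
    (hs : ∀ u w, Gq (σ x) u w = Gq (σ x) w u) (hσi : (fderiv ℝ σ x).IsInvertible)
    (hpull : ∀ᶠ y in 𝓝 x, ∀ u w, Gp y u w = Gq (σ y) (fderiv ℝ σ y u) (fderiv ℝ σ y w))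
    (u w : E) :
    vectorChristoffel Gq (σ x) (fderiv ℝ σ x u) (fderiv ℝ σ x w) =
      fderiv ℝ σ x (vectorChristoffel Gp x u w) - fderiv ℝ (fderiv ℝ σ) x u w := by
  have hsym : ∀ a b, fderiv ℝ (fderiv ℝ σ) x a b = fderiv ℝ (fderiv ℝ σ) x b a :=
    (hσ.isSymmSndFDerivAt (by simpa using two_le_infty)).eq
  refine hqi.injective ?_
  ext z'
  obtain ⟨z, rfl⟩ := hσi.surjective z'
  have h1 := vectorChristoffel_spec hqi (fderiv ℝ σ x u) (fderiv ℝ σ x w) (fderiv ℝ σ x z)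
  have h2 := vectorChristoffel_spec hpi u w z
  rw [hpull.self_of_nhds, fderiv_pullback hσ hp hq hpull, fderiv_pullback hσ hp hq hpull,
    fderiv_pullback hσ hp hq hpull] at h2
  rw [h1, map_sub, sub_apply, h2, hsym w u, hsym z u, hsym z w, hs (fderiv ℝ (fderiv ℝ σ) x u z),
    hs (fderiv ℝ σ x u)]
  ring

end Christoffel

section Curves
variable {E : Type*} [NormedAddCommGroup E] [NormedSpace ℝ E] [FiniteDimensional ℝ E]
  {Q : Type*} [TopologicalSpace Q] [ChartedSpace E Q] [IsManifold 𝓘(ℝ, E) ∞ Q]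
  {G : MetricField E Q} {U : Set Q}

theorem dchart_velocity {p : Q} {c : ℝ → Q} {t : ℝ} (hc : MDifferentiableAt 𝓘(ℝ, ℝ) 𝓘(ℝ, E) c t)
    (ht : c t ∈ (extChartAt 𝓘(ℝ, E) p).source) :
    dchart 𝓘(ℝ, E) p (c t) (velocity c t) = deriv (fun s => extChartAt 𝓘(ℝ, E) p (c s)) t := by
  have hI : IsManifold 𝓘(ℝ, E) 1 Q := IsManifold.of_le (n := ∞) (by simp)
  have h1 := mfderiv_comp t (mdifferentiableAt_extChartAt (I := 𝓘(ℝ, E)) (by simpa using ht)) hc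
  rw [mfderiv_eq_fderiv] at h1
  have h2 := DFunLike.congr_fun h1 (1 : ℝ)
  rw [← fderiv_apply_one_eq_deriv]
  exact h2.symm

theorem differentiableAt_metricInChart (hG : IsMetricOn G U) {p q : Q} (hq : q ∈ U)
    (hqs : q ∈ (extChartAt 𝓘(ℝ, E) p).source) :
    DifferentiableAt ℝ (metricInChart G p) (extChartAt 𝓘(ℝ, E) p q) := by
  have ho : IsOpen ((extChartAt 𝓘(ℝ, E) p).target ∩ (extChartAt 𝓘(ℝ, E) p).symm ⁻¹' U) :=
    (continuousOn_extChartAt_symm p).isOpen_inter_preimage (isOpen_extChartAt_target p) hG.isOpen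
  refine ((hG.smooth p).contDiffAt (ho.mem_nhds ⟨(extChartAt 𝓘(ℝ, E) p).map_source hqs, ?_⟩)
    ).differentiableAt (by simp)
  rw [mem_preimage, (extChartAt 𝓘(ℝ, E) p).left_inv hqs]
  exact hq

theorem metricInChart_symm (hG : IsMetricOn G U) {p q : Q} (hq : q ∈ U)
    (hqs : q ∈ (extChartAt 𝓘(ℝ, E) p).source) (u w : E) :
    metricInChart G p (extChartAt 𝓘(ℝ, E) p q) u w =
      metricInChart G p (extChartAt 𝓘(ℝ, E) p q) w u := by
  rw [metricInChart_extChartAt G p hqs, metricInChart_extChartAt G p hqs, hG.symm q hq]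

theorem isInvertible_metricInChart (hG : IsMetricOn G U) {p q : Q} (hq : q ∈ U)
    (hqs : q ∈ (extChartAt 𝓘(ℝ, E) p).source) :
    (metricInChart G p (extChartAt 𝓘(ℝ, E) p q)).IsInvertible := by
  refine isInvertible_of_pos _ fun v hv => ?_
  rw [metricInChart_extChartAt G p hqs]
  refine hG.pos q hq _ fun h => hv ?_
  rw [← dchart_inverse_apply hqs v, h, map_zero]

/-- The covariant derivative along a curve, computed in an arbitrary chart. -/
theorem dchart_covDeriv (hG : IsMetricOn G U) {p : Q} {c : ℝ → Q} {t : ℝ}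
    (hc : MDifferentiableAt 𝓘(ℝ, ℝ) 𝓘(ℝ, E) c t) (hU : c t ∈ U)
    (ht : c t ∈ (extChartAt 𝓘(ℝ, E) p).source) {W : ∀ s, TangentSpace 𝓘(ℝ, E) (c s)}
    (hW : DifferentiableAt ℝ (fun s => dchart 𝓘(ℝ, E) p (c s) (W s)) t) :
    dchart 𝓘(ℝ, E) p (c t) (covDeriv G c W t) =
      deriv (fun s => dchart 𝓘(ℝ, E) p (c s) (W s)) t +
        vectorChristoffel (metricInChart G p) (extChartAt 𝓘(ℝ, E) p (c t))
          (deriv (fun s => extChartAt 𝓘(ℝ, E) p (c s)) t) (dchart 𝓘(ℝ, E) p (c t) (W t)) := by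
  set q := c t with hq
  have htq : q ∈ (extChartAt 𝓘(ℝ, E) q).source := mem_extChartAt_source q
  set σ := extChartAt 𝓘(ℝ, E) q ∘ (extChartAt 𝓘(ℝ, E) p).symm with hσ
  set x : ℝ → E := fun s => extChartAt 𝓘(ℝ, E) p (c s) with hx
  have hxt : x t ∈ (extChartAt 𝓘(ℝ, E) p).target := (extChartAt 𝓘(ℝ, E) p).map_source ht
  have hxs : (extChartAt 𝓘(ℝ, E) p).symm (x t) = q := (extChartAt 𝓘(ℝ, E) p).left_inv ht
  have hσx : σ (x t) = extChartAt 𝓘(ℝ, E) q q := by rw [hσ, Function.comp_apply, hxs]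
  have hσs : ContDiffAt ℝ ∞ σ (x t) :=
    contDiffAt_chart_transition q p hxt (by rw [hxs]; exact htq)
  have hdσ : ∀ r : Q, r ∈ (extChartAt 𝓘(ℝ, E) p).source → r ∈ (extChartAt 𝓘(ℝ, E) q).source →
      ∀ v : TangentSpace 𝓘(ℝ, E) r, fderiv ℝ σ (extChartAt 𝓘(ℝ, E) p r) (dchart 𝓘(ℝ, E) p r v) =
        dchart 𝓘(ℝ, E) q r v := fun r hr hr' v => by
    have h1 := fderiv_chart_transition (J := 𝓘(ℝ, E)) q p ((extChartAt 𝓘(ℝ, E) p).map_source hr)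
      (by rw [(extChartAt 𝓘(ℝ, E) p).left_inv hr]; exact hr') (dchart 𝓘(ℝ, E) p r v)
    rw [(extChartAt 𝓘(ℝ, E) p).left_inv hr, inverse_dchart_apply hr] at h1
    exact h1
  have hnear : ∀ᶠ s in 𝓝 t, c s ∈ (extChartAt 𝓘(ℝ, E) p).source ∧
      c s ∈ (extChartAt 𝓘(ℝ, E) q).source := by
    have hcc : ContinuousAt c t := hc.continuousAt
    filter_upwards [hcc.preimage_mem_nhds (extChartAt_source_mem_nhds' ht),
      hcc.preimage_mem_nhds (extChartAt_source_mem_nhds' htq)] with s h1 h2 using ⟨h1, h2⟩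
  -- the components of the field and of the curve in the chart at `c t`
  have hWq : (fun s => dchart 𝓘(ℝ, E) q (c s) (W s)) =ᶠ[𝓝 t]
      fun s => fderiv ℝ σ (x s) (dchart 𝓘(ℝ, E) p (c s) (W s)) :=
    hnear.mono fun s hs => (hdσ (c s) hs.1 hs.2 (W s)).symm
  have hxd : HasDerivAt x (deriv x t) t := by
    have hI : IsManifold 𝓘(ℝ, E) 1 Q := IsManifold.of_le (n := ∞) (by simp)
    have h1 : MDifferentiableAt 𝓘(ℝ, ℝ) 𝓘(ℝ, E) (extChartAt 𝓘(ℝ, E) p ∘ c) t :=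
      (mdifferentiableAt_extChartAt (I := 𝓘(ℝ, E)) (by simpa using ht)).comp t hc
    exact h1.differentiableAt.hasDerivAt
  have hσd : HasFDerivAt σ (fderiv ℝ σ (x t)) (x t) :=
    (hσs.differentiableAt (by simp)).hasFDerivAt
  have hσd2 : HasFDerivAt (fderiv ℝ σ) (fderiv ℝ (fderiv ℝ σ) (x t)) (x t) :=
    ((hσs.fderiv_right (m := 1) (by rw [one_add_one_eq_two]; exact two_le_infty)).differentiableAt
      (by simp)).hasFDerivAt
  have hxq : deriv (fun s => extChartAt 𝓘(ℝ, E) q (c s)) t = fderiv ℝ σ (x t) (deriv x t) := by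
    have h1 := hσd.comp_hasDerivAt t hxd
    refine (h1.congr_of_eventuallyEq (hnear.mono fun s hs => ?_)).deriv
    simp only [hσ, hx, Function.comp_apply, (extChartAt 𝓘(ℝ, E) p).left_inv hs.1]
  have hWqd : deriv (fun s => dchart 𝓘(ℝ, E) q (c s) (W s)) t =
      fderiv ℝ (fderiv ℝ σ) (x t) (deriv x t) (dchart 𝓘(ℝ, E) p (c t) (W t)) +
        fderiv ℝ σ (x t) (deriv (fun s => dchart 𝓘(ℝ, E) p (c s) (W s)) t) :=
    (((hσd2.comp_hasDerivAt t hxd).clm_apply hW.hasDerivAt).congr_of_eventuallyEq hWq).deriv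
  have hcov : covDeriv G c W t = (dchart 𝓘(ℝ, E) q q).inverse
      (deriv (fun s => dchart 𝓘(ℝ, E) q (c s) (W s)) t +
        vectorChristoffel (metricInChart G q) (extChartAt 𝓘(ℝ, E) q q)
          (deriv (fun s => extChartAt 𝓘(ℝ, E) q (c s)) t) (dchart 𝓘(ℝ, E) q (c t) (W t))) := rfl
  have hpull : ∀ᶠ y in 𝓝 (x t), ∀ u w, metricInChart G p y u w =
      metricInChart G q (σ y) (fderiv ℝ σ y u) (fderiv ℝ σ y w) := by
    filter_upwards [eventually_mem_chart_domains q p htq ht] with y hy u w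
    have hys : (extChartAt 𝓘(ℝ, E) p).symm y ∈ (extChartAt 𝓘(ℝ, E) p).source :=
      (extChartAt 𝓘(ℝ, E) p).map_target hy.1
    have hye := (extChartAt 𝓘(ℝ, E) p).right_inv hy.1
    have h1 := metricInChart_extChartAt G p hys u w
    have h2 := hdσ _ hys hy.2
    rw [hye] at h1 h2
    obtain ⟨u', rfl⟩ : ∃ u', dchart 𝓘(ℝ, E) p ((extChartAt 𝓘(ℝ, E) p).symm y) u' = u :=
      ⟨_, dchart_inverse_apply hys u⟩
    obtain ⟨w', rfl⟩ : ∃ w', dchart 𝓘(ℝ, E) p ((extChartAt 𝓘(ℝ, E) p).symm y) w' = w :=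
      ⟨_, dchart_inverse_apply hys w⟩
    rw [h1, h2, h2, inverse_dchart_apply hys, inverse_dchart_apply hys]
    exact (metricInChart_dchart G q hy.2 u' w').symm
  have hσi : (fderiv ℝ σ (x t)).IsInvertible := by
    refine isInvertible_of_injective _ (fun a b hab => ?_) rfl
    have h1 := hdσ q ht htq
    have h2 : ∀ a, fderiv ℝ σ (x t) a = dchart 𝓘(ℝ, E) q q ((dchart 𝓘(ℝ, E) p q).inverse a) :=
      fun a => by
        rw [← h1, dchart_inverse_apply ht]
    rw [h2, h2] at hab
    rw [← dchart_inverse_apply ht a, ← dchart_inverse_apply ht b,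
      (dchart_isInvertible htq).injective hab]
  have htr := vectorChristoffel_transform hσs (differentiableAt_metricInChart hG hU ht)
    (by rw [hσx]; exact differentiableAt_metricInChart hG hU htq)
    (isInvertible_metricInChart hG hU ht)
    (by rw [hσx]; exact isInvertible_metricInChart hG hU htq)
    (by rw [hσx]; exact metricInChart_symm hG hU htq) hσi hpull (deriv x t)
    (dchart 𝓘(ℝ, E) p (c t) (W t))
  rw [hcov, hxq, hWqd, ← hσx, ← hdσ (c t) ht htq (W t)]
  change dchart 𝓘(ℝ, E) p q ((dchart 𝓘(ℝ, E) q q).inverse (_ + vectorChristoffel (metricInChart G q)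
    (σ (x t)) (fderiv ℝ σ (x t) (deriv x t))
      (fderiv ℝ σ (x t) (dchart 𝓘(ℝ, E) p (c t) (W t))))) = _
  rw [htr]
  set z := deriv (fun s => dchart 𝓘(ℝ, E) p (c s) (W s)) t +
        vectorChristoffel (metricInChart G p) (x t) (deriv x t) (dchart 𝓘(ℝ, E) p (c t) (W t)) with hz
  have hfin : fderiv ℝ (fderiv ℝ σ) (x t) (deriv x t) (dchart 𝓘(ℝ, E) p (c t) (W t)) +
        fderiv ℝ σ (x t) (deriv (fun s => dchart 𝓘(ℝ, E) p (c s) (W s)) t) +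
      (fderiv ℝ σ (x t) (vectorChristoffel (metricInChart G p) (x t) (deriv x t)
        (dchart 𝓘(ℝ, E) p (c t) (W t))) - fderiv ℝ (fderiv ℝ σ) (x t) (deriv x t)
          (dchart 𝓘(ℝ, E) p (c t) (W t))) =
      dchart 𝓘(ℝ, E) q q ((dchart 𝓘(ℝ, E) p q).inverse z) := by
    rw [← hdσ q ht htq, dchart_inverse_apply ht, hz, map_add]
    abel
  rw [hfin, inverse_dchart_apply htq, dchart_inverse_apply ht]

end Curves

/-! ### The constraint and the energy along a trajectory -/

set_option synthInstance.maxHeartbeats 200000 in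
theorem vectorChristoffel_zero {E : Type*} [NormedAddCommGroup E] [NormedSpace ℝ E]
    (G : E → E →L[ℝ] E →L[ℝ] ℝ) (y u : E) : vectorChristoffel G y u 0 = 0 := by
  have h : (1 / 2 : ℝ) • (fderiv ℝ G y u 0 + fderiv ℝ G y 0 u -
      ((fderiv ℝ G y).flip u).flip 0) = 0 := by
    ext z
    change (1 / 2 : ℝ) * (fderiv ℝ G y u 0 z + fderiv ℝ G y 0 u z - fderiv ℝ G y z u 0) = 0
    simp only [map_zero, zero_apply]
    ring
  rw [vectorChristoffel, h, map_zero]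

section Trajectories
variable {E : Type*} [NormedAddCommGroup E] [NormedSpace ℝ E] [FiniteDimensional ℝ E]
  {Q : Type*} [TopologicalSpace Q] [ChartedSpace E Q] [IsManifold 𝓘(ℝ, E) ∞ Q]
  {r : ℕ} {G : MetricField E Q} {D : DistField E Q} {U : Set Q} {V : Q → ℝ}
  {c : ℝ → Q} {J : Set ℝ} {t : ℝ} {p : Q}

theorem contDiffAt_chart_curve (hJ : IsOpen J) (hc : ContMDiffOn 𝓘(ℝ, ℝ) 𝓘(ℝ, E) 2 c J)
    (ht : t ∈ J) (hp : c t ∈ (extChartAt 𝓘(ℝ, E) p).source) :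
    ContDiffAt ℝ 2 (fun s => extChartAt 𝓘(ℝ, E) p (c s)) t := by
  have hI : IsManifold 𝓘(ℝ, E) 2 Q := IsManifold.of_le (n := ∞) two_le_infty
  have h1 : ContMDiffAt 𝓘(ℝ, E) 𝓘(ℝ, E) 2 (extChartAt 𝓘(ℝ, E) p) (c t) :=
    contMDiffAt_extChartAt' (by simpa using hp)
  exact (h1.comp t ((hc t ht).contMDiffAt (hJ.mem_nhds ht))).contDiffAt

theorem mdifferentiableAt_curve (hJ : IsOpen J) (hc : ContMDiffOn 𝓘(ℝ, ℝ) 𝓘(ℝ, E) 2 c J)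
    (ht : t ∈ J) : MDifferentiableAt 𝓘(ℝ, ℝ) 𝓘(ℝ, E) c t :=
  ((hc t ht).contMDiffAt (hJ.mem_nhds ht)).mdifferentiableAt (by simp)

theorem eventually_dchart_velocity (hJ : IsOpen J) (hc : ContMDiffOn 𝓘(ℝ, ℝ) 𝓘(ℝ, E) 2 c J)
    (ht : t ∈ J) (hp : c t ∈ (extChartAt 𝓘(ℝ, E) p).source) :
    ∀ᶠ s in 𝓝 t, s ∈ J ∧ c s ∈ (extChartAt 𝓘(ℝ, E) p).source ∧
      dchart 𝓘(ℝ, E) p (c s) (velocity c s) = deriv (fun s => extChartAt 𝓘(ℝ, E) p (c s)) s := by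
  have hcc : ContinuousAt c t := (mdifferentiableAt_curve hJ hc ht).continuousAt
  filter_upwards [hJ.mem_nhds ht, hcc.preimage_mem_nhds (extChartAt_source_mem_nhds' hp)]
    with s h1 h2
  exact ⟨h1, h2, dchart_velocity (mdifferentiableAt_curve hJ hc h1) h2⟩

theorem contDiffAt_deriv {x : ℝ → E} (hx : ContDiffAt ℝ 2 x t) : ContDiffAt ℝ 1 (deriv x) t := by
  have h1 : ContDiffAt ℝ 1 (fderiv ℝ x) t :=
    hx.fderiv_right (m := 1) (by rw [one_add_one_eq_two])
  have h2 : deriv x = fun s => fderiv ℝ x s 1 := by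
    funext s
    rw [fderiv_apply_one_eq_deriv]
  rw [h2]
  exact h1.clm_apply contDiffAt_const

theorem differentiableAt_deriv_chart (hJ : IsOpen J) (hc : ContMDiffOn 𝓘(ℝ, ℝ) 𝓘(ℝ, E) 2 c J)
    (ht : t ∈ J) (hp : c t ∈ (extChartAt 𝓘(ℝ, E) p).source) :
    DifferentiableAt ℝ (deriv fun s => extChartAt 𝓘(ℝ, E) p (c s)) t :=
  (contDiffAt_deriv (contDiffAt_chart_curve hJ hc ht hp)).differentiableAt (by simp)

theorem differentiableAt_dchart_velocity (hJ : IsOpen J)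
    (hc : ContMDiffOn 𝓘(ℝ, ℝ) 𝓘(ℝ, E) 2 c J) (ht : t ∈ J)
    (hp : c t ∈ (extChartAt 𝓘(ℝ, E) p).source) :
    DifferentiableAt ℝ (fun s => dchart 𝓘(ℝ, E) p (c s) (velocity c s)) t :=
  (differentiableAt_deriv_chart hJ hc ht hp).congr_of_eventuallyEq
    ((eventually_dchart_velocity hJ hc ht hp).mono fun _ h => h.2.2)

/-- Compatibility of the Levi-Civita derivative with the metric. -/
theorem hasDerivAt_metric (hG : IsMetricOn G U) (hJ : IsOpen J)
    (hc : ContMDiffOn 𝓘(ℝ, ℝ) 𝓘(ℝ, E) 2 c J) (ht : t ∈ J) (hU : c t ∈ U)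
    {W : ∀ s, TangentSpace 𝓘(ℝ, E) (c s)}
    (hW : DifferentiableAt ℝ (fun s => dchart 𝓘(ℝ, E) (c t) (c s) (W s)) t) :
    HasDerivAt (fun s => G (c s) (W s) (W s)) (2 * G (c t) (covDeriv G c W t) (W t)) t := by
  set p := c t with hp
  have hps : c t ∈ (extChartAt 𝓘(ℝ, E) p).source := mem_extChartAt_source p
  have hcov := dchart_covDeriv hG (mdifferentiableAt_curve hJ hc ht) hU hps hW
  set x : ℝ → E := fun s => extChartAt 𝓘(ℝ, E) p (c s) with hx
  set w : ℝ → E := fun s => dchart 𝓘(ℝ, E) p (c s) (W s) with hw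
  have hxd : HasDerivAt x (deriv x t) t :=
    ((contDiffAt_chart_curve hJ hc ht hps).differentiableAt (by simp)).hasDerivAt
  have hGd := hasDerivAt_comp_of_eq (F := E →L[ℝ] E →L[ℝ] ℝ)
    (differentiableAt_metricInChart hG hU hps) hxd rfl
  have h1 := (hGd.clm_apply hW.hasDerivAt).clm_apply hW.hasDerivAt
  have h2 : (fun s => G (c s) (W s) (W s)) =ᶠ[𝓝 t] fun s => metricInChart G p (x s) (w s) (w s) :=
    (eventually_dchart_velocity hJ hc ht hps).mono fun s hs =>
      (metricInChart_dchart G p hs.2.1 _ _).symm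
  refine (h1.congr_of_eventuallyEq h2).congr_deriv ?_
  have h3 : G (c t) (covDeriv G c W t) (W t) = metricInChart G p (x t) (deriv w t +
      vectorChristoffel (metricInChart G p) (x t) (deriv x t) (w t)) (w t) := by
    rw [← hcov]
    exact (metricInChart_dchart G p hps _ _).symm
  have hi : (metricInChart G p (x t)).IsInvertible := isInvertible_metricInChart hG hU hps
  have hsy : ∀ u v, metricInChart G p (x t) u v = metricInChart G p (x t) v u :=
    metricInChart_symm hG hU hps
  have h4 := vectorChristoffel_spec hi (deriv x t) (w t) (w t)
  rw [h3, map_add, add_apply, add_apply, h4, hsy (w t)]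
  change fderiv ℝ (metricInChart G p) (x t) (deriv x t) (w t) (w t) +
    metricInChart G p (x t) (deriv w t) (w t) + metricInChart G p (x t) (deriv w t) (w t) = _
  ring

theorem eq_of_hasDerivAt_zero {f : ℝ → ℝ} (hJ : IsOpen J) (hJ' : J.OrdConnected)
    (hf : ∀ s ∈ J, HasDerivAt f 0 s) {s t : ℝ} (hs : s ∈ J) (ht : t ∈ J) : f s = f t :=
  hJ.is_const_of_deriv_eq_zero hJ'.isPreconnected
    (fun u hu => (hf u hu).differentiableAt.differentiableWithinAt) (fun u hu => (hf u hu).deriv) hs ht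

/-- The equation of motion at time `t` of a curve that is tangent to the distribution: the
constraint together with the projected Newton equation `P (∇ċ + grad V) = 0`. -/
def IsSolutionAt (G : MetricField E Q) (V : Q → ℝ) (D : DistField E Q) (c : ℝ → Q) (t : ℝ) : Prop :=
  velocity (E := E) c t ∈ D (c t) ∧
    proj G D (c t) (covDeriv G c (velocity c) t + grad G V (c t)) = 0

theorem proj_eq_self (hG : IsMetricOn G U) {q : Q} (hq : q ∈ U) {v : TangentSpace 𝓘(ℝ, E) q}
    (hv : v ∈ D q) : proj G D q v = v :=
  eq_proj hG D hq hv (by rw [sub_self]; exact (orth G D q).zero_mem)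

theorem covDeriv_eq_zero {W : ∀ s, TangentSpace 𝓘(ℝ, E) (c s)} (hW : ∀ᶠ s in 𝓝 t, W s = 0) :
    covDeriv G c W t = 0 := by
  have h0 : W t = 0 := hW.self_of_nhds
  have h1 : (fun s => dchart 𝓘(ℝ, E) (c t) (c s) (W s)) =ᶠ[𝓝 t] fun _ => (0 : E) :=
    hW.mono fun s hs => by simp only [hs, map_zero]
  have hcov : covDeriv G c W t = (dchart 𝓘(ℝ, E) (c t) (c t)).inverse
      (deriv (fun s => dchart 𝓘(ℝ, E) (c t) (c s) (W s)) t +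
        vectorChristoffel (metricInChart G (c t)) (extChartAt 𝓘(ℝ, E) (c t) (c t))
          (deriv (fun s => extChartAt 𝓘(ℝ, E) (c t) (c s)) t)
          (dchart 𝓘(ℝ, E) (c t) (c t) (W t))) := rfl
  rw [hcov, h1.deriv_eq, deriv_const, h0, map_zero, vectorChristoffel_zero, add_zero, map_zero]

theorem velocity_sub_proj_eq_zero {u : ℝ} (hG : IsMetricOn G U) (hu : c u ∈ U)
    (hv : velocity (E := E) c u ∈ D (c u)) :
    velocity (E := E) c u - proj G D (c u) (velocity c u) = 0 := by
  rw [proj_eq_self hG hu hv, sub_self]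

/-- A solution that is tangent to the distribution on an open set satisfies the equation of
`IsTrajectory` there: `P' ċ` vanishes identically, and so does its covariant derivative. -/
theorem IsSolutionAt.nhCovDeriv_eq (hG : IsMetricOn G U) (hJ : IsOpen J) (hU : MapsTo c J U)
    (hs : ∀ s ∈ J, IsSolutionAt G V D c s) (ht : t ∈ J) :
    nhCovDeriv G D c (velocity c) t + proj G D (c t) (grad G V (c t)) = 0 := by
  have h1 : covDeriv G c (fun s => velocity c s - proj G D (c s) (velocity c s)) t = 0 :=
    covDeriv_eq_zero <| by
      filter_upwards [hJ.mem_nhds ht] with s hs'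
      exact velocity_sub_proj_eq_zero hG (hU hs') (hs s hs').1
  rw [nhCovDeriv, h1, add_zero, ← map_add]
  exact (hs t ht).2

/-- The component `w = P' ċ` of the velocity of a trajectory satisfies `∇w ∈ D`, hence has constant
length; as it vanishes initially, the trajectory is tangent to the distribution for all times. -/
theorem IsTrajectory.velocity_mem (hG : IsMetricOn G U) (hD : IsDistribution D r)
    (hT : IsTrajectory G V D U J c) (ht : t ∈ J) : velocity (E := E) c t ∈ D (c t) := by
  set W : ∀ s, TangentSpace 𝓘(ℝ, E) (c s) := fun s =>
    velocity c s - proj G D (c s) (velocity c s) with hW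
  have hd : ∀ s ∈ J, HasDerivAt (fun s => G (c s) (W s) (W s)) 0 s := fun s hs => by
    obtain ⟨m, h0, h⟩ := exists_model hG hD (hT.mapsTo hs)
    have hps := mem_extChartAt_source (I := 𝓘(ℝ, E)) (c s)
    have hx := contDiffAt_chart_curve hT.isOpen hT.contMDiffOn hs hps
    have hO : ∀ᶠ u in 𝓝 s, extChartAt 𝓘(ℝ, E) (c s) (c u) ∈ m.O :=
      hx.continuousAt.preimage_mem_nhds (m.isOpen.mem_nhds h0)
    have hWd : DifferentiableAt ℝ (fun u => dchart 𝓘(ℝ, E) (c s) (c u) (W u)) s := by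
      have h1 : HasDerivAt (fun u => m.P (extChartAt 𝓘(ℝ, E) (c s) (c u)))
          (fderiv ℝ m.P (extChartAt 𝓘(ℝ, E) (c s) (c s))
            (deriv (fun u => extChartAt 𝓘(ℝ, E) (c s) (c u)) s)) s :=
        hasDerivAt_comp_of_eq (CoordModel.hasFDerivAt_P h0).differentiableAt
          (hx.differentiableAt (by simp)).hasDerivAt rfl
      have h2 := (differentiableAt_deriv_chart hT.isOpen hT.contMDiffOn hs hps).hasDerivAt
      refine ((h2.sub (h1.clm_apply h2)).differentiableAt).congr_of_eventuallyEq ?_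
      filter_upwards [eventually_dchart_velocity hT.isOpen hT.contMDiffOn hs hps, hO]
        with u hu huO
      simp only [hW, Pi.sub_apply]
      rw [map_sub, ← h.P_dchart hG hu.2.1 huO, hu.2.2]
    refine (hasDerivAt_metric hG hT.isOpen hT.contMDiffOn hs (hT.mapsTo hs) hWd).congr_deriv ?_
    have h3 := hT.equation s hs
    rw [nhCovDeriv] at h3
    have h4 : covDeriv G c W s = -(proj G D (c s) (covDeriv G c (velocity c) s) +
        proj G D (c s) (grad G V (c s))) := by
      rw [eq_neg_iff_add_eq_zero, ← h3]
      abel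
    have h5 : covDeriv G c W s ∈ D (c s) := by
      rw [h4]
      exact (D (c s)).neg_mem ((D (c s)).add_mem
        (proj_mem_and_sub_mem hG D (hT.mapsTo hs) _).1
        (proj_mem_and_sub_mem hG D (hT.mapsTo hs) _).1)
    have h6 : W s ∈ orth G D (c s) := (proj_mem_and_sub_mem hG D (hT.mapsTo hs) _).2
    rw [h6 _ h5, mul_zero]
  -- the squared length of `W` is constant and vanishes at time `0`
  have h1 := eq_of_hasDerivAt_zero hT.isOpen hT.ordConnected hd ht hT.zero_mem
  have h2 : W 0 = 0 := velocity_sub_proj_eq_zero hG (hT.mapsTo hT.zero_mem) hT.initial_mem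
  simp only [h2, map_zero] at h1
  have h3 : W t = 0 := by
    by_contra h
    exact (hG.pos _ (hT.mapsTo ht) _ h).ne' h1
  rw [sub_eq_zero.1 h3]
  exact (proj_mem_and_sub_mem hG D (hT.mapsTo ht) _).1

theorem IsTrajectory.isSolutionAt (hG : IsMetricOn G U) (hD : IsDistribution D r)
    (hT : IsTrajectory G V D U J c) (ht : t ∈ J) : IsSolutionAt G V D c t := by
  refine ⟨hT.velocity_mem hG hD ht, ?_⟩
  have h1 : covDeriv G c (fun s => velocity c s - proj G D (c s) (velocity c s)) t = 0 :=
    covDeriv_eq_zero <| by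
      filter_upwards [hT.isOpen.mem_nhds ht] with s hs'
      exact velocity_sub_proj_eq_zero hG (hT.mapsTo hs') (hT.velocity_mem hG hD hs')
  have h2 := hT.equation t ht
  rwa [nhCovDeriv, h1, add_zero, ← map_add] at h2

theorem inner_grad (hG : IsMetricOn G U) {q : Q} (hq : q ∈ U) (v : TangentSpace 𝓘(ℝ, E) q) :
    G q (grad G V q) v = mfderiv 𝓘(ℝ, E) 𝓘(ℝ, ℝ) V q v :=
  DFunLike.congr_fun (IsModelAt.sharp_apply hG hq _) v

/-- Conservation of energy. -/
theorem IsTrajectory.energy_eq (hV : ContMDiff 𝓘(ℝ, E) 𝓘(ℝ, ℝ) ∞ V) (hG : IsMetricOn G U)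
    (hD : IsDistribution D r) (hT : IsTrajectory G V D U J c) (ht : t ∈ J) :
    1 / 2 * G (c t) (velocity c t) (velocity c t) + V (c t) =
      1 / 2 * G (c 0) (velocity c 0) (velocity c 0) + V (c 0) := by
  refine eq_of_hasDerivAt_zero
    (f := fun t => 1 / 2 * G (c t) (velocity c t) (velocity c t) + V (c t)) hT.isOpen
    hT.ordConnected (fun s hs => ?_) ht hT.zero_mem
  have hU := hT.mapsTo hs
  have h1 := hasDerivAt_metric hG hT.isOpen hT.contMDiffOn hs hU
    (differentiableAt_dchart_velocity hT.isOpen hT.contMDiffOn hs (mem_extChartAt_source _))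
  have h2 : HasDerivAt (fun s => V (c s)) (G (c s) (grad G V (c s)) (velocity c s)) s := by
    have h3 := mfderiv_comp s (hV.mdifferentiableAt (by simp) (x := c s))
      (mdifferentiableAt_curve hT.isOpen hT.contMDiffOn hs)
    rw [mfderiv_eq_fderiv] at h3
    have h4 := DFunLike.congr_fun h3 (1 : ℝ)
    have h5 : deriv (fun s => V (c s)) s = G (c s) (grad G V (c s)) (velocity c s) := by
      rw [inner_grad hG hU, ← fderiv_apply_one_eq_deriv]
      exact h4
    rw [← h5]
    exact ((hV.mdifferentiableAt (by simp) (x := c s)).comp s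
      (mdifferentiableAt_curve hT.isOpen hT.contMDiffOn hs)).differentiableAt.hasDerivAt
  refine ((h1.const_mul (1 / 2)).add h2).congr_deriv ?_
  obtain ⟨h3, h4⟩ := hT.isSolutionAt hG hD hs
  have h5 := (proj_mem_and_sub_mem hG D hU (covDeriv G c (velocity c) s + grad G V (c s))).2
  rw [h4, sub_zero] at h5
  have h6 := h5 _ h3
  rw [hG.symm _ hU, map_add, add_apply] at h6
  linarith

end Trajectories

/-! ### Uniqueness of trajectories -/

theorem contDiffOn_fderiv_apply {X E F : Type*} [NormedAddCommGroup X] [NormedSpace ℝ X]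
    [NormedAddCommGroup E] [NormedSpace ℝ E] [NormedAddCommGroup F] [NormedSpace ℝ F] {f : E → F}
    {O : Set E} (hO : IsOpen O) (hf : ContDiffOn ℝ ∞ f O) {S : Set X} {b a : X → E}
    (hb : ContDiffOn ℝ ∞ b S) (hbO : MapsTo b S O) (ha : ContDiffOn ℝ ∞ a S) :
    ContDiffOn ℝ ∞ (fun z => fderiv ℝ f (b z) (a z)) S :=
  ((hf.fderiv_of_isOpen hO (m := ∞) (by simp)).comp hb hbO).clm_apply ha

namespace CoordModel
variable {E : Type*} [NormedAddCommGroup E] [NormedSpace ℝ E] [FiniteDimensional ℝ E] {r : ℕ}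
  {m : CoordModel E r}

variable (m) in
/-- The terms of zeroth and first order in Newton's equation `x'' + Γ(x', x') + grad V = 0`. -/
def force (V : E → ℝ) (x v : E) : E :=
  vectorChristoffel m.G x v v + m.sharp x (fderiv ℝ V x)

variable (m) in
/-- The first-order system of the constrained motion in coordinates. -/
def motion (V : E → ℝ) (z : E × E) : E × E :=
  (z.2, fderiv ℝ m.P z.1 z.2 z.2 - m.P z.1 (m.force V z.1 z.2))

set_option synthInstance.maxHeartbeats 200000 in
theorem smooth_force {V : E → ℝ} (hV : ContDiffOn ℝ ∞ V m.O) :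
    ContDiffOn ℝ ∞ (fun z : E × E => m.force V z.1 z.2) (m.O ×ˢ univ) := by
  have hf : MapsTo (Prod.fst : E × E → E) (m.O ×ˢ univ) m.O := fun z hz => hz.1
  have hS : ContDiffOn ℝ ∞ (fun z : E × E => m.sharp z.1) (m.O ×ˢ univ) :=
    (smooth_sharp (m := m)).comp contDiffOn_fst hf
  have hVd : ContDiffOn ℝ ∞ (fun z : E × E => fderiv ℝ V z.1) (m.O ×ˢ univ) :=
    (hV.fderiv_of_isOpen m.isOpen (m := ∞) (by simp)).comp contDiffOn_fst hf
  have hGd : ∀ a : E × E → E, ContDiffOn ℝ ∞ a (m.O ×ˢ univ) →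
      ContDiffOn ℝ ∞ (fun z : E × E => fderiv ℝ m.G z.1 (a z)) (m.O ×ˢ univ) := fun a ha =>
    contDiffOn_fderiv_apply m.isOpen m.smooth_G contDiffOn_fst hf ha
  have hA : ContDiffOn ℝ ∞ (fun z : E × E => (1 / 2 : ℝ) • (fderiv ℝ m.G z.1 z.2 z.2 +
      fderiv ℝ m.G z.1 z.2 z.2 - ((fderiv ℝ m.G z.1).flip z.2).flip z.2)) (m.O ×ˢ univ) := by
    refine contDiffOn_clm_apply.2 fun u => ?_
    change ContDiffOn ℝ ∞ (fun z : E × E => (1 / 2 : ℝ) * (fderiv ℝ m.G z.1 z.2 z.2 u +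
      fderiv ℝ m.G z.1 z.2 z.2 u - fderiv ℝ m.G z.1 u z.2 z.2)) (m.O ×ˢ univ)
    have h1 : ContDiffOn ℝ ∞ (fun z : E × E => fderiv ℝ m.G z.1 z.2 z.2 u) (m.O ×ˢ univ) :=
      ((hGd _ contDiffOn_snd).clm_apply contDiffOn_snd).clm_apply contDiffOn_const
    have h2 : ContDiffOn ℝ ∞ (fun z : E × E => fderiv ℝ m.G z.1 u z.2 z.2) (m.O ×ˢ univ) :=
      ((hGd _ contDiffOn_const).clm_apply contDiffOn_snd).clm_apply contDiffOn_snd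
    exact contDiffOn_const.mul ((h1.add h1).sub h2)
  exact (hS.clm_apply hA).add (hS.clm_apply hVd)

theorem smooth_motion {V : E → ℝ} (hV : ContDiffOn ℝ ∞ V m.O) :
    ContDiffOn ℝ ∞ (m.motion V) (m.O ×ˢ univ) := by
  have hf : MapsTo (Prod.fst : E × E → E) (m.O ×ˢ univ) m.O := fun z hz => hz.1
  have hP : ContDiffOn ℝ ∞ (fun z : E × E => m.P z.1) (m.O ×ˢ univ) :=
    (smooth_P (m := m)).comp contDiffOn_fst hf
  have hPd : ContDiffOn ℝ ∞ (fun z : E × E => fderiv ℝ m.P z.1) (m.O ×ˢ univ) :=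
    (smooth_fderiv_P (m := m)).comp contDiffOn_fst hf
  exact contDiffOn_snd.prodMk (((hPd.clm_apply contDiffOn_snd).clm_apply contDiffOn_snd).sub
    (hP.clm_apply (smooth_force hV)))

/-- Differentiating the constraint `P x' = x'` turns the projected Newton equation into a
first-order system. -/
theorem hasDerivAt_motion {V : E → ℝ} {x : ℝ → E} {t : ℝ} (hx : ContDiffAt ℝ 2 x t)
    (hO : x t ∈ m.O) (hc : ∀ᶠ s in 𝓝 t, m.P (x s) (deriv x s) = deriv x s)
    (he : m.P (x t) (deriv (deriv x) t + m.force V (x t) (deriv x t)) = 0) :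
    HasDerivAt (fun s => (x s, deriv x s)) (m.motion V (x t, deriv x t)) t := by
  have h1 := (hx.differentiableAt (by simp)).hasDerivAt
  have h2 := ((contDiffAt_deriv hx).differentiableAt (by simp)).hasDerivAt
  have h3 := (hasDerivAt_comp_of_eq (hasFDerivAt_P hO).differentiableAt h1 rfl).clm_apply h2
  have h4 := h3.unique (h2.congr_of_eventuallyEq hc)
  refine (h1.prodMk h2).congr_deriv ?_
  rw [map_add] at he
  rw [motion, ← h4]
  refine Prod.ext rfl ?_
  change fderiv ℝ m.P (x t) (deriv x t) (deriv x t) + m.P (x t) (deriv (deriv x) t) =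
    fderiv ℝ m.P (x t) (deriv x t) (deriv x t) - m.P (x t) (m.force V (x t) (deriv x t))
  rw [eq_neg_of_add_eq_zero_left he, sub_eq_add_neg]

end CoordModel

section Uniqueness
variable {E : Type*} [NormedAddCommGroup E] [NormedSpace ℝ E] [FiniteDimensional ℝ E]
  {Q : Type*} [TopologicalSpace Q] [ChartedSpace E Q] [IsManifold 𝓘(ℝ, E) ∞ Q]
  {r : ℕ} {m : CoordModel E r} {G : MetricField E Q} {D : DistField E Q} {U : Set Q} {V : Q → ℝ}
  {c : ℝ → Q} {J : Set ℝ} {t : ℝ} {p : Q}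

/-- The differential of a function, read in a chart. -/
theorem covec_mfderiv (hV : ContMDiff 𝓘(ℝ, E) 𝓘(ℝ, ℝ) ∞ V) {q : Q}
    (hq : q ∈ (extChartAt 𝓘(ℝ, E) p).source) :
    covec p (mfderiv 𝓘(ℝ, E) 𝓘(ℝ, ℝ) V q) =
      fderiv ℝ (inChart V p) (extChartAt 𝓘(ℝ, E) p q) := by
  have hI : IsManifold 𝓘(ℝ, E) 1 Q := IsManifold.of_le (n := ∞) (by simp)
  have hd : DifferentiableAt ℝ (inChart V p) (extChartAt 𝓘(ℝ, E) p q) :=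
    ((contDiffOn_comp_extChartAt_symm hV p).contDiffAt ((isOpen_extChartAt_target p).mem_nhds
      ((extChartAt 𝓘(ℝ, E) p).map_source hq))).differentiableAt (by simp)
  have h1 := mfderiv_comp q (I' := 𝓘(ℝ, E)) (I'' := 𝓘(ℝ, ℝ)) (g := inChart V p)
    hd.mdifferentiableAt (mdifferentiableAt_extChartAt (I := 𝓘(ℝ, E)) (x := p) (by simpa using hq))
  have h2 : inChart V p ∘ extChartAt 𝓘(ℝ, E) p =ᶠ[𝓝 q] V := by
    filter_upwards [extChartAt_source_mem_nhds' hq] with y hy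
    rw [Function.comp_apply, inChart, (extChartAt 𝓘(ℝ, E) p).left_inv hy]
  rw [h2.mfderiv_eq, mfderiv_eq_fderiv] at h1
  ext u
  have h3 := DFunLike.congr_fun h1 ((dchart 𝓘(ℝ, E) p q).inverse u)
  refine h3.trans ?_
  change fderiv ℝ (inChart V p) (extChartAt 𝓘(ℝ, E) p q)
    (dchart 𝓘(ℝ, E) p q ((dchart 𝓘(ℝ, E) p q).inverse u)) = _
  rw [dchart_inverse_apply hq]

/-- The equation of motion in an arbitrary chart. -/
theorem isSolutionAt_iff_chart (hV : ContMDiff 𝓘(ℝ, E) 𝓘(ℝ, ℝ) ∞ V) (hG : IsMetricOn G U)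
    (h : IsModelAt m G D U p) (hJ : IsOpen J) (hc : ContMDiffOn 𝓘(ℝ, ℝ) 𝓘(ℝ, E) 2 c J)
    (ht : t ∈ J) (hp : c t ∈ (extChartAt 𝓘(ℝ, E) p).source)
    (hO : extChartAt 𝓘(ℝ, E) p (c t) ∈ m.O) {x : ℝ → E}
    (hx : x = fun s => extChartAt 𝓘(ℝ, E) p (c s)) :
    IsSolutionAt G V D c t ↔ m.P (x t) (deriv x t) = deriv x t ∧
      m.P (x t) (deriv (deriv x) t + m.force (inChart V p) (x t) (deriv x t)) = 0 := by
  have hU := h.mem_U hp hO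
  have hmd := mdifferentiableAt_curve hJ hc ht
  have hv : dchart 𝓘(ℝ, E) p (c t) (velocity c t) = deriv x t := by
    rw [hx]
    exact dchart_velocity hmd hp
  have hxt : x t = extChartAt 𝓘(ℝ, E) p (c t) := by rw [hx]
  have hcov := dchart_covDeriv hG hmd hU hp (differentiableAt_dchart_velocity hJ hc ht hp)
  have hev : (fun s => dchart 𝓘(ℝ, E) p (c s) (velocity c s)) =ᶠ[𝓝 t] deriv x := by
    rw [hx]
    exact (eventually_dchart_velocity hJ hc ht hp).mono fun s hs => hs.2.2
  rw [hev.deriv_eq, hv, ← hx, ← hxt, ← h.G_eq] at hcov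
  have hgr : dchart 𝓘(ℝ, E) p (c t) (grad G V (c t)) =
      m.sharp (x t) (fderiv ℝ (inChart V p) (x t)) := by
    have h1 := h.dchart_sharp hG hp hO (mfderiv 𝓘(ℝ, E) 𝓘(ℝ, ℝ) V (c t))
    rw [hxt]
    exact h1.trans (congrArg _ (covec_mfderiv hV hp))
  have hinj := (dchart_isInvertible (J := 𝓘(ℝ, E)) hp).injective
  refine and_congr ?_ ?_
  · rw [h.mem_D_iff hp hO, hv, hxt]
  · rw [← hinj.eq_iff, map_zero, ← h.P_dchart hG hp hO, ContinuousLinearMap.map_add, hcov, hgr, hxt,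
      CoordModel.force, add_assoc]

/-- Two solutions with the same position and velocity at time `t` agree near `t`, as both solve the
first-order system `motion` in the chart. -/
theorem solution_unique_local (hV : ContMDiff 𝓘(ℝ, E) 𝓘(ℝ, ℝ) ∞ V) (hG : IsMetricOn G U)
    (hD : IsDistribution D r) {c₁ c₂ : ℝ → Q} (hJ : IsOpen J)
    (hc₁ : ContMDiffOn 𝓘(ℝ, ℝ) 𝓘(ℝ, E) 2 c₁ J) (hc₂ : ContMDiffOn 𝓘(ℝ, ℝ) 𝓘(ℝ, E) 2 c₂ J)
    (hU : MapsTo c₁ J U)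
    (hs₁ : ∀ s ∈ J, IsSolutionAt G V D c₁ s) (hs₂ : ∀ s ∈ J, IsSolutionAt G V D c₂ s)
    (ht : t ∈ J) (h0 : c₁ t = c₂ t)
    (hd : deriv (fun s => extChartAt 𝓘(ℝ, E) (c₁ t) (c₁ s)) t =
      deriv (fun s => extChartAt 𝓘(ℝ, E) (c₁ t) (c₂ s)) t) : c₁ =ᶠ[𝓝 t] c₂ := by
  set p := c₁ t with hp
  obtain ⟨m, hm0, h⟩ := exists_model hG hD (hU ht)
  have hps : p ∈ (extChartAt 𝓘(ℝ, E) p).source := mem_extChartAt_source p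
  have key : ∀ c : ℝ → Q, ContMDiffOn 𝓘(ℝ, ℝ) 𝓘(ℝ, E) 2 c J → (∀ s ∈ J, IsSolutionAt G V D c s) →
      c t = p → ∀ S ∈ 𝓝 (extChartAt 𝓘(ℝ, E) p p,
        deriv (fun s => extChartAt 𝓘(ℝ, E) p (c s)) t), ∀ᶠ s in 𝓝 t,
      c s ∈ (extChartAt 𝓘(ℝ, E) p).source ∧
      HasDerivAt (fun s => (extChartAt 𝓘(ℝ, E) p (c s),
        deriv (fun s => extChartAt 𝓘(ℝ, E) p (c s)) s)) (m.motion (inChart V p)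
          (extChartAt 𝓘(ℝ, E) p (c s), deriv (fun s => extChartAt 𝓘(ℝ, E) p (c s)) s)) s ∧
      (extChartAt 𝓘(ℝ, E) p (c s), deriv (fun s => extChartAt 𝓘(ℝ, E) p (c s)) s) ∈ S := by
    intro c hc hs hct S hS
    have hps' : c t ∈ (extChartAt 𝓘(ℝ, E) p).source := by rw [hct]; exact hps
    set x : ℝ → E := fun s => extChartAt 𝓘(ℝ, E) p (c s) with hx
    have hxc := contDiffAt_chart_curve hJ hc ht hps'
    have hxt : x t = extChartAt 𝓘(ℝ, E) p p := by rw [hx, ← hct]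
    have hO : ∀ᶠ s in 𝓝 t, x s ∈ m.O :=
      hxc.continuousAt.preimage_mem_nhds (m.isOpen.mem_nhds (by
        change x t ∈ m.O
        rw [hxt]; exact hm0))
    have hall : ∀ᶠ s in 𝓝 t, s ∈ J ∧ c s ∈ (extChartAt 𝓘(ℝ, E) p).source ∧ x s ∈ m.O := by
      filter_upwards [eventually_dchart_velocity hJ hc ht hps', hO] with s h1 h2
      exact ⟨h1.1, h1.2.1, h2⟩
    have hcont : ContinuousAt (fun s => (x s, deriv x s)) t :=
      hxc.continuousAt.prodMk (contDiffAt_deriv hxc).continuousAt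
    have hS' : ∀ᶠ s in 𝓝 t, (x s, deriv x s) ∈ S :=
      hcont.preimage_mem_nhds (by rw [hxt]; exact hS)
    have hch : ∀ s, s ∈ J ∧ c s ∈ (extChartAt 𝓘(ℝ, E) p).source ∧ x s ∈ m.O →
        m.P (x s) (deriv x s) = deriv x s ∧
        m.P (x s) (deriv (deriv x) s + m.force (inChart V p) (x s) (deriv x s)) = 0 :=
      fun s hs' => (isSolutionAt_iff_chart hV hG h hJ hc hs'.1 hs'.2.1 hs'.2.2 hx).1 (hs s hs'.1)
    filter_upwards [hall.eventually_nhds, hS'] with s h1 h2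
    have h3 := h1.self_of_nhds
    refine ⟨h3.2.1, CoordModel.hasDerivAt_motion (contDiffAt_chart_curve hJ hc h3.1 h3.2.1) h3.2.2
      (h1.mono fun u hu => (hch u hu).1) (hch s h3).2, h2⟩
  have hmot : ContDiffAt ℝ 1 (m.motion (inChart V p)) (extChartAt 𝓘(ℝ, E) p p,
      deriv (fun s => extChartAt 𝓘(ℝ, E) p (c₁ s)) t) :=
    ((CoordModel.smooth_motion (contDiffOn_inChart hV h)).contDiffAt
      ((m.isOpen.prod isOpen_univ).mem_nhds ⟨hm0, trivial⟩)).of_le (by simp)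
  obtain ⟨K, S, hS, hK⟩ := hmot.exists_lipschitzOnWith
  have k1 := key c₁ hc₁ hs₁ rfl S hS
  have k2 := key c₂ hc₂ hs₂ h0.symm S (by rw [← hd]; exact hS)
  have huniq := ODE_solution_unique_of_eventually (v := fun _ => m.motion (inChart V p))
    (s := fun _ => S) (Filter.Eventually.of_forall fun _ => hK) (k1.mono fun s hs => hs.2)
    (k2.mono fun s hs => hs.2) (by
      refine Prod.ext ?_ hd
      change extChartAt 𝓘(ℝ, E) p (c₁ t) = extChartAt 𝓘(ℝ, E) p (c₂ t)
      rw [← h0])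
  filter_upwards [huniq, k1, k2] with s h1 h2 h3
  exact (extChartAt 𝓘(ℝ, E) p).injOn h2.1 h3.1 (congrArg Prod.fst h1)

/-- The set of times near which two solutions agree is open, and it is closed in `J` because `Q` is
Hausdorff and the velocities are continuous. -/
theorem solution_unique [T2Space Q] (hV : ContMDiff 𝓘(ℝ, E) 𝓘(ℝ, ℝ) ∞ V) (hG : IsMetricOn G U)
    (hD : IsDistribution D r) {c₁ c₂ : ℝ → Q} (hJ : IsOpen J) (hJ' : J.OrdConnected)
    (hc₁ : ContMDiffOn 𝓘(ℝ, ℝ) 𝓘(ℝ, E) 2 c₁ J) (hc₂ : ContMDiffOn 𝓘(ℝ, ℝ) 𝓘(ℝ, E) 2 c₂ J)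
    (hU : MapsTo c₁ J U)
    (hs₁ : ∀ s ∈ J, IsSolutionAt G V D c₁ s) (hs₂ : ∀ s ∈ J, IsSolutionAt G V D c₂ s)
    (h0 : (0 : ℝ) ∈ J) (hi : (⟨c₁ 0, velocity c₁ 0⟩ : TangentBundle 𝓘(ℝ, E) Q) =
      ⟨c₂ 0, velocity c₂ 0⟩) : EqOn c₁ c₂ J := by
  have hloc : ∀ t ∈ J, c₁ t = c₂ t → deriv (fun s => extChartAt 𝓘(ℝ, E) (c₁ t) (c₁ s)) t =
      deriv (fun s => extChartAt 𝓘(ℝ, E) (c₁ t) (c₂ s)) t → c₁ =ᶠ[𝓝 t] c₂ := fun t ht =>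
    solution_unique_local hV hG hD hJ hc₁ hc₂ hU hs₁ hs₂ ht
  set S : Set ℝ := {t | t ∈ J ∧ c₁ =ᶠ[𝓝 t] c₂} with hS
  have hSo : IsOpen S := hJ.inter isOpen_setOfPred_eventually_nhds
  have h0S : (0 : ℝ) ∈ S := by
    refine ⟨h0, hloc 0 h0 (congrArg TotalSpace.proj hi) ?_⟩
    have hp : c₁ 0 ∈ (extChartAt 𝓘(ℝ, E) (c₁ 0)).source := mem_extChartAt_source _
    have h1 : c₁ 0 = c₂ 0 := congrArg TotalSpace.proj hi
    have hp' : c₂ 0 ∈ (extChartAt 𝓘(ℝ, E) (c₁ 0)).source := by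
      rw [← h1]
      exact hp
    rw [← dchart_velocity (mdifferentiableAt_curve hJ hc₁ h0) hp,
      ← dchart_velocity (mdifferentiableAt_curve hJ hc₂ h0) hp']
    exact congrArg (fun w : TangentBundle 𝓘(ℝ, E) Q => dchart 𝓘(ℝ, E) (c₁ 0) w.proj w.snd) hi
  have hcl : closure S ∩ J ⊆ S := by
    rintro t ⟨htS, htJ⟩
    refine ⟨htJ, ?_⟩
    have hf : ∃ᶠ s in 𝓝 t, s ∈ S := mem_closure_iff_frequently.1 htS
    have hc1 := (mdifferentiableAt_curve hJ hc₁ htJ).continuousAt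
    have hc2 := (mdifferentiableAt_curve hJ hc₂ htJ).continuousAt
    have heq : c₁ t = c₂ t :=
      tendsto_nhds_unique_of_frequently_eq hc1 hc2 (hf.mono fun s hs => hs.2.self_of_nhds)
    have hp : c₁ t ∈ (extChartAt 𝓘(ℝ, E) (c₁ t)).source := mem_extChartAt_source _
    have hp' : c₂ t ∈ (extChartAt 𝓘(ℝ, E) (c₁ t)).source := by
      rw [← heq]
      exact hp
    have hd1 := (contDiffAt_deriv (contDiffAt_chart_curve hJ hc₁ htJ hp)).continuousAt
    have hd2 := (contDiffAt_deriv (contDiffAt_chart_curve hJ hc₂ htJ hp')).continuousAt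
    exact hloc t htJ heq (tendsto_nhds_unique_of_frequently_eq hd1 hd2 (hf.mono fun s hs =>
      (hs.2.fun_comp (extChartAt 𝓘(ℝ, E) (c₁ t))).deriv_eq))
  exact fun t ht => (hJ'.isPreconnected.subset_of_closure_inter_subset hSo ⟨0, h0, h0S⟩ hcl
    ht).2.self_of_nhds

end Uniqueness

/-! ### The time change in coordinates -/

theorem fderiv_smul_apply {E F : Type*} [NormedAddCommGroup E] [NormedSpace ℝ E]
    [NormedAddCommGroup F] [NormedSpace ℝ F] {f : E → ℝ} {g : E → F} {x : E}
    (hf : DifferentiableAt ℝ f x) (hg : DifferentiableAt ℝ g x) (u : E) :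
    fderiv ℝ (fun y => f y • g y) x u = f x • fderiv ℝ g x u + fderiv ℝ f x u • g x := by
  have h : fderiv ℝ (fun y => f y • g y) x = _ := (hf.hasFDerivAt.smul hg.hasFDerivAt).fderiv
  rw [h]
  rfl

set_option synthInstance.maxHeartbeats 200000 in
/-- The relation between the Christoffel symbols of a metric and of its Jacobi metric, along a
velocity `v` of total energy `e`, reparametrized by the factor `a = 1 / (e - W)`. -/
theorem CoordModel.force_jacobi {E : Type*} [NormedAddCommGroup E] [NormedSpace ℝ E]
    [FiniteDimensional ℝ E] {r : ℕ} {m me : CoordModel E r} {W : E → ℝ} {e a : ℝ} {x v : E}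
    (hx : x ∈ m.O) (hx' : x ∈ me.O) (hG : me.G = fun y => (e - W y) • m.G y)
    (hW : DifferentiableAt ℝ W x) (ha : a * (e - W x) = 1) (hv : m.G x v v = 2 * (e - W x)) :
    me.force (fun _ => 0) x (a • v) = a ^ 2 • m.force W x v - (a ^ 3 * fderiv ℝ W x v) • v := by
  have hGd : DifferentiableAt ℝ m.G x :=
    (m.smooth_G.contDiffAt (m.isOpen.mem_nhds hx)).differentiableAt (by simp)
  have hfd : DifferentiableAt ℝ (fun y => e - W y) x := hW.const_sub e
  have hdf : ∀ u, fderiv ℝ (fun y => e - W y) x u = - fderiv ℝ W x u := fun u => by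
    rw [fderiv_const_sub]
    rfl
  have hdG : ∀ u z w, fderiv ℝ me.G x u z w =
      (e - W x) * fderiv ℝ m.G x u z w - fderiv ℝ W x u * m.G x z w := fun u z w => by
    have h1 := congrArg (fun L : E →L[ℝ] E →L[ℝ] ℝ => L z w) (fderiv_smul_apply hfd hGd u)
    rw [hG]
    refine h1.trans ?_
    change (e - W x) * fderiv ℝ m.G x u z w + fderiv ℝ (fun y => e - W y) x u * m.G x z w = _
    rw [hdf]
    ring
  have hGx : ∀ z w, me.G x z w = (e - W x) * m.G x z w := fun z w => by
    rw [hG]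
    rfl
  refine CoordModel.eq_of_G_eq hx' fun w => ?_
  have hf0 : me.force (fun _ => 0) x (a • v) = vectorChristoffel me.G x (a • v) (a • v) := by
    rw [CoordModel.force]
    simp
  rw [hf0, vectorChristoffel_spec (isInvertible_G hx'), hGx, hdG, hdG]
  have h1 := vectorChristoffel_spec (isInvertible_G hx) v v w
  have h2 := G_sharp hx (fderiv ℝ W x) w
  rw [CoordModel.force]
  simp only [map_smul, map_sub, map_add, smul_apply, sub_apply, add_apply,
    smul_eq_mul, h1, h2, hv]
  set dv := fderiv ℝ W x v
  set dw := fderiv ℝ W x w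
  set g := m.G x v w
  set k := fderiv ℝ m.G x v v w
  set l := fderiv ℝ m.G x w v v
  set q := e - W x
  have h3 : a ^ 3 * q = a ^ 2 := by linear_combination a ^ 2 * ha
  linear_combination dv * g * h3

/-- The second derivative of a reparametrized curve. -/
theorem deriv_deriv_comp {E : Type*} [NormedAddCommGroup E] [NormedSpace ℝ E]
    [FiniteDimensional ℝ E] {x y : ℝ → E}
    {k κ : ℝ → ℝ} {κ' t : ℝ} (hx : ContDiffAt ℝ 2 x (k t)) (hκ : HasDerivAt κ κ' t)
    (hk : ∀ᶠ u in 𝓝 t, HasDerivAt k (κ u) u) (hy : y =ᶠ[𝓝 t] fun u => x (k u)) :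
    deriv y t = κ t • deriv x (k t) ∧
      deriv (deriv y) t = κ' • deriv x (k t) + κ t ^ 2 • deriv (deriv x) (k t) := by
  have hkc : ContinuousAt k t := hk.self_of_nhds.continuousAt
  have hx1 : ∀ᶠ s in 𝓝 (k t), ContDiffAt ℝ 2 x s := hx.eventually (by simp)
  have h1 : deriv y =ᶠ[𝓝 t] fun u => κ u • deriv x (k u) := by
    filter_upwards [hk, hkc.eventually hx1, hy.eventuallyEq_nhds] with u h1 h2 h3
    rw [h3.deriv_eq]
    exact ((h2.differentiableAt (by simp)).hasDerivAt.scomp u h1).deriv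
  refine ⟨h1.self_of_nhds, ?_⟩
  have h2 := (contDiffAt_deriv hx).differentiableAt (by simp)
  rw [h1.deriv_eq]
  have h3 := (hκ.smul (h2.hasDerivAt.scomp t hk.self_of_nhds)).deriv
  refine h3.trans ?_
  rw [smul_smul, add_comm, sq]
  rfl

section Reparametrization
variable {E : Type*} [NormedAddCommGroup E] [NormedSpace ℝ E] [FiniteDimensional ℝ E]
  {Q : Type*} [TopologicalSpace Q] [ChartedSpace E Q] [IsManifold 𝓘(ℝ, E) ∞ Q]
  {r : ℕ} {G : MetricField E Q} {D : DistField E Q} {U : Set Q} {V : Q → ℝ} {e : ℝ}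
  {J I : Set ℝ} {t : ℝ}

theorem proj_jacobi {q : Q} (hq : q ∈ region V e) : proj (jacobi G V e) D q = proj G D q := by
  unfold proj
  rw [orth_jacobi hq]

/-- At energy `e`, the time change `ds/dt = 1 / (e - V)` turns solutions for `(g, V)` into solutions
for the Jacobi metric, and conversely. -/
theorem isSolutionAt_jacobi_iff (hV : ContMDiff 𝓘(ℝ, E) 𝓘(ℝ, ℝ) ∞ V)
    (hG : IsMetricOn G (region V e)) (hGe : IsMetricOn (jacobi G V e) (region V e))
    (hD : IsDistribution D r) (hJ : IsOpen J) (hI : IsOpen I) {c₁ c₂ : ℝ → Q} {k : ℝ → ℝ}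
    (hc₁ : ContMDiffOn 𝓘(ℝ, ℝ) 𝓘(ℝ, E) 2 c₁ J) (hc₂ : ContMDiffOn 𝓘(ℝ, ℝ) 𝓘(ℝ, E) 2 c₂ I)
    (hkJ : MapsTo k I J) (hk : ∀ u ∈ I, HasDerivAt k (e - V (c₂ u))⁻¹ u)
    (hck : ∀ u ∈ I, c₂ u = c₁ (k u)) (ht : t ∈ I) (hU : c₁ (k t) ∈ region V e)
    (hen : G (c₁ (k t)) (velocity c₁ (k t)) (velocity c₁ (k t)) = 2 * (e - V (c₁ (k t)))) :
    IsSolutionAt G V D c₁ (k t) ↔ IsSolutionAt (jacobi G V e) (fun _ => 0) D c₂ t := by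
  set p := c₁ (k t) with hp
  have hps : c₁ (k t) ∈ (extChartAt 𝓘(ℝ, E) p).source := mem_extChartAt_source p
  have hps₂ : c₂ t ∈ (extChartAt 𝓘(ℝ, E) p).source := by rw [hck t ht]; exact hps
  obtain ⟨m, hm0, h⟩ := exists_model hG hD hU
  obtain ⟨me, hme0, he⟩ := exists_model hGe hD hU
  set x₁ : ℝ → E := fun s => extChartAt 𝓘(ℝ, E) p (c₁ s) with hx₁
  set x₂ : ℝ → E := fun s => extChartAt 𝓘(ℝ, E) p (c₂ s) with hx₂
  have hx₁t : x₁ (k t) = extChartAt 𝓘(ℝ, E) p p := rfl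
  have hx₂t : x₂ t = extChartAt 𝓘(ℝ, E) p p := by rw [hx₂, ← hx₁t]; simp only [hck t ht, hx₁]
  rw [isSolutionAt_iff_chart hV hG h hJ hc₁ (hkJ ht) hps (by exact hm0) hx₁,
    isSolutionAt_iff_chart contMDiff_const hGe he hI hc₂ ht hps₂
      (by rw [hck t ht]; exact hme0) hx₂]
  set a := (e - V p)⁻¹ with ha
  have hne : e - V p ≠ 0 := (sub_pos.2 hU).ne'
  have hVd : DifferentiableAt ℝ (inChart V p) (extChartAt 𝓘(ℝ, E) p p) :=
    ((contDiffOn_comp_extChartAt_symm hV p).contDiffAt ((isOpen_extChartAt_target p).mem_nhds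
      ((extChartAt 𝓘(ℝ, E) p).map_source hps))).differentiableAt (by simp)
  have hVp : inChart V p (extChartAt 𝓘(ℝ, E) p p) = V p := by
    rw [inChart, (extChartAt 𝓘(ℝ, E) p).left_inv hps]
  have hP : ∀ w, me.P (extChartAt 𝓘(ℝ, E) p p) w = m.P (extChartAt 𝓘(ℝ, E) p p) w := fun w => by
    rw [← dchart_inverse_apply (J := 𝓘(ℝ, E)) hps w, h.P_dchart hG hps hm0,
      he.P_dchart hGe hps hme0, proj_jacobi hU]
  have hx₂d := (contDiffAt_chart_curve hI hc₂ ht hps₂).differentiableAt (by simp)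
  have hκ0 := ((hasDerivAt_comp_of_eq hVd hx₂d.hasDerivAt hx₂t).const_sub e).inv
    (by rw [hck t ht, ← hp, hVp]; exact hne)
  have hκ : HasDerivAt (fun u => (e - V (c₂ u))⁻¹)
      (a ^ 2 * fderiv ℝ (inChart V p) (extChartAt 𝓘(ℝ, E) p p) (deriv x₂ t)) t := by
    refine (hκ0.congr_of_eventuallyEq ?_).congr_deriv ?_
    · filter_upwards [eventually_dchart_velocity hI hc₂ ht hps₂] with u hu
      simp only [Pi.inv_apply, inChart, (extChartAt 𝓘(ℝ, E) p).left_inv hu.2.1]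
    · rw [hck t ht, ← hp, hVp, neg_neg, div_eq_mul_inv, ha, inv_pow, mul_comm]
  have hc₂p : c₂ t = p := hck t ht
  obtain ⟨h1, h2⟩ := deriv_deriv_comp (x := x₁) (y := x₂)
    (contDiffAt_chart_curve hJ hc₁ (hkJ ht) hps) hκ
    (by filter_upwards [hI.mem_nhds ht] with u hu using hk u hu)
    (by filter_upwards [hI.mem_nhds ht] with u hu; simp only [hx₁, hx₂, hck u hu])
  have h1' : deriv x₂ t = a • deriv x₁ (k t) := by rw [h1, hc₂p]
  have h2' : deriv (deriv x₂) t + me.force (inChart (fun _ => 0) p) (x₂ t) (deriv x₂ t) =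
      a ^ 2 • (deriv (deriv x₁) (k t) + m.force (inChart V p) (x₁ (k t)) (deriv x₁ (k t))) := by
    have hv := dchart_velocity (mdifferentiableAt_curve hJ hc₁ (hkJ ht)) hps
    have h3 := CoordModel.force_jacobi (m := m) (me := me) (W := inChart V p) (e := e) (a := a)
      (v := deriv x₁ (k t)) hm0 hme0 (by rw [h.G_eq, he.G_eq]; rfl) hVd
      (by rw [hVp, ha, inv_mul_cancel₀ hne])
      (by rw [hVp, ← hen, ← h.G_dchart hps, hv])
    have h4 : (inChart (fun _ : Q => (0 : ℝ)) p : E → ℝ) = fun _ => 0 := rfl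
    rw [h2, hx₂t, hc₂p, h4, h1', h3, hx₁t, map_smul, smul_eq_mul]
    module
  have ha0 : a ≠ 0 := inv_ne_zero hne
  rw [h2', hx₂t, h1', hx₁t, hP, hP, map_smul, map_smul]
  refine and_congr (smul_right_injective E ha0).eq_iff.symm ?_
  rw [smul_eq_zero_iff_right (pow_ne_zero 2 ha0)]

end Reparametrization

/-! ### Reparametrized trajectories -/

/-- Existence of the time change with a given positive rate `f`, together with its inverse. -/
theorem exists_time_change {J : Set ℝ} (hJ : IsOpen J) (hJ' : J.OrdConnected) (h0 : (0 : ℝ) ∈ J)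
    {f : ℝ → ℝ} (hf : ContinuousOn f J) (hpos : ∀ s ∈ J, 0 < f s) :
    ∃ h k : ℝ → ℝ, h 0 = 0 ∧ (∀ s ∈ J, HasDerivAt h (f s) s) ∧ StrictMonoOn h J ∧
      IsOpen (h '' J) ∧ (h '' J).OrdConnected ∧ (∀ s ∈ J, k (h s) = s) ∧
      ∀ s ∈ J, HasDerivAt k (f s)⁻¹ (h s) := by
  set h : ℝ → ℝ := fun s => ∫ x in (0 : ℝ)..s, f x with hh
  have hd : ∀ s ∈ J, HasDerivAt h (f s) s := fun s hs =>
    intervalIntegral.integral_hasDerivAt_right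
      ((hf.mono (hJ'.uIcc_subset h0 hs)).intervalIntegrable)
      (hf.stronglyMeasurableAtFilter hJ s hs) (hf.continuousAt (hJ.mem_nhds hs))
  have hc : ContinuousOn h J := fun s hs => (hd s hs).continuousAt.continuousWithinAt
  have hmono : StrictMonoOn h J := by
    refine strictMonoOn_of_deriv_pos hJ'.convex hc fun s hs => ?_
    rw [hJ.interior_eq] at hs
    rw [(hd s hs).deriv]
    exact hpos s hs
  have hstrict : ∀ s ∈ J, HasStrictDerivAt h (f s) s := fun s hs =>
    hasStrictDerivAt_of_hasDerivAt_of_continuousAt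
      (by filter_upwards [hJ.mem_nhds hs] with u hu using hd u hu)
      (hf.continuousAt (hJ.mem_nhds hs))
  have hinv : ∀ s ∈ J, Function.invFunOn h J (h s) = s := fun s hs =>
    hmono.injOn.leftInvOn_invFunOn hs
  refine ⟨h, Function.invFunOn h J, by simp [hh], hd, hmono, ?_,
    (hJ'.isPreconnected.image h hc).ordConnected, hinv, fun s hs => ?_⟩
  · rw [isOpen_iff_mem_nhds]
    rintro _ ⟨s, hs, rfl⟩
    rw [← (hstrict s hs).map_nhds_eq (hpos s hs).ne']
    exact Filter.image_mem_map (hJ.mem_nhds hs)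
  · exact ((hstrict s hs).to_local_left_inverse (hpos s hs).ne'
      (by filter_upwards [hJ.mem_nhds hs] with u hu using hinv u hu)).hasDerivAt

/-- A solution of an autonomous scalar equation `k' = g (k)` gains one derivative at each step. -/
theorem contDiffOn_two_of_hasDerivAt {I J : Set ℝ} {g k : ℝ → ℝ} (hI : IsOpen I)
    (hk : ∀ t ∈ I, HasDerivAt k (g (k t)) t) (hkJ : MapsTo k I J) (hg : ContDiffOn ℝ 1 g J) :
    ContDiffOn ℝ 2 k I := by
  have hd : DifferentiableOn ℝ k I := fun t ht => (hk t ht).differentiableAt.differentiableWithinAt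
  have he : EqOn (deriv k) (fun t => g (k t)) I := fun t ht => (hk t ht).deriv
  have h1 : ContDiffOn ℝ 1 k I := by
    have := (contDiffOn_succ_iff_deriv_of_isOpen (n := 0) (f := k) hI).2 ⟨hd, by simp,
      contDiffOn_zero.2 (ContinuousOn.congr (hg.continuousOn.comp hd.continuousOn hkJ) he)⟩
    simpa using this
  have := (contDiffOn_succ_iff_deriv_of_isOpen (n := 1) (f := k) hI).2 ⟨hd, by simp,
    (hg.comp h1 hkJ).congr he⟩
  rwa [one_add_one_eq_two] at this

section Curves
variable {E : Type*} [NormedAddCommGroup E] [NormedSpace ℝ E] [FiniteDimensional ℝ E]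
  {Q : Type*} [TopologicalSpace Q] [ChartedSpace E Q] [IsManifold 𝓘(ℝ, E) ∞ Q]
  {r : ℕ} {G : MetricField E Q} {D : DistField E Q} {U : Set Q} {V : Q → ℝ} {e : ℝ}
  {J I : Set ℝ} {t : ℝ} {c c' : ℝ → Q}

theorem velocity_comp {k : ℝ → ℝ} {a : ℝ} (hc : MDifferentiableAt 𝓘(ℝ, ℝ) 𝓘(ℝ, E) c (k t))
    (hk : HasDerivAt k a t) : velocity (E := E) (fun u => c (k u)) t = a • velocity c (k t) := by
  have h1 := mfderiv_comp t (g := c) hc hk.differentiableAt.mdifferentiableAt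
  have h2 := DFunLike.congr_fun h1 (1 : ℝ)
  refine h2.trans ?_
  have h3 : mfderiv 𝓘(ℝ, ℝ) 𝓘(ℝ, ℝ) k t (1 : ℝ) = a • (1 : ℝ) := by
    rw [mfderiv_eq_fderiv]
    exact (fderiv_apply_one_eq_deriv.trans hk.deriv).trans (mul_one a).symm
  refine (congrArg (mfderiv 𝓘(ℝ, ℝ) 𝓘(ℝ, E) c (k t)) h3).trans ?_
  exact map_smul _ _ _

theorem isTrajectory_of_isSolutionAt (hG : IsMetricOn G U) (hJ : IsOpen J) (hJ' : J.OrdConnected)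
    (h0 : (0 : ℝ) ∈ J) (hc : ContMDiffOn 𝓘(ℝ, ℝ) 𝓘(ℝ, E) 2 c J) (hU : MapsTo c J U)
    (hs : ∀ s ∈ J, IsSolutionAt G V D c s) : IsTrajectory G V D U J c :=
  ⟨hJ, hJ', h0, hc, hU, (hs 0 h0).1, fun _ ht => IsSolutionAt.nhCovDeriv_eq hG hJ hU hs ht⟩

/-- The equation of motion depends only on the germ of the curve. -/
theorem IsSolutionAt.congr (hV : ContMDiff 𝓘(ℝ, E) 𝓘(ℝ, ℝ) ∞ V) (hG : IsMetricOn G U)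
    (hD : IsDistribution D r) (hJ : IsOpen J) (hc : ContMDiffOn 𝓘(ℝ, ℝ) 𝓘(ℝ, E) 2 c J)
    (hcc : EqOn c' c J) (ht : t ∈ J) (hU : c t ∈ U) (hs : IsSolutionAt G V D c t) :
    IsSolutionAt G V D c' t := by
  obtain ⟨m, hm, h⟩ := exists_model hG hD hU
  have hps : c t ∈ (extChartAt 𝓘(ℝ, E) (c t)).source := mem_extChartAt_source _
  have hx : (fun s => extChartAt 𝓘(ℝ, E) (c t) (c' s)) =ᶠ[𝓝 t]
      fun s => extChartAt 𝓘(ℝ, E) (c t) (c s) := by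
    filter_upwards [hJ.mem_nhds ht] with s hs
    rw [hcc hs]
  rw [isSolutionAt_iff_chart hV hG h hJ (hc.congr fun s hs => hcc hs) ht (by rw [hcc ht]; exact hps)
    (by rw [hcc ht]; exact hm) rfl]
  rw [isSolutionAt_iff_chart hV hG h hJ hc ht hps hm rfl] at hs
  rw [hx.deriv_eq, hx.deriv.deriv_eq, hcc ht]
  exact hs

open Classical in
/-- Two trajectories with the same initial velocity have a common extension. -/
theorem IsTrajectory.exists_union [T2Space Q] (hV : ContMDiff 𝓘(ℝ, E) 𝓘(ℝ, ℝ) ∞ V)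
    (hG : IsMetricOn G U) (hD : IsDistribution D r) {c₁ c₂ : ℝ → Q} {J₁ J₂ : Set ℝ}
    (hT₁ : IsTrajectory G V D U J₁ c₁) (hT₂ : IsTrajectory G V D U J₂ c₂)
    (hi : (⟨c₁ 0, velocity c₁ 0⟩ : TangentBundle 𝓘(ℝ, E) Q) = ⟨c₂ 0, velocity c₂ 0⟩) :
    ∃ c, IsTrajectory G V D U (J₁ ∪ J₂) c ∧ EqOn c c₁ J₁ ∧ EqOn c c₂ J₂ := by
  have hs₁ := fun s (hs : s ∈ J₁) => hT₁.isSolutionAt hG hD hs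
  have hs₂ := fun s (hs : s ∈ J₂) => hT₂.isSolutionAt hG hD hs
  have heq : EqOn c₁ c₂ (J₁ ∩ J₂) :=
    solution_unique hV hG hD (hT₁.isOpen.inter hT₂.isOpen)
      (hT₁.ordConnected.inter hT₂.ordConnected) (hT₁.contMDiffOn.mono inter_subset_left)
      (hT₂.contMDiffOn.mono inter_subset_right) (hT₁.mapsTo.mono_left inter_subset_left)
      (fun s hs => hs₁ s hs.1) (fun s hs => hs₂ s hs.2) ⟨hT₁.zero_mem, hT₂.zero_mem⟩ hi
  have h1 : EqOn (J₁.piecewise c₁ c₂) c₁ J₁ := fun s hs => piecewise_eq_of_mem _ _ _ hs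
  have h2 : EqOn (J₁.piecewise c₁ c₂) c₂ J₂ := fun s hs => by
    by_cases h : s ∈ J₁
    · rw [h1 h, heq ⟨h, hs⟩]
    · exact piecewise_eq_of_notMem _ _ _ h
  have hc1 := hT₁.contMDiffOn.congr fun s hs => h1 hs
  have hc2 := hT₂.contMDiffOn.congr fun s hs => h2 hs
  refine ⟨_, isTrajectory_of_isSolutionAt hG (hT₁.isOpen.union hT₂.isOpen)
    (hT₁.ordConnected.isPreconnected.union 0 hT₁.zero_mem hT₂.zero_mem
      hT₂.ordConnected.isPreconnected).ordConnected (Or.inl hT₁.zero_mem) ?_ ?_ ?_, h1, h2⟩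
  · exact hc1.union_of_isOpen hc2 hT₁.isOpen hT₂.isOpen
  · rintro s (hs | hs)
    · rw [h1 hs]; exact hT₁.mapsTo hs
    · rw [h2 hs]; exact hT₂.mapsTo hs
  · rintro s (hs | hs)
    · exact IsSolutionAt.congr hV hG hD hT₁.isOpen hT₁.contMDiffOn h1 hs (hT₁.mapsTo hs) (hs₁ s hs)
    · exact IsSolutionAt.congr hV hG hD hT₂.isOpen hT₂.contMDiffOn h2 hs (hT₂.mapsTo hs) (hs₂ s hs)

/-- A maximal trajectory is defined wherever a trajectory with the same initial velocity is. -/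
theorem IsMaximalTrajectory.subset [T2Space Q] (hV : ContMDiff 𝓘(ℝ, E) 𝓘(ℝ, ℝ) ∞ V)
    (hG : IsMetricOn G U) (hD : IsDistribution D r) {c₁ c₂ : ℝ → Q} {J₁ J₂ : Set ℝ}
    (hT₁ : IsMaximalTrajectory G V D U J₁ c₁) (hT₂ : IsTrajectory G V D U J₂ c₂)
    (hi : (⟨c₁ 0, velocity c₁ 0⟩ : TangentBundle 𝓘(ℝ, E) Q) = ⟨c₂ 0, velocity c₂ 0⟩) :
    J₂ ⊆ J₁ := by
  obtain ⟨c, hc, h1, -⟩ := hT₁.1.exists_union hV hG hD hT₂ hi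
  rw [← hT₁.2 _ c hc subset_union_left h1]
  exact subset_union_right

theorem IsTrajectory.eqOn_inter [T2Space Q] (hV : ContMDiff 𝓘(ℝ, E) 𝓘(ℝ, ℝ) ∞ V)
    (hG : IsMetricOn G U) (hD : IsDistribution D r) {c₁ c₂ : ℝ → Q} {J₁ J₂ : Set ℝ}
    (hT₁ : IsTrajectory G V D U J₁ c₁) (hT₂ : IsTrajectory G V D U J₂ c₂)
    (hi : (⟨c₁ 0, velocity c₁ 0⟩ : TangentBundle 𝓘(ℝ, E) Q) = ⟨c₂ 0, velocity c₂ 0⟩) :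
    EqOn c₁ c₂ (J₁ ∩ J₂) := by
  obtain ⟨c, -, h1, h2⟩ := hT₁.exists_union hV hG hD hT₂ hi
  exact fun s hs => (h1 hs.1).symm.trans (h2 hs.2)

theorem contDiffOn_energy_comp (hV : ContMDiff 𝓘(ℝ, E) 𝓘(ℝ, ℝ) ∞ V)
    (hc : ContMDiffOn 𝓘(ℝ, ℝ) 𝓘(ℝ, E) 2 c J) : ContDiffOn ℝ 2 (fun s => e - V (c s)) J :=
  contDiffOn_const.sub (contMDiffOn_iff_contDiffOn.1
    ((hV.of_le two_le_infty).comp_contMDiffOn hc))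

/-- A trajectory of `(g, V)` of energy `e`, with the new time `h = ∫ (e - V)`, is a trajectory of
the Jacobi metric. -/
theorem IsTrajectory.exists_jacobi (hV : ContMDiff 𝓘(ℝ, E) 𝓘(ℝ, ℝ) ∞ V)
    (hG : IsMetricOn G (region V e)) (hGe : IsMetricOn (jacobi G V e) (region V e))
    (hD : IsDistribution D r) (hT : IsTrajectory G V D (region V e) J c)
    (hen : G (c 0) (velocity c 0) (velocity c 0) = 2 * (e - V (c 0))) :
    ∃ h k : ℝ → ℝ, h 0 = 0 ∧ (∀ s ∈ J, HasDerivAt h (e - V (c s)) s) ∧ StrictMonoOn h J ∧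
      (∀ s ∈ J, k (h s) = s) ∧
      IsTrajectory (jacobi G V e) (fun _ => 0) D (region V e) (h '' J) (fun t => c (k t)) ∧
      velocity (E := E) (fun t => c (k t)) 0 = (e - V (c 0))⁻¹ • velocity c (k 0) := by
  have hpos : ∀ s ∈ J, 0 < e - V (c s) := fun s hs => sub_pos.2 (hT.mapsTo hs)
  have hf : ContDiffOn ℝ 2 (fun s => e - V (c s)) J := contDiffOn_energy_comp hV hT.contMDiffOn
  obtain ⟨h, k, h0, hd, hmono, ho, hoc, hk, hkd⟩ := exists_time_change hT.isOpen hT.ordConnected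
    hT.zero_mem hf.continuousOn hpos
  have hkJ : MapsTo k (h '' J) J := by
    rintro _ ⟨s, hs, rfl⟩
    rw [hk s hs]
    exact hs
  have hkd' : ∀ t ∈ h '' J, HasDerivAt k (e - V (c (k t)))⁻¹ t := by
    rintro _ ⟨s, hs, rfl⟩
    rw [hk s hs]
    exact hkd s hs
  have hk2 : ContDiffOn ℝ 2 k (h '' J) :=
    contDiffOn_two_of_hasDerivAt (g := fun s => (e - V (c s))⁻¹) ho hkd' hkJ
      ((hf.inv fun s hs => (hpos s hs).ne').of_le (by simp))
  have hc2 : ContMDiffOn 𝓘(ℝ, ℝ) 𝓘(ℝ, E) 2 (fun t => c (k t)) (h '' J) :=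
    hT.contMDiffOn.comp (contMDiffOn_iff_contDiffOn.2 hk2) hkJ
  have h0J : (0 : ℝ) ∈ h '' J := ⟨0, hT.zero_mem, h0⟩
  have hk0 : k 0 = 0 := by
    have := hk 0 hT.zero_mem
    rwa [h0] at this
  refine ⟨h, k, h0, hd, hmono, hk, isTrajectory_of_isSolutionAt hGe ho hoc h0J hc2
    (hT.mapsTo.comp hkJ) fun t ht => ?_, ?_⟩
  · refine (isSolutionAt_jacobi_iff hV hG hGe hD hT.isOpen ho hT.contMDiffOn hc2 hkJ hkd'
      (fun _ _ => rfl) ht (hT.mapsTo (hkJ ht)) ?_).1 (hT.isSolutionAt hG hD (hkJ ht))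
    have := hT.energy_eq hV hG hD (hkJ ht)
    linarith
  · have h1 := hkd' 0 h0J
    rw [hk0] at h1
    have h2 : MDifferentiableAt 𝓘(ℝ, ℝ) 𝓘(ℝ, E) c (k 0) :=
      mdifferentiableAt_curve hT.isOpen hT.contMDiffOn (hkJ h0J)
    exact velocity_comp h2 h1

/-- A trajectory of the Jacobi metric with energy `1`, with the new time `k = ∫ (e - V)⁻¹`, is a
trajectory of `(g, V)` of energy `e`. -/
theorem IsTrajectory.exists_of_jacobi (hV : ContMDiff 𝓘(ℝ, E) 𝓘(ℝ, ℝ) ∞ V)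
    (hG : IsMetricOn G (region V e)) (hGe : IsMetricOn (jacobi G V e) (region V e))
    (hD : IsDistribution D r) (hT : IsTrajectory (jacobi G V e) (fun _ => 0) D (region V e) I c)
    (hen : jacobi G V e (c 0) (velocity c 0) (velocity c 0) = 2) :
    ∃ k h : ℝ → ℝ, k 0 = 0 ∧ h 0 = 0 ∧
      (∀ s ∈ k '' I, HasDerivAt h (e - V (c (h s))) s) ∧
      (∀ t ∈ I, h (k t) = t) ∧
      IsTrajectory G V D (region V e) (k '' I) (fun s => c (h s)) ∧
      velocity (E := E) (fun s => c (h s)) 0 = (e - V (c 0)) • velocity c (h 0) := by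
  have hpos : ∀ s ∈ I, 0 < e - V (c s) := fun s hs => sub_pos.2 (hT.mapsTo hs)
  have hf : ContDiffOn ℝ 2 (fun s => e - V (c s)) I := contDiffOn_energy_comp hV hT.contMDiffOn
  obtain ⟨k, h, k0, hd, -, ho, hoc, hh, hhd⟩ := exists_time_change hT.isOpen hT.ordConnected
    hT.zero_mem (f := fun s => (e - V (c s))⁻¹) (hf.continuousOn.inv₀ fun s hs => (hpos s hs).ne')
    fun s hs => inv_pos.2 (hpos s hs)
  simp only [inv_inv] at hhd
  have hhI : MapsTo h (k '' I) I := by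
    rintro _ ⟨s, hs, rfl⟩
    rw [hh s hs]
    exact hs
  have hhd' : ∀ s ∈ k '' I, HasDerivAt h (e - V (c (h s))) s := by
    rintro _ ⟨s, hs, rfl⟩
    rw [hh s hs]
    exact hhd s hs
  have hh2 : ContDiffOn ℝ 2 h (k '' I) :=
    contDiffOn_two_of_hasDerivAt (g := fun s => e - V (c s)) ho hhd' hhI (hf.of_le (by simp))
  have hc2 : ContMDiffOn 𝓘(ℝ, ℝ) 𝓘(ℝ, E) 2 (fun s => c (h s)) (k '' I) :=
    hT.contMDiffOn.comp (contMDiffOn_iff_contDiffOn.2 hh2) hhI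
  have h0I : (0 : ℝ) ∈ k '' I := ⟨0, hT.zero_mem, k0⟩
  have hh0 : h 0 = 0 := by
    have := hh 0 hT.zero_mem
    rwa [k0] at this
  have hvel : ∀ s ∈ k '' I, velocity (E := E) (fun s => c (h s)) s =
      (e - V (c (h s))) • velocity c (h s) := fun s hs =>
    velocity_comp (mdifferentiableAt_curve hT.isOpen hT.contMDiffOn (hhI hs)) (hhd' s hs)
  refine ⟨k, h, k0, hh0, hhd', hh, isTrajectory_of_isSolutionAt hG ho hoc h0I hc2
    (hT.mapsTo.comp hhI) ?_, ?_⟩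
  · rintro _ ⟨t, ht, rfl⟩
    refine (isSolutionAt_jacobi_iff hV hG hGe hD ho hT.isOpen hc2 hT.contMDiffOn
      (fun t ht => ⟨t, ht, rfl⟩) hd (fun u hu => by rw [hh u hu]) ht
      (hT.mapsTo (hhI ⟨t, ht, rfl⟩)) ?_).2 (hT.isSolutionAt hGe hD ht)
    have h1 := hT.energy_eq contMDiff_const hGe hD (hhI ⟨t, ht, rfl⟩)
    rw [hen, jacobi_apply] at h1
    rw [hvel _ ⟨t, ht, rfl⟩, map_smul, map_smul, smul_apply, smul_eq_mul, smul_eq_mul]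
    linear_combination 2 * (e - V (c (h (k t)))) * h1
  · rw [hvel 0 h0I, hh0]

end Curves

/-! ### The Maupertuis–Jacobi principle -/

section TimeChange
variable {E : Type*} [NormedAddCommGroup E] [NormedSpace ℝ E] [FiniteDimensional ℝ E]
  {Q : Type*} [TopologicalSpace Q] [ChartedSpace E Q] [IsManifold 𝓘(ℝ, E) ∞ Q]
  {r : ℕ} {G : MetricField E Q} {D : DistField E Q} {V : Q → ℝ} {e : ℝ}
  {J I : Set ℝ}

theorem IsMetricOn.mono {U U' : Set Q} (hG : IsMetricOn G U) (hU : IsOpen U') (h : U' ⊆ U) :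
    IsMetricOn G U' :=
  ⟨hU, fun q hq => hG.symm q (h hq), fun q hq => hG.pos q (h hq),
    fun p => (hG.smooth p).mono fun _ hy => ⟨hy.1, h hy.2⟩⟩

theorem inner_smul_self {q : Q} {v : TangentSpace 𝓘(ℝ, E) q} (hv : 0 < G q v v) {b : ℝ}
    (hb : 0 ≤ b) : G q ((√b / gNorm G q v) • v) ((√b / gNorm G q v) • v) = b := by
  have hn : gNorm G q v ≠ 0 := (Real.sqrt_pos.2 hv).ne'
  have h1 : gNorm G q v ^ 2 = G q v v := Real.sq_sqrt hv.le
  rw [map_smul, map_smul, smul_apply, smul_eq_mul, smul_eq_mul, ← h1]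
  field_simp
  exact Real.sq_sqrt hb

theorem HasInitialVelocity.proj_eq {c : ℝ → Q} {q : Q} {v : TangentSpace 𝓘(ℝ, E) q}
    (h : HasInitialVelocity c q v) : c 0 = q := congrArg TotalSpace.proj h

theorem HasInitialVelocity.inner_eq {c : ℝ → Q} {q : Q} {v : TangentSpace 𝓘(ℝ, E) q}
    (h : HasInitialVelocity c q v) (G : MetricField E Q) :
    G (c 0) (velocity c 0) (velocity c 0) = G q v v :=
  congrArg (fun w : TangentBundle 𝓘(ℝ, E) Q => G w.proj w.snd w.snd) h

theorem HasInitialVelocity.smul {c : ℝ → Q} {q : Q} {v : TangentSpace 𝓘(ℝ, E) q}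
    (h : HasInitialVelocity c q v) (f : Q → ℝ) :
    (⟨c 0, f (c 0) • velocity c 0⟩ : TangentBundle 𝓘(ℝ, E) Q) = ⟨q, f q • v⟩ :=
  congrArg (fun w : TangentBundle 𝓘(ℝ, E) Q =>
    (⟨w.proj, f w.proj • w.snd⟩ : TangentBundle 𝓘(ℝ, E) Q)) h

theorem mk_smul_velocity {c : ℝ → Q} {s t a : ℝ} (h : s = t) :
    (⟨c s, a • velocity c s⟩ : TangentBundle 𝓘(ℝ, E) Q) = ⟨c t, a • velocity c t⟩ := by
  rw [h]

/-- The Maupertuis–Jacobi principle: the trajectories of energy `e` are, up to the time change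
`dh/ds = e - V`, the trajectories of the Jacobi metric of kinetic energy `1`. -/
theorem exists_jacobi_time_change [T2Space Q] (hV : ContMDiff 𝓘(ℝ, E) 𝓘(ℝ, ℝ) ∞ V)
    (hG : IsMetricOn G (region V e)) (hGe : IsMetricOn (jacobi G V e) (region V e))
    (hD : IsDistribution D r) {q : Q} (hq : q ∈ region V e) {v : TangentSpace 𝓘(ℝ, E) q}
    (hv : v ≠ 0) {cP cQ : ℝ → Q} (hP : IsTrajectory G V D (region V e) J cP)
    (hPi : HasInitialVelocity cP q ((√(2 * (e - V q)) / gNorm G q v) • v))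
    (hQ : IsTrajectory (jacobi G V e) (fun _ => 0) D (region V e) I cQ)
    (hQi : HasInitialVelocity cQ q ((√(2 / (e - V q)) / gNorm G q v) • v)) :
    ∃ h : ℝ → ℝ, h 0 = 0 ∧ StrictMonoOn h J ∧ (∀ s ∈ J, HasDerivAt h (e - V (cP s)) s) ∧
      (∀ s ∈ J, h s ∈ I → cP s = cQ (h s)) ∧
      (IsMaximalTrajectory (jacobi G V e) (fun _ => 0) D (region V e) I cQ → MapsTo h J I) ∧
      (IsMaximalTrajectory G V D (region V e) J cP → I ⊆ h '' J) := by
  have hl : 0 < e - V q := sub_pos.2 hq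
  have hvp := hG.pos q hq v hv
  have hen : G (cP 0) (velocity cP 0) (velocity cP 0) = 2 * (e - V (cP 0)) := by
    rw [hPi.inner_eq, inner_smul_self hvp (by positivity), hPi.proj_eq]
  have hen' : jacobi G V e (cQ 0) (velocity cQ 0) (velocity cQ 0) = 2 := by
    rw [hQi.inner_eq, jacobi_apply, inner_smul_self hvp (by positivity)]
    field_simp
  -- the two initial velocities differ by the factor `e - V q`
  have hsq : √(2 * (e - V q)) = (e - V q) * √(2 / (e - V q)) := by
    rw [← Real.sqrt_sq hl.le, ← Real.sqrt_mul (sq_nonneg _), Real.sqrt_sq hl.le]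
    congr 1
    field_simp
  obtain ⟨h, k, h0, hd, hmono, hk, hT, hvel⟩ := hP.exists_jacobi hV hG hGe hD hen
  have hk0 : k 0 = 0 := by
    have := hk 0 hP.zero_mem
    rwa [h0] at this
  have hi : (⟨cQ 0, velocity cQ 0⟩ : TangentBundle 𝓘(ℝ, E) Q) =
      ⟨cP (k 0), velocity (fun t => cP (k t)) 0⟩ := by
    rw [hvel, mk_smul_velocity hk0, hPi.smul fun x => (e - V x)⁻¹]
    refine hQi.trans (congrArg _ ?_)
    rw [smul_smul, hsq, mul_div_assoc, inv_mul_cancel_left₀ hl.ne']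
  refine ⟨h, h0, hmono, hd, fun s hs hsI => ?_, fun hmax s hs => ?_, fun hmax t ht => ?_⟩
  · have := hQ.eqOn_inter contMDiff_const hGe hD hT hi ⟨hsI, s, hs, rfl⟩
    simp only [hk s hs] at this
    exact this.symm
  · exact hmax.subset contMDiff_const hGe hD hT hi ⟨s, hs, rfl⟩
  -- the time change of `cQ` gives a trajectory of `(g, V)`, hence its interval is contained in `J`
  · obtain ⟨k', h', k0, h0', hd', hh', hT', hvel'⟩ := hQ.exists_of_jacobi hV hG hGe hD hen'
    have hi' : (⟨cP 0, velocity cP 0⟩ : TangentBundle 𝓘(ℝ, E) Q) =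
        ⟨cQ (h' 0), velocity (fun t => cQ (h' t)) 0⟩ := by
      rw [hvel', mk_smul_velocity h0', hQi.smul fun x => e - V x]
      refine hPi.trans (congrArg _ ?_)
      rw [smul_smul, hsq, mul_div_assoc]
    have hsub : k' '' I ⊆ J := hmax.subset hV hG hD hT' hi'
    have heq := hP.eqOn_inter hV hG hD hT' hi'
    -- both time changes solve the same equation on the interval `k' '' I`
    have hhh : h (k' t) - h' (k' t) = h 0 - h' 0 :=
      eq_of_hasDerivAt_zero (f := fun s => h s - h' s) hT'.isOpen hT'.ordConnected (fun s hs => by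
        refine ((hd s (hsub hs)).sub (hd' s hs)).congr_deriv ?_
        have h1 : cP s = cQ (h' s) := heq ⟨hsub hs, hs⟩
        rw [h1, sub_self]) ⟨t, ht, rfl⟩ hT'.zero_mem
    refine ⟨k' t, hsub ⟨t, ht, rfl⟩, ?_⟩
    rw [h0, h0', hh' t ht, sub_self] at hhh
    exact sub_eq_zero.1 hhh

end TimeChange

end Nonholonomic

end

open Nonholonomic in
theorem theorem4p1
    {E : Type*} [NormedAddCommGroup E] [NormedSpace ℝ E] [FiniteDimensional ℝ E]
    {Q : Type*} [TopologicalSpace Q] [T2Space Q] [ChartedSpace E Q] [IsManifold 𝓘(ℝ, E) ∞ Q]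
    (g : ContMDiffRiemannianMetric 𝓘(ℝ, E) ∞ E (fun q : Q => TangentSpace 𝓘(ℝ, E) q))
    (V : Q → ℝ) (hV : ContMDiff 𝓘(ℝ, E) 𝓘(ℝ, ℝ) ∞ V)
    (D : DistField E Q) (r : ℕ) (hD : IsDistribution D r) (e : ℝ) :
    -- the level set
    (sphereSet g.inner V D e =
        {α | α ∈ dualDistE g.inner V D e ∧ hamiltonian g.inner V α = e} ∧
      sphereSet g.inner V D e =
        {α | α ∈ dualDistE g.inner V D e ∧
          jacobiHamiltonian g.inner V e α = 1} ∧
      (∀ α ∈ sphereSet g.inner V D e,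
        (∀ Y ∈ nhTangent D (dualDistE g.inner V D e) α,
          differential (hamiltonian g.inner V) α Y =
            (e - V α.proj) * differential (jacobiHamiltonian g.inner V e) α Y) ∧
        (∃ Y ∈ nhTangent D (dualDistE g.inner V D e) α,
          differential (hamiltonian g.inner V) α Y ≠ 0 ∧
          differential (jacobiHamiltonian g.inner V e) α Y ≠ 0)) ∧
      IsSubmanifoldOfCodim (cotModel E) (sphereSet g.inner V D e)
        (dualDistE g.inner V D e) 1 ∧
      (∀ α ∈ sphereSet g.inner V D e,
        tangentSet (cotModel E) (sphereSet g.inner V D e) α =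
          {X | X ∈ tangentSet (cotModel E) (dualDistE g.inner V D e) α ∧
            differential (hamiltonian g.inner V) α X = 0} ∧
        tangentSet (cotModel E) (sphereSet g.inner V D e) α =
          {X | X ∈ tangentSet (cotModel E) (dualDistE g.inner V D e) α ∧
            differential (jacobiHamiltonian g.inner V e) α X = 0}) ∧
      IsSphereBundle (cotModel E) 𝓘(ℝ, E) (fun α : Cotangent E Q => α.proj)
        (sphereSet g.inner V D e) (region V e) r ∧
      (∀ q ∈ region V e, ∀ α : TangentSpace 𝓘(ℝ, E) q →L[ℝ] ℝ,
        (⟨q, α⟩ : Cotangent E Q) ∈ sphereSet g.inner V D e ↔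
          (∀ v ∈ orth g.inner D q, α v = 0) ∧
            √(cometric g.inner q α α) = √(2 * (e - V q)))) ∧
    -- the contact bundle, its Reeb section, and the Hamiltonian fields
    (IsContactBundle (cotModel E) (sphereSet g.inner V D e) (contactBundle g.inner V D e)
        thetaE omegaE (r - 1) ∧
      ∃ X Xe : ∀ α : Cotangent E Q, TangentSpace (cotModel E) α,
        IsNHHamiltonianField D (dualDist g.inner D univ) (hamiltonian g.inner V) X ∧
        (∀ X', IsNHHamiltonianField D (dualDist g.inner D univ) (hamiltonian g.inner V) X' →
          ∀ α ∈ dualDist g.inner D univ, X' α = X α) ∧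
        IsNHHamiltonianField D (dualDistE g.inner V D e)
          (jacobiHamiltonian g.inner V e) Xe ∧
        (∀ X', IsNHHamiltonianField D (dualDistE g.inner V D e)
            (jacobiHamiltonian g.inner V e) X' →
          ∀ α ∈ dualDistE g.inner V D e, X' α = Xe α) ∧
        IsReebSection (cotModel E) (sphereSet g.inner V D e) (contactBundle g.inner V D e)
          thetaE omegaE Xe ∧
        ∀ Re : ∀ α : Cotangent E Q, TangentSpace (cotModel E) α,
          IsReebSection (cotModel E) (sphereSet g.inner V D e) (contactBundle g.inner V D e)
            thetaE omegaE Re →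
          ∀ α ∈ sphereSet g.inner V D e, Re α = Xe α ∧ (e - V α.proj) • Re α = X α) ∧
    -- the trajectories
    (∀ q ∈ region V e, ∀ v ∈ D q, v ≠ 0 → ∀ (J I : Set ℝ) (cP cQ : ℝ → Q),
      IsTrajectory g.inner V D (region V e) J cP →
      HasInitialVelocity cP q ((√(2 * (e - V q)) / gNorm g.inner q v) • v) →
      IsTrajectory (jacobi g.inner V e) (fun _ => 0) D (region V e) I cQ →
      HasInitialVelocity cQ q ((√(2 / (e - V q)) / gNorm g.inner q v) • v) →
      ∃ h : ℝ → ℝ, h 0 = 0 ∧ StrictMonoOn h J ∧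
        (∀ s ∈ J, HasDerivAt h (e - V (cP s)) s) ∧
        (∀ s ∈ J, h s ∈ I → cP s = cQ (h s)) ∧
        (IsMaximalTrajectory (jacobi g.inner V e) (fun _ => 0) D (region V e) I cQ →
          MapsTo h J I) ∧
        (IsMaximalTrajectory g.inner V D (region V e) J cP → I ⊆ h '' J)) := by
  have hG := isMetricOn_inner g
  have hJ := isMetricOn_jacobi g hV e
  refine ⟨level_set_facts hV hG hJ hD, contact_facts hV hG hJ hD, ?_⟩
  intro q hq v _ hv0 J I cP cQ hP hPi hQ hQi
  exact exists_jacobi_time_change hV (hG.mono hJ.isOpen (subset_univ _)) hJ hD hq hv0 hP hPi hQ hQi
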